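/- Setting. A probability algebra is a σ-complete Boolean algebra with a countably additive probability measure that is strictly positive on non-zero elements; a morphism $T\colon X\to Y$ of probability algebras is a measure-preserving Boolean homomorphism $T^*$ from the algebra of $Y$ to that of $X$. $\mathrm{Stone}(X)$ denotes the canonical model of $X$ (its Stone space with the induced Baire probability measure $\mu_{\mathrm{Stone}(X)}$), and $\mathrm{Stone}(T)\colon\mathrm{Stone}(X)\to\mathrm{Stone}(Y)$ the continuous map induced by $T$. All compact Hausdorff spaces carry the Baire σ-algebra. For a compact Hausdorff space $Z$, $\mathrm{Cond}_X(Z)$ is the set of Boolean homomorphisms from the Baire σ-algebra of $Z$ to the algebra of $X$ that preserve countable joins; each $\eta\in\mathrm{Cond}_X(Z)$ is represented by a unique continuous map $\tilde\eta\colon \mathrm{Stone}(X)\to Z$, and if $Z$ is a compact Hausdorff group, $\mathrm{Cond}_X(Z)$ is a group under pointwise multiplication of these representatives. If $H\le K$ is closed, $\mathrm{Cond}_X(H)$ is regarded as a subset of $\mathrm{Cond}_X(K)$. Let $\Gamma$ be a group, $K$ a compact Hausdorff group, $Y$ an ergodic probability algebra system of $\Gamma$ and $X$ an ergodic group extension of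 $Y$ by $K$: an ergodic probability algebra system of $\Gamma$ with a $\Gamma$-equivariant morphism $\pi\colon X\to Y$, a vertical coordinate $\theta\in \mathrm{Cond}_X(K)$ such that $\pi$ and $\theta$ generate the algebra of $X$, and conditional elements $\rho_\gamma\in\mathrm{Cond}_Y(K)$ with $\rho_{\gamma\gamma'}=(\rho_\gamma\circ T_Y^{\gamma'})\rho_{\gamma'}$ and $\theta\circ T_X^\gamma=(\rho_\gamma\circ\pi)\theta$ for all $\gamma,\gamma'\in\Gamma$. Let $Y\rtimes_\rho K$ be the probability algebra of $\mathrm{Stone}(Y)\times K$ with product measure $\mu_{\mathrm{Stone}(Y)}\times\mathrm{Haar}_K$, with the $\Gamma$-action induced by $(y,k)\mapsto(\mathrm{Stone}(T_Y^\gamma)(y),\tilde\rho_\gamma(y)k)$ and the commuting action of $K^{\mathrm{op}}$ induced by $(y,k)\mapsto (y,kk_0)$; let $X\rtimes_1 K$ be defined in the same way from $X$ and the trivial cocycle; and let $\Pi\colon X\rtimes_1K\to Y\rtimes_\rho K$ be induced by $(x,k)\mapsto(\mathrm{Stone}(\pi)(x),\tilde\theta(x)k)$. Write $\mathrm{Inv}$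 for the factor of $\Gamma$-invariant elements. A compact subgroup $H\le K$ is called a Mackey range of the extension if $\mathrm{Inv}(Y\rtimes_\rho K)$ is isomorphic to $H\backslash K$ (with Haar measure) as a factor of $K$; that is, if there is a morphism of probability algebras $\psi\colon Y\rtimes_\rho K\to H\backslash K$ such that $\psi^*$ maps onto the algebra of $\mathrm{Inv}(Y\rtimes_\rho K)$, $\psi$ is equivariant for the right translation actions of $K^{\mathrm{op}}$, and $\psi\circ\Pi$ equals the composition of the vertical coordinate $X\rtimes_1K\to K$ with the quotient map $K\to H\backslash K$. Claim. A Mackey range exists. For every Mackey range $H$: (i) there is $\Phi\in \mathrm{Cond}_Y(K)$ such that $\theta_*:=(\Phi\circ\pi)\theta$ lies in $\mathrm{Cond}_X(H)$; (ii) for every $\Phi\in\mathrm{Cond}_Y(K)$ with $\theta_*:=(\Phi\circ\pi)\theta\in\mathrm{Cond}_X(H)$, represented by the continuous map $\tilde\theta_*\colon\mathrm{Stone}(X)\to H$, one has $$\int_{\mathrm{Stone}(X)} (f\circ \mathrm{Stone}(\pi))\,(g\circ\tilde\theta_*)\,d\mu_{\mathrm{Stone}(X)}=\Big(\int_{\mathrm{Stone}(Y)}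 f\,d\mu_{\mathrm{Stone}(Y)}\Big)\Big(\int_H g\,d\mathrm{Haar}_H\Big)$$ for all $f\in C(\mathrm{Stone}(Y),\mathbb C)$ and $g\in C(H,\mathbb C)$; that is, $(\mathrm{Stone}(\pi),\tilde\theta_*)$ pushes $\mu_{\mathrm{Stone}(X)}$ forward to $\mu_{\mathrm{Stone}(Y)}\times\mathrm{Haar}_H$. -/

import Mathlib

open MeasureTheory Set Filter Topology
open scoped ENNReal

namespace MackeyZimmer

/-! ### Baire σ-algebras -/

/-- The Baire σ-algebra of a topological space, generated by the continuous functions. -/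
@[reducible] def baireSigma (Z : Type*) [TopologicalSpace Z] : MeasurableSpace Z :=
  ⨆ f : C(Z, ℝ), MeasurableSpace.comap f (borel ℝ)

/-- The measurable structure of `Z` is its Baire σ-algebra. -/
class BaireMeasurableSpace (Z : Type*) [TopologicalSpace Z] [m : MeasurableSpace Z] : Prop where
  eq_baire : m = baireSigma Z

theorem measurable_real_of_continuous {Z : Type*} [TopologicalSpace Z] [MeasurableSpace Z]
    [hZ : BaireMeasurableSpace Z] {f : Z → ℝ} (hf : Continuous f) : Measurable f := by
  rw [measurable_iff_comap_le, hZ.eq_baire]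
  rw [BorelSpace.measurable_eq (α := ℝ)]
  exact le_iSup (fun f : C(Z, ℝ) => MeasurableSpace.comap f (borel ℝ)) ⟨f, hf⟩

/-- A map into a Baire space is measurable as soon as its compositions with continuous
functions are. -/
theorem measurable_to_baire {A Z : Type*} [MeasurableSpace A] [TopologicalSpace Z]
    [MeasurableSpace Z] [hZ : BaireMeasurableSpace Z] {f : A → Z}
    (hf : ∀ g : C(Z, ℝ), Measurable fun a => g (f a)) : Measurable f := by
  rw [measurable_iff_comap_le, hZ.eq_baire, baireSigma, MeasurableSpace.comap_iSup]
  refine iSup_le fun g => ?_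
  rw [MeasurableSpace.comap_comp]
  have := (hf g).comap_le
  rw [BorelSpace.measurable_eq (α := ℝ)] at this
  exact this

theorem measurable_of_continuous {W Z : Type*} [TopologicalSpace W] [MeasurableSpace W]
    [BaireMeasurableSpace W] [TopologicalSpace Z] [MeasurableSpace Z] [BaireMeasurableSpace Z]
    {f : W → Z} (hf : Continuous f) : Measurable f :=
  measurable_to_baire fun g => measurable_real_of_continuous (g.continuous.comp hf)

/-- On a closed subspace of a compact Hausdorff space, the trace of the Baire σ-algebra is the
Baire σ-algebra of the subspace. -/
instance {Z : Type*} [TopologicalSpace Z] [MeasurableSpace Z] [hZ : BaireMeasurableSpace Z]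
    [CompactSpace Z] [T2Space Z] (p : Z → Prop) [CompactSpace (Subtype p)] :
    BaireMeasurableSpace (Subtype p) where
  eq_baire := by
    apply le_antisymm
    · change MeasurableSpace.comap _ _ ≤ _
      rw [hZ.eq_baire, baireSigma, MeasurableSpace.comap_iSup]
      refine iSup_le fun g => ?_
      rw [MeasurableSpace.comap_comp]
      exact le_iSup (fun f : C(Subtype p, ℝ) => MeasurableSpace.comap f (borel ℝ))
        ⟨fun x => g x, g.continuous.comp continuous_subtype_val⟩
    · refine iSup_le fun g => ?_
      have hc : IsClosedEmbedding (Subtype.val : Subtype p → Z) :=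
        continuous_subtype_val.isClosedEmbedding Subtype.val_injective
      obtain ⟨G, hG⟩ := ContinuousMap.exists_extension hc g
      have hm : Measurable fun x : Subtype p => G x :=
        (measurable_real_of_continuous G.continuous).comp measurable_subtype_coe
      have : (g : Subtype p → ℝ) = fun x : Subtype p => G x.1 := by
        funext x
        exact (congrArg (fun F : C(Subtype p, ℝ) => F x) hG).symm
      rw [this, ← BorelSpace.measurable_eq (α := ℝ)]
      exact hm.comap_le

/-! ### Probability algebras -/

/-- A probability algebra: a σ-complete Boolean algebra with a countably additive probability
measure which is strictly positive on non-zero elements. -/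
class ProbAlg (B : Type*) extends BooleanAlgebra B where
  /-- the probability measure -/
  mu : B → ℝ
  mu_nonneg : ∀ a, 0 ≤ mu a
  mu_top : mu ⊤ = 1
  exists_isLUB : ∀ f : ℕ → B, ∃ s, IsLUB (range f) s
  hasSum_mu : ∀ (f : ℕ → B) (s : B), Pairwise (Function.onFun Disjoint f) → IsLUB (range f) s →
    HasSum (fun n => mu (f n)) (mu s)
  eq_bot_of_mu_eq_zero : ∀ a, mu a = 0 → a = ⊥

namespace ProbAlg

variable {B : Type*} [ProbAlg B]

theorem mu_bot : mu (⊥ : B) = 0 := by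
  have h := hasSum_mu (fun _ : ℕ => (⊥ : B)) ⊥ (fun _ _ _ => disjoint_bot_left)
    (by simp [isLUB_singleton])
  exact (summable_const_iff _).1 h.summable

theorem mu_sup {a b : B} (h : Disjoint a b) : mu (a ⊔ b) = mu a + mu b := by
  let f : ℕ → B := fun n => if n = 0 then a else if n = 1 then b else ⊥
  have hd : Pairwise (Function.onFun Disjoint f) := by
    intro i j hij
    simp only [Function.onFun, f]
    split_ifs <;> simp_all [disjoint_comm]
  have hl : IsLUB (range f) (a ⊔ b) := by
    constructor
    · rintro _ ⟨n, rfl⟩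
      simp only [f]; split_ifs <;> simp
    · intro c hc
      exact sup_le (by simpa [f] using hc ⟨0, rfl⟩) (by simpa [f] using hc ⟨1, rfl⟩)
  have h1 := hasSum_mu f _ hd hl
  have h2 : HasSum (fun n => mu (f n)) (∑ n ∈ Finset.range 2, mu (f n)) := by
    apply hasSum_sum_of_ne_finset_zero
    intro n hn
    have : f n = ⊥ := by
      simp only [Finset.mem_range, not_lt] at hn
      simp only [f]; rw [if_neg (by omega), if_neg (by omega)]
    rw [this, mu_bot]
  rw [h1.unique h2]
  simp [Finset.sum_range_succ, f]

theorem mu_sdiff {a b : B} (h : a ≤ b) : mu (b \ a) = mu b - mu a := by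
  have := mu_sup (B := B) (a := a) (b := b \ a) disjoint_sdiff_self_right
  rw [sup_sdiff_cancel_right h] at this
  linarith

theorem mu_mono {a b : B} (h : a ≤ b) : mu a ≤ mu b := by
  have := mu_sdiff h
  have := mu_nonneg (b \ a)
  linarith

theorem tendsto_mu_partialSups (f : ℕ → B) (s : B) (h : IsLUB (range f) s) :
    Tendsto (fun n => mu (partialSups f n)) atTop (𝓝 (mu s)) := by
  have hl : IsLUB (range (disjointed f)) s := by
    constructor
    · rintro _ ⟨n, rfl⟩
      exact (disjointed_le f n).trans (h.1 ⟨n, rfl⟩)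
    · intro c hc
      refine h.2 ?_
      rintro _ ⟨n, rfl⟩
      refine (le_partialSups f n).trans ?_
      rw [← partialSups_disjointed]
      exact partialSups_le _ _ _ fun i _ => hc ⟨i, rfl⟩
  have hs := (hasSum_mu _ _ (disjoint_disjointed f) hl).tendsto_sum_nat
  have he : ∀ n, mu (partialSups f n) = ∑ i ∈ Finset.range (n + 1), mu (disjointed f i) := by
    intro n
    rw [← partialSups_disjointed]
    induction n with
    | zero => simp
    | succ n ih =>
      rw [Finset.sum_range_succ, ← ih, ← Order.succ_eq_add_one, partialSups_succ, mu_sup]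
      rw [partialSups_disjointed]
      rw [disjointed_succ f (i := n) (not_isMax n)]
      exact disjoint_sdiff_self_right
  simp_rw [he]
  exact (tendsto_add_atTop_iff_nat 1).2 hs

end ProbAlg

open ProbAlg

/-- The pullback map `T^* : B → A` of a morphism of probability algebras (which, as an arrow,
points from `A` to `B`): a measure-preserving homomorphism of Boolean algebras. -/
structure ProbAlgHom (B A : Type*) [ProbAlg B] [ProbAlg A] extends BoundedLatticeHom B A where
  mu_map : ∀ b, mu (toFun b) = mu b

namespace ProbAlgHom

variable {A B : Type*} [ProbAlg A] [ProbAlg B]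

instance : FunLike (ProbAlgHom B A) B A where
  coe φ := φ.toFun
  coe_injective := by
    rintro ⟨φ, hφ⟩ ⟨ψ, hψ⟩ h
    congr
    exact DFunLike.coe_injective h

instance : BoundedLatticeHomClass (ProbAlgHom B A) B A where
  map_sup φ := φ.map_sup'
  map_inf φ := φ.map_inf'
  map_top φ := φ.map_top'
  map_bot φ := φ.map_bot'

theorem mu_apply (φ : ProbAlgHom B A) (b : B) : mu (φ b) = mu b := φ.mu_map b

/-- A morphism of probability algebras automatically preserves countable joins. -/
theorem isLUB_map (φ : ProbAlgHom B A) {f : ℕ → B} {s : B} (h : IsLUB (range f) s) :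
    IsLUB (range fun n => φ (f n)) (φ s) := by
  constructor
  · rintro _ ⟨n, rfl⟩
    exact OrderHomClass.mono φ (h.1 ⟨n, rfl⟩)
  · intro t ht
    have hp : ∀ n, φ (partialSups f n) ≤ t := by
      intro n
      induction n with
      | zero => simpa using ht ⟨0, rfl⟩
      | succ n ih =>
        rw [← Order.succ_eq_add_one, partialSups_succ]
        exact (map_sup φ _ _).trans_le (sup_le ih (ht ⟨_, rfl⟩))
    have hle : ∀ n, partialSups f n ≤ s := fun n => partialSups_le _ _ _ fun i _ => h.1 ⟨i, rfl⟩
    have hb : ∀ n, mu (φ s \ t) ≤ mu s - mu (partialSups f n) := by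
      intro n
      rw [← mu_apply φ s, ← mu_apply φ (partialSups f n),
        ← mu_sdiff (OrderHomClass.mono φ (hle n))]
      exact mu_mono (sdiff_le_sdiff_left (hp n))
    have hlim : Tendsto (fun n => mu s - mu (partialSups f n)) atTop (𝓝 (mu s - mu s)) :=
      tendsto_const_nhds.sub (tendsto_mu_partialSups f s h)
    rw [sub_self] at hlim
    have h0 := ge_of_tendsto' hlim hb
    exact sdiff_eq_bot_iff.1 (eq_bot_of_mu_eq_zero _ (le_antisymm h0 (mu_nonneg _)))

end ProbAlgHom

/-! ### Conditional elements -/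

/-- A conditional element of the measurable space `Z` over the probability algebra `B`: a
morphism from `B` to `Z` in the category of abstract measurable spaces, i.e. a Boolean
homomorphism from the σ-algebra of `Z` to `B` that preserves countable joins (hence also
countable meets). -/
structure Cond (B Z : Type*) [ProbAlg B] [MeasurableSpace Z] extends
    BoundedLatticeHom {s : Set Z // MeasurableSet s} B where
  isLUB_map' : ∀ f : ℕ → {s : Set Z // MeasurableSet s},
    IsLUB (range fun n => toFun (f n)) (toFun ⟨⋃ n, (f n).1, MeasurableSet.iUnion fun n => (f n).2⟩)

namespace Cond

variable {A B Z W : Type*} [ProbAlg A] [ProbAlg B] [MeasurableSpace Z] [MeasurableSpace W]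

instance : FunLike (Cond B Z) {s : Set Z // MeasurableSet s} B where
  coe φ := φ.toFun
  coe_injective := by
    rintro ⟨φ, hφ⟩ ⟨ψ, hψ⟩ h
    congr
    exact DFunLike.coe_injective h

instance : BoundedLatticeHomClass (Cond B Z) {s : Set Z // MeasurableSet s} B where
  map_sup φ := φ.map_sup'
  map_inf φ := φ.map_inf'
  map_top φ := φ.map_top'
  map_bot φ := φ.map_bot'

theorem isLUB_map (θ : Cond B Z) (f : ℕ → {s : Set Z // MeasurableSet s}) :
    IsLUB (range fun n => θ (f n)) (θ ⟨⋃ n, (f n).1, MeasurableSet.iUnion fun n => (f n).2⟩) :=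
  θ.isLUB_map' f

/-- Composition of a conditional element with a measurable map `Z → W`. -/
def map (f : Z → W) (hf : Measurable f) (θ : Cond B Z) : Cond B W where
  toFun s := θ ⟨f ⁻¹' s.1, hf s.2⟩
  map_sup' s t := θ.map_sup' ⟨f ⁻¹' s.1, hf s.2⟩ ⟨f ⁻¹' t.1, hf t.2⟩
  map_inf' s t := θ.map_inf' ⟨f ⁻¹' s.1, hf s.2⟩ ⟨f ⁻¹' t.1, hf t.2⟩
  map_top' := map_top θ
  map_bot' := map_bot θ
  isLUB_map' s := by
    have := θ.isLUB_map fun n => ⟨f ⁻¹' (s n).1, hf (s n).2⟩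
    simpa only [preimage_iUnion] using this

/-- Base change: the composition `θ ∘ Inc(T)` of a conditional element over `B` with a
probability algebra morphism, given by its pullback map `φ = T^* : B → A`. -/
def pull (φ : ProbAlgHom B A) (θ : Cond B Z) : Cond A Z where
  toFun s := φ (θ s)
  map_sup' s t := (congrArg φ (θ.map_sup' s t)).trans (map_sup φ _ _)
  map_inf' s t := (congrArg φ (θ.map_inf' s t)).trans (map_inf φ _ _)
  map_top' := (congrArg φ θ.map_top').trans (map_top φ)
  map_bot' := (congrArg φ θ.map_bot').trans (map_bot φ)
  isLUB_map' s := φ.isLUB_map (θ.isLUB_map s)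

end Cond

/-! ### The canonical model -/

/-- The Stone space of a Boolean algebra: the Boolean homomorphisms to the two-element algebra,
with the topology of pointwise convergence. -/
def Stone (B : Type*) [BooleanAlgebra B] : Type _ :=
  {p : B → Bool // p ⊤ = true ∧ p ⊥ = false ∧ ∀ a b, p (a ⊓ b) = (p a && p b) ∧
    p (a ⊔ b) = (p a || p b)}

namespace Stone

section Topology

variable {B : Type*} [BooleanAlgebra B]

instance : TopologicalSpace (Stone B) := instTopologicalSpaceSubtype

/-- The Stone space is equipped with its Baire σ-algebra. -/
instance : MeasurableSpace (Stone B) := baireSigma (Stone B)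

instance : BaireMeasurableSpace (Stone B) := ⟨rfl⟩

instance : T2Space (Stone B) := inferInstanceAs (T2Space (Subtype _))

instance : TotallyDisconnectedSpace (Stone B) :=
  inferInstanceAs (TotallyDisconnectedSpace (Subtype _))

instance : CompactSpace (Stone B) := by
  refine isCompact_iff_compactSpace (s := {p : B → Bool | p ⊤ = true ∧ p ⊥ = false ∧
    ∀ a b, p (a ⊓ b) = (p a && p b) ∧ p (a ⊔ b) = (p a || p b)}).1 (IsClosed.isCompact ?_)
  simp only [ofPred_and, ofPred_forall]
  have hc : ∀ a : B, Continuous fun p : B → Bool => p a := fun a => continuous_apply a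
  refine (isClosed_eq (hc _) continuous_const).inter ((isClosed_eq (hc _) continuous_const).inter
    (isClosed_iInter fun a => isClosed_iInter fun b => (isClosed_eq (hc _) ?_).inter
      (isClosed_eq (hc _) ?_)))
  · exact (continuous_of_discreteTopology (f := fun x : Bool × Bool => (x.1 && x.2))).comp
      ((hc a).prodMk (hc b))
  · exact (continuous_of_discreteTopology (f := fun x : Bool × Bool => (x.1 || x.2))).comp
      ((hc a).prodMk (hc b))

/-- The clopen subset of the Stone space attached to an element of the Boolean algebra. -/
def clopen (a : B) : Set (Stone B) := {p | p.1 a = true}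

theorem mem_clopen {a : B} {p : Stone B} : p ∈ clopen a ↔ p.1 a = true := Iff.rfl

@[simp] theorem clopen_top : clopen (⊤ : B) = univ := by
  ext p; simp [mem_clopen, p.2.1]

@[simp] theorem clopen_bot : clopen (⊥ : B) = ∅ := by
  ext p; simp [mem_clopen, p.2.2.1]

@[simp] theorem clopen_inf (a b : B) : clopen (a ⊓ b) = clopen a ∩ clopen b := by
  ext p; simp [mem_clopen, (p.2.2.2 a b).1]

@[simp] theorem clopen_sup (a b : B) : clopen (a ⊔ b) = clopen a ∪ clopen b := by
  ext p; simp [mem_clopen, (p.2.2.2 a b).2]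

@[simp] theorem clopen_compl (a : B) : clopen aᶜ = (clopen a)ᶜ := by
  refine (IsCompl.compl_eq ?_).symm
  constructor
  · rw [Set.disjoint_iff_inter_eq_empty, ← clopen_inf, inf_compl_self, clopen_bot]
  · exact codisjoint_iff.2 ((clopen_sup a aᶜ).symm.trans (by rw [sup_compl_eq_top, clopen_top]; rfl))

@[simp] theorem clopen_sdiff (a b : B) : clopen (a \ b) = clopen a \ clopen b := by
  rw [_root_.sdiff_eq, clopen_inf, clopen_compl]; rfl

theorem isClopen_clopen (a : B) : IsClopen (clopen a) := by
  have hc : Continuous fun p : Stone B => p.1 a :=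
    (continuous_apply a).comp continuous_subtype_val
  exact (isClopen_discrete {true}).preimage hc

theorem nonempty_clopen {a : B} (ha : a ≠ ⊥) : (clopen a).Nonempty := by
  have hd : Disjoint ((Order.PFilter.principal a : Order.PFilter B) : Set B)
      ((⊥ : Order.Ideal B) : Set B) := by
    rw [Set.disjoint_left]
    intro x hx hx'
    have h1 : a ≤ x := hx
    have h2 : x = ⊥ := le_bot_iff.1 hx'
    exact ha (le_bot_iff.1 (h2 ▸ h1))
  obtain ⟨J, hJ, -, hJd⟩ := DistribLattice.prime_ideal_of_disjoint_filter_ideal hd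
  classical
  have hnt : (⊤ : B) ∉ J := by
    intro h
    exact hJ.ne_univ (Set.eq_univ_of_forall fun x => J.lower le_top h)
  refine ⟨⟨fun b => decide (b ∉ J), by simp [hnt], by simp, fun x y => ⟨?_, ?_⟩⟩, ?_⟩
  · have : x ⊓ y ∈ J ↔ x ∈ J ∨ y ∈ J :=
      ⟨hJ.mem_or_mem, fun h => h.elim (J.lower inf_le_left) (J.lower inf_le_right)⟩
    by_cases h1 : x ∈ J <;> by_cases h2 : y ∈ J <;> simp [this, h1, h2]
  · by_cases h1 : x ∈ J <;> by_cases h2 : y ∈ J <;> simp [Order.Ideal.sup_mem_iff, h1, h2]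
  · have : a ∉ J := fun h => Set.disjoint_left.1 hJd (show a ≤ a from le_rfl) h
    exact decide_eq_true this

theorem clopen_subset_clopen {a b : B} : clopen a ⊆ clopen b ↔ a ≤ b := by
  constructor
  · intro h
    by_contra hn
    obtain ⟨p, hp⟩ := nonempty_clopen (a := a \ b) (fun h => hn (sdiff_eq_bot_iff.1 h))
    rw [clopen_sdiff] at hp
    exact hp.2 (h hp.1)
  · intro h
    rw [← inf_eq_left.2 h, clopen_inf]
    exact inter_subset_right

theorem clopen_injective : Function.Injective (clopen : B → Set (Stone B)) := fun _ _ h =>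
  le_antisymm (clopen_subset_clopen.1 h.le) (clopen_subset_clopen.1 h.ge)

/-- The sets attached to elements of the algebra form a basis of neighbourhoods. -/
theorem exists_clopen_mem_subset {U : Set (Stone B)} (hU : IsOpen U) {p : Stone B} (hp : p ∈ U) :
    ∃ a, p ∈ clopen a ∧ clopen a ⊆ U := by
  obtain ⟨V, hV, rfl⟩ := isOpen_induced_iff.1 hU
  obtain ⟨I, u, hu, hsub⟩ := isOpen_pi_iff.1 hV p.1 hp
  refine ⟨I.inf fun b => if p.1 b then b else bᶜ, ?_, ?_⟩
  · have : ∀ J : Finset B, p ∈ clopen (J.inf fun b => if p.1 b then b else bᶜ) := by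
      classical
      intro J
      induction J using Finset.induction with
      | empty => simp
      | insert b J hb ih =>
        rw [Finset.inf_insert, clopen_inf]
        refine ⟨?_, ih⟩
        by_cases h : p.1 b = true
        · rw [if_pos h]; exact h
        · simp only [h, Bool.false_eq_true, if_false, clopen_compl]
          exact h
    exact this I
  · intro q hq
    refine hsub fun b hb => ?_
    have h1 : q ∈ clopen (if p.1 b then b else bᶜ) :=
      clopen_subset_clopen.2 (Finset.inf_le (f := fun b => if p.1 b then b else bᶜ) hb) hq
    have h2 : q.1 b = p.1 b := by
      by_cases h : p.1 b = true
      · rw [if_pos h] at h1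
        rw [h]; exact h1
      · rw [if_neg h, clopen_compl] at h1
        simp only [Bool.not_eq_true] at h
        rw [h]
        simpa [mem_clopen] using h1
    rw [h2]
    exact (hu b hb).2

/-- Between a compact set and an open set there is a set attached to an element. -/
theorem exists_clopen_between {C U : Set (Stone B)} (hC : IsCompact C) (hU : IsOpen U)
    (h : C ⊆ U) : ∃ a, C ⊆ clopen a ∧ clopen a ⊆ U := by
  refine hC.induction_on (p := fun C => ∃ a, C ⊆ clopen a ∧ clopen a ⊆ U) ?_ ?_ ?_ ?_
  · exact ⟨⊥, by simp, by simp⟩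
  · rintro s t hst ⟨a, h1, h2⟩
    exact ⟨a, hst.trans h1, h2⟩
  · rintro s t ⟨a, h1, h2⟩ ⟨b, h3, h4⟩
    exact ⟨a ⊔ b, by rw [clopen_sup]; exact union_subset_union h1 h3,
      by rw [clopen_sup]; exact union_subset h2 h4⟩
  · intro x hx
    obtain ⟨a, ha, haU⟩ := exists_clopen_mem_subset hU (h hx)
    exact ⟨clopen a, mem_nhdsWithin_of_mem_nhds ((isClopen_clopen a).isOpen.mem_nhds ha), a,
      subset_rfl, haU⟩

theorem measurable_of_le {m : MeasurableSpace (Stone B)} (hm : ∀ a : B, MeasurableSet[m] (clopen a)) :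
    baireSigma (Stone B) ≤ m := by
  refine iSup_le fun g => ?_
  rw [← BorelSpace.measurable_eq (α := ℝ), ← measurable_iff_comap_le]
  refine measurable_of_Iic (mδ := m) (f := g) fun c => ?_
  have hb : ∀ n : ℕ, ∃ a : B, g ⁻¹' Iic c ⊆ clopen a ∧ clopen a ⊆ g ⁻¹' Iio (c + 1 / (n + 1)) := by
    intro n
    refine exists_clopen_between (isClosed_Iic.preimage g.continuous).isCompact
      (isOpen_Iio.preimage g.continuous) ?_
    intro x hx
    have : (0 : ℝ) < 1 / (n + 1) := Nat.one_div_pos_of_nat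
    simp only [mem_preimage, mem_Iic, mem_Iio] at hx ⊢
    linarith
  choose a ha1 ha2 using hb
  have he : g ⁻¹' Iic c = ⋂ n, clopen (a n) := by
    refine subset_antisymm (subset_iInter ha1) fun x hx => ?_
    have hlim : Tendsto (fun n : ℕ => c + 1 / ((n : ℝ) + 1)) atTop (𝓝 (c + 0)) :=
      tendsto_const_nhds.add tendsto_one_div_add_atTop_nhds_zero_nat
    rw [add_zero] at hlim
    exact ge_of_tendsto' hlim fun n => le_of_lt (ha2 n (mem_iInter.1 hx n))
  rw [he]
  exact MeasurableSet.iInter fun n => hm (a n)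

theorem measurableSet_clopen (a : B) : MeasurableSet (clopen a) := by
  have hc : Continuous ((clopen a).indicator (fun _ => (1 : ℝ))) :=
    (isClopen_clopen a).continuous_indicator continuous_const
  have := measurable_real_of_continuous hc (measurableSet_singleton (1 : ℝ))
  convert this using 1
  ext p
  by_cases h : p ∈ clopen a <;> simp [h]

end Topology

section Measure

variable (B : Type*) [ProbAlg B]

theorem isSetRing_range_clopen : IsSetRing (range (clopen : B → Set (Stone B))) where
  empty_mem := ⟨⊥, clopen_bot⟩
  union_mem := by
    rintro _ _ ⟨a, rfl⟩ ⟨b, rfl⟩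
    exact ⟨a ⊔ b, clopen_sup a b⟩
  sdiff_mem := by
    rintro _ _ ⟨a, rfl⟩ ⟨b, rfl⟩
    exact ⟨a \ b, clopen_sdiff a b⟩

open Classical in
/-- The content on clopen sets given by the measure of the corresponding element. -/
noncomputable def contentFun (s : Set (Stone B)) : ℝ≥0∞ :=
  if h : ∃ a : B, clopen a = s then ENNReal.ofReal (mu h.choose) else 0

theorem contentFun_clopen (a : B) : contentFun B (clopen a) = ENNReal.ofReal (mu a) := by
  have h : ∃ b : B, clopen b = clopen a := ⟨a, rfl⟩
  rw [contentFun, dif_pos h, clopen_injective h.choose_spec]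

/-- The finitely additive content on clopen sets. -/
noncomputable def content : AddContent ℝ≥0∞ (range (clopen : B → Set (Stone B))) :=
  (isSetRing_range_clopen B).addContent_of_union (contentFun B)
    (by rw [← clopen_bot, contentFun_clopen, mu_bot, ENNReal.ofReal_zero])
    (by
      rintro _ _ ⟨a, rfl⟩ ⟨b, rfl⟩ hd
      have hd' : Disjoint a b := by
        rw [disjoint_iff, ← clopen_injective.eq_iff, clopen_inf, clopen_bot]
        exact Set.disjoint_iff_inter_eq_empty.1 hd
      rw [← clopen_sup, contentFun_clopen, contentFun_clopen, contentFun_clopen, mu_sup hd',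
        ENNReal.ofReal_add (mu_nonneg a) (mu_nonneg b)])

theorem content_clopen (a : B) : content B (clopen a) = ENNReal.ofReal (mu a) :=
  contentFun_clopen B a

theorem content_isSigmaSubadditive : (content B).IsSigmaSubadditive := by
  intro f hf hU
  obtain ⟨s, hs⟩ := hU
  have hcl : ∀ i, IsOpen (f i) := fun i => by
    obtain ⟨a, ha⟩ := hf i
    rw [← ha]; exact (isClopen_clopen a).isOpen
  obtain ⟨t, ht⟩ := (hs ▸ (isClopen_clopen s).isClosed.isCompact :
    IsCompact (⋃ i, f i)).elim_finite_subcover f hcl subset_rfl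
  have he : ⋃ i, f i = ⋃ i ∈ t, f i := subset_antisymm ht (iUnion₂_subset fun i _ =>
    subset_iUnion f i)
  rw [he]
  exact (addContent_biUnion_le (isSetRing_range_clopen B) fun i _ => hf i).trans
    (ENNReal.sum_le_tsum t)

/-- The probability measure on the Stone space giving the clopen set attached to `a` the
measure of `a`. Together with it, the Stone space is the canonical model of the probability
algebra `B`. -/
noncomputable def measure : Measure (Stone B) :=
  (content B).measure (isSetRing_range_clopen B).isSetSemiring
    (measurable_of_le fun a => MeasurableSpace.measurableSet_generateFrom (mem_range_self a))
    (content_isSigmaSubadditive B)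

variable {B}

theorem measure_clopen (a : B) : measure B (clopen a) = ENNReal.ofReal (mu a) := by
  rw [← content_clopen, measure]
  exact AddContent.measure_eq _ _ (le_antisymm
    (measurable_of_le fun a => MeasurableSpace.measurableSet_generateFrom (mem_range_self a))
    (MeasurableSpace.generateFrom_le (by rintro _ ⟨a, rfl⟩; exact measurableSet_clopen a)))
    _ (mem_range_self a)

instance : IsProbabilityMeasure (measure B) :=
  ⟨by rw [← clopen_top, measure_clopen, mu_top, ENNReal.ofReal_one]⟩

theorem clopen_ae_le_iff {a b : B} : clopen a ≤ᵐ[measure B] clopen b ↔ a ≤ b := by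
  constructor
  · intro h
    have h0 : measure B (clopen a \ clopen b) = 0 := ae_le_set.1 h
    rw [← clopen_sdiff, measure_clopen, ENNReal.ofReal_eq_zero] at h0
    exact sdiff_eq_bot_iff.1 (eq_bot_of_mu_eq_zero _ (le_antisymm h0 (mu_nonneg _)))
  · intro h
    exact (clopen_subset_clopen.2 h).eventuallyLE

theorem clopen_ae_eq_iff {a b : B} : clopen a =ᵐ[measure B] clopen b ↔ a = b :=
  ⟨fun h => le_antisymm (clopen_ae_le_iff.1 h.le) (clopen_ae_le_iff.1 h.symm.le),
    fun h => h ▸ EventuallyEq.rfl⟩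

theorem clopen_isLUB_ae_eq {f : ℕ → B} {s : B} (h : IsLUB (range f) s) :
    clopen s =ᵐ[measure B] ⋃ n, clopen (f n) := by
  have hsub : ⋃ n, clopen (f n) ⊆ clopen s :=
    iUnion_subset fun n => clopen_subset_clopen.2 (h.1 ⟨n, rfl⟩)
  refine EventuallyLE.antisymm (ae_le_set.2 ?_) hsub.eventuallyLE
  have hps : ∀ n, clopen (partialSups f n) ⊆ ⋃ n, clopen (f n) := by
    intro n
    induction n with
    | zero => simpa using subset_iUnion (fun n => clopen (f n)) 0
    | succ n ih =>
      rw [← Order.succ_eq_add_one, partialSups_succ, clopen_sup]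
      exact union_subset ih (subset_iUnion (fun n => clopen (f n)) _)
  have hle : ∀ n, partialSups f n ≤ s := fun n => partialSups_le _ _ _ fun i _ => h.1 ⟨i, rfl⟩
  have hb : ∀ n, measure B (clopen s \ ⋃ n, clopen (f n)) ≤
      ENNReal.ofReal (mu s - mu (partialSups f n)) := by
    intro n
    rw [← mu_sdiff (hle n), ← measure_clopen, clopen_sdiff]
    exact measure_mono (sdiff_subset_sdiff_right (hps n))
  have hlim : Tendsto (fun n => ENNReal.ofReal (mu s - mu (partialSups f n))) atTop
      (𝓝 (ENNReal.ofReal (mu s - mu s))) :=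
    ENNReal.tendsto_ofReal (tendsto_const_nhds.sub (tendsto_mu_partialSups f s h))
  rw [sub_self, ENNReal.ofReal_zero] at hlim
  exact le_antisymm (ge_of_tendsto' hlim hb) (by simp)

/-- Every Baire set of the canonical model agrees almost everywhere with a clopen set. -/
theorem exists_clopen_ae_eq {E : Set (Stone B)} (hE : MeasurableSet E) :
    ∃ a : B, E =ᵐ[measure B] clopen a := by
  let m : MeasurableSpace (Stone B) :=
    { MeasurableSet' := fun E => ∃ a : B, E =ᵐ[measure B] clopen a
      measurableSet_empty := ⟨⊥, by rw [clopen_bot]; exact EventuallyEq.rfl⟩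
      measurableSet_compl := by
        rintro E ⟨a, ha⟩
        exact ⟨aᶜ, by rw [clopen_compl]; exact ha.compl⟩
      measurableSet_iUnion := by
        intro f hf
        choose a ha using hf
        obtain ⟨s, hs⟩ := exists_isLUB a
        exact ⟨s, (Filter.EventuallyEq.countable_iUnion ha).trans (clopen_isLUB_ae_eq hs).symm⟩ }
  exact measurable_of_le (m := m) (fun a => ⟨a, EventuallyEq.rfl⟩) E hE

/-- The element of the probability algebra represented by a Baire set of its canonical model. -/
noncomputable def cls (E : {s : Set (Stone B) // MeasurableSet s}) : B :=
  (exists_clopen_ae_eq E.2).choose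

theorem ae_eq_clopen_cls (E : {s : Set (Stone B) // MeasurableSet s}) :
    E.1 =ᵐ[measure B] clopen (cls E) := (exists_clopen_ae_eq E.2).choose_spec

theorem cls_eq_iff {E : {s : Set (Stone B) // MeasurableSet s}} {a : B} :
    cls E = a ↔ E.1 =ᵐ[measure B] clopen a := by
  rw [← clopen_ae_eq_iff]
  exact ⟨fun h => (ae_eq_clopen_cls E).trans h, fun h => (ae_eq_clopen_cls E).symm.trans h⟩

/-- Non-empty open sets have positive measure. -/
theorem measure_pos_of_isOpen {U : Set (Stone B)} (hU : IsOpen U) (hne : U.Nonempty) :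
    measure B U ≠ 0 := by
  obtain ⟨p, hp⟩ := hne
  obtain ⟨a, ha, haU⟩ := exists_clopen_mem_subset hU hp
  intro h0
  have h1 : measure B (clopen a) = 0 := measure_mono_null haU h0
  rw [measure_clopen, ENNReal.ofReal_eq_zero] at h1
  have := eq_bot_of_mu_eq_zero a (le_antisymm h1 (mu_nonneg _))
  rw [this, clopen_bot] at ha
  exact ha

end Measure

section Map

variable {A B : Type*} [ProbAlg A] [ProbAlg B]

/-- The canonical model of a morphism, given by its pullback map `φ : B → A`. -/
def map (φ : ProbAlgHom B A) : C(Stone A, Stone B) where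
  toFun p := ⟨fun b => p.1 (φ b), (congrArg p.1 (map_top φ)).trans p.2.1,
    (congrArg p.1 (map_bot φ)).trans p.2.2.1,
    fun a b => ⟨(congrArg p.1 (map_inf φ a b)).trans (p.2.2.2 _ _).1,
      (congrArg p.1 (map_sup φ a b)).trans (p.2.2.2 _ _).2⟩⟩
  continuous_toFun := by
    refine continuous_induced_rng.2 ?_
    exact continuous_pi fun b => (continuous_apply (φ b)).comp continuous_subtype_val

theorem map_preimage_clopen (φ : ProbAlgHom B A) (b : B) :
    map φ ⁻¹' clopen b = clopen (φ b) := by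
  ext p; exact Iff.rfl

theorem measurePreserving_map (φ : ProbAlgHom B A) :
    MeasurePreserving (map φ) (measure A) (measure B) := by
  have hm : Measurable (map φ) := measurable_of_continuous (map φ).continuous
  refine ⟨hm, ?_⟩
  have := Measure.isProbabilityMeasure_map (μ := measure A) hm.aemeasurable
  refine MeasureTheory.ext_of_generate_finite (range clopen) (le_antisymm
    (measurable_of_le fun a => MeasurableSpace.measurableSet_generateFrom (mem_range_self a))
    (MeasurableSpace.generateFrom_le (by rintro _ ⟨a, rfl⟩; exact measurableSet_clopen a)))
    ?_ ?_ (by simp)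
  · rintro _ ⟨a, rfl⟩ _ ⟨b, rfl⟩ -
    exact ⟨a ⊓ b, clopen_inf a b⟩
  · rintro _ ⟨b, rfl⟩
    rw [Measure.map_apply hm (measurableSet_clopen b), map_preimage_clopen, measure_clopen,
      measure_clopen, φ.mu_apply]

end Map

end Stone

namespace Cond

section Rep

variable {B Z : Type*} [ProbAlg B] [TopologicalSpace Z] [MeasurableSpace Z]
  [BaireMeasurableSpace Z]

/-- The conditional element represented by a continuous map on the canonical model. -/
noncomputable def ofRep (f : C(Stone B, Z)) : Cond B Z where
  toFun E := Stone.cls ⟨f ⁻¹' E.1, measurable_of_continuous f.continuous E.2⟩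
  map_sup' s t := by
    rw [Stone.cls_eq_iff, Stone.clopen_sup]
    exact (Stone.ae_eq_clopen_cls ⟨f ⁻¹' s.1, _⟩).union (Stone.ae_eq_clopen_cls ⟨f ⁻¹' t.1, _⟩)
  map_inf' s t := by
    rw [Stone.cls_eq_iff, Stone.clopen_inf]
    exact (Stone.ae_eq_clopen_cls ⟨f ⁻¹' s.1, _⟩).inter (Stone.ae_eq_clopen_cls ⟨f ⁻¹' t.1, _⟩)
  map_top' := by
    rw [Stone.cls_eq_iff, Stone.clopen_top]
    exact EventuallyEq.rfl
  map_bot' := by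
    rw [Stone.cls_eq_iff, Stone.clopen_bot]
    exact EventuallyEq.rfl
  isLUB_map' s := by
    obtain ⟨t, ht⟩ := exists_isLUB fun n =>
      Stone.cls (B := B) ⟨f ⁻¹' (s n).1, measurable_of_continuous f.continuous (s n).2⟩
    refine Eq.subst (motive := fun x => IsLUB _ x) ?_ ht
    symm
    rw [Stone.cls_eq_iff]
    refine EventuallyEq.trans ?_ (Stone.clopen_isLUB_ae_eq ht).symm
    simp only [preimage_iUnion]
    exact Filter.EventuallyEq.countable_iUnion fun n => Stone.ae_eq_clopen_cls ⟨f ⁻¹' (s n).1, _⟩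

theorem preimage_ae_eq_ofRep (f : C(Stone B, Z)) (E : {s : Set Z // MeasurableSet s}) :
    f ⁻¹' E.1 =ᵐ[Stone.measure B] Stone.clopen (ofRep f E) :=
  Stone.ae_eq_clopen_cls ⟨f ⁻¹' E.1, _⟩

theorem ofRep_eq_iff {f : C(Stone B, Z)} {θ : Cond B Z} :
    ofRep f = θ ↔ ∀ E, f ⁻¹' E.1 =ᵐ[Stone.measure B] Stone.clopen (θ E) := by
  refine ⟨fun h E => h ▸ preimage_ae_eq_ofRep f E, fun h => DFunLike.ext _ _ fun E => ?_⟩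
  rw [← Stone.clopen_ae_eq_iff]
  exact (preimage_ae_eq_ofRep f E).symm.trans (h E)

theorem exists_separating {Z : Type*} [TopologicalSpace Z] [CompactSpace Z] [T2Space Z] {z w : Z} (h : z ≠ w) : ∃ g : C(Z, ℝ), g z = 0 ∧ g w = 1 := by
  obtain ⟨g, h0, h1, -⟩ := exists_continuous_zero_one_of_isClosed (isClosed_singleton (x := z))
    (isClosed_singleton (x := w)) (by simpa using h)
  exact ⟨g, h0 rfl, h1 rfl⟩

variable [CompactSpace Z] [T2Space Z]

theorem ofRep_injective : Function.Injective (ofRep : C(Stone B, Z) → Cond B Z) := by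
  intro f f' h
  ext p
  by_contra hne
  obtain ⟨g, h0, h1⟩ := exists_separating hne
  have hg : Measurable g := measurable_real_of_continuous g.continuous
  let E : {s : Set Z // MeasurableSet s} := ⟨g ⁻¹' Iio (1 / 2), hg measurableSet_Iio⟩
  have hE : f ⁻¹' E.1 =ᵐ[Stone.measure B] f' ⁻¹' E.1 :=
    (preimage_ae_eq_ofRep f E).trans (h ▸ (preimage_ae_eq_ofRep f' E).symm)
  have h0' : Stone.measure B (f ⁻¹' E.1 \ f' ⁻¹' E.1) = 0 := ae_le_set.1 hE.le
  refine Stone.measure_pos_of_isOpen (B := B)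
    (U := (fun p => g (f p)) ⁻¹' Iio (1 / 2) ∩ (fun p => g (f' p)) ⁻¹' Ioi (1 / 2))
    ((isOpen_Iio.preimage (g.continuous.comp f.continuous)).inter
      (isOpen_Ioi.preimage (g.continuous.comp f'.continuous))) ⟨p, ?_, ?_⟩
    (measure_mono_null ?_ h0')
  · simp [h0]
  · simp only [mem_preimage, h1, mem_Ioi]; norm_num
  · rintro q ⟨hq, hq'⟩
    refine ⟨hq, fun hq'' => ?_⟩
    have h1 : g (f' q) < 1 / 2 := hq''
    have h2 : 1 / 2 < g (f' q) := hq'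
    linarith

/-- Every conditional element of a compact Hausdorff space is represented by a continuous map
on the canonical model. -/
theorem ofRep_surjective : Function.Surjective (ofRep : C(Stone B, Z) → Cond B Z) := by
  intro θ
  have hmg : ∀ g : C(Z, ℝ), Measurable g := fun g => measurable_real_of_continuous g.continuous
  -- the zero-one valued set function on the Baire σ-algebra attached to a point
  have key : ∀ p : Stone B, ∃ z : Z, ∀ E : {s : Set Z // MeasurableSet s}, IsClosed E.1 →
      p ∈ Stone.clopen (θ E) → z ∈ E.1 := by
    intro p
    let ι := {E : {s : Set Z // MeasurableSet s} // IsClosed E.1 ∧ p ∈ Stone.clopen (θ E)}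
    have hne : (⋂ i : ι, i.1.1).Nonempty := by
      have : Nonempty ι := ⟨⟨⊤, isClosed_univ, by
        have : θ ⊤ = ⊤ := map_top θ
        rw [this, Stone.clopen_top]; trivial⟩⟩
      refine IsCompact.nonempty_iInter_of_directed_nonempty_isCompact_isClosed
        (fun i : ι => i.1.1) ?_ ?_ (fun i => i.2.1.isCompact) (fun i => i.2.1)
      · intro i j
        refine ⟨⟨i.1 ⊓ j.1, i.2.1.inter j.2.1, ?_⟩, inter_subset_left, inter_subset_right⟩
        have : θ (i.1 ⊓ j.1) = θ i.1 ⊓ θ j.1 := map_inf θ _ _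
        rw [this, Stone.clopen_inf]
        exact ⟨i.2.2, j.2.2⟩
      · intro i
        by_contra hemp
        rw [not_nonempty_iff_eq_empty] at hemp
        have h1 : i.1 = ⊥ := Subtype.ext hemp
        have h2 := i.2.2
        have : θ ⊥ = ⊥ := map_bot θ
        rw [h1, this, Stone.clopen_bot] at h2
        exact h2
    obtain ⟨z, hz⟩ := hne
    exact ⟨z, fun E h1 h2 => mem_iInter.1 hz ⟨E, h1, h2⟩⟩
  choose f hf using key
  have hlt : ∀ (p : Stone B) (g : C(Z, ℝ)) (c : ℝ), g (f p) < c →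
      p ∈ Stone.clopen (θ ⟨g ⁻¹' Iio c, hmg g measurableSet_Iio⟩) := by
    intro p g c hgc
    by_contra hn
    have h1 : (⟨g ⁻¹' Ici c, hmg g measurableSet_Ici⟩ : {s : Set Z // MeasurableSet s}) =
        (⟨g ⁻¹' Iio c, hmg g measurableSet_Iio⟩ : {s : Set Z // MeasurableSet s})ᶜ :=
      Subtype.ext (by ext; simp)
    have h2 : p ∈ Stone.clopen (θ ⟨g ⁻¹' Ici c, hmg g measurableSet_Ici⟩) := by
      have : ∀ E : {s : Set Z // MeasurableSet s}, θ Eᶜ = (θ E)ᶜ := map_compl' θ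
      rw [h1, this, Stone.clopen_compl]
      exact hn
    have h3 := hf p _ (isClosed_Ici.preimage g.continuous) h2
    exact absurd hgc (not_lt.2 h3)
  have hle : ∀ (p : Stone B) (g : C(Z, ℝ)) (c : ℝ),
      p ∈ Stone.clopen (θ ⟨g ⁻¹' Iic c, hmg g measurableSet_Iic⟩) → g (f p) ≤ c :=
    fun p g c h => hf p _ (isClosed_Iic.preimage g.continuous) h
  have hmono : ∀ {E F : {s : Set Z // MeasurableSet s}}, E.1 ⊆ F.1 →
      Stone.clopen (θ E) ⊆ Stone.clopen (θ F) := fun h =>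
    Stone.clopen_subset_clopen.2 (OrderHomClass.mono θ h)
  have hcont : Continuous f := by
    rw [continuous_iff_continuousAt]
    intro p U hU
    rw [mem_map]
    obtain ⟨V, hVU, hV, hpV⟩ := mem_nhds_iff.1 hU
    obtain ⟨g, h0, h1, -⟩ := exists_continuous_zero_one_of_isClosed
      (isClosed_singleton (x := f p)) hV.isClosed_compl (by simpa using hpV)
    have h0' : g (f p) = 0 := h0 rfl
    have hp := hlt p g (1 / 2) (by rw [h0']; norm_num)
    filter_upwards [(Stone.isClopen_clopen _).isOpen.mem_nhds hp] with q hq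
    have hq' : g (f q) ≤ 1 / 2 := hle q g _
      (hmono (E := ⟨g ⁻¹' Iio (1 / 2), _⟩) (preimage_mono Iio_subset_Iic_self) hq)
    refine hVU ?_
    by_contra hqV
    have : g (f q) = 1 := h1 hqV
    rw [this] at hq'
    norm_num at hq'
  refine ⟨⟨f, hcont⟩, ofRep_eq_iff.2 ?_⟩
  have hbaire : ∀ E : Set Z, MeasurableSet E → MeasurableSet[baireSigma Z] E := by
    intro E hE
    rwa [‹BaireMeasurableSpace Z›.eq_baire] at hE
  have hcompl : ∀ E : {s : Set Z // MeasurableSet s}, θ Eᶜ = (θ E)ᶜ := map_compl' θ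
  have hIic : ∀ (g : C(Z, ℝ)) (c : ℝ), f ⁻¹' (g ⁻¹' Iic c) =ᵐ[Stone.measure B]
      Stone.clopen (θ ⟨g ⁻¹' Iic c, hmg g measurableSet_Iic⟩) := by
    intro g c
    have hsub : Stone.clopen (θ ⟨g ⁻¹' Iic c, hmg g measurableSet_Iic⟩) ⊆ f ⁻¹' (g ⁻¹' Iic c) :=
      fun p hp => hle p g c hp
    refine EventuallyLE.antisymm ?_ hsub.eventuallyLE
    -- complement of the closed sublevel set as a countable union
    let F : ℕ → {s : Set Z // MeasurableSet s} := fun n =>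
      ⟨g ⁻¹' Ici (c + 1 / (n + 1)), hmg g measurableSet_Ici⟩
    have hF : (⟨⋃ n, (F n).1, MeasurableSet.iUnion fun n => (F n).2⟩ :
        {s : Set Z // MeasurableSet s}) = (⟨g ⁻¹' Iic c, hmg g measurableSet_Iic⟩ :
        {s : Set Z // MeasurableSet s})ᶜ := by
      apply Subtype.ext
      change ⋃ n, (F n).1 = (g ⁻¹' Iic c)ᶜ
      ext z
      simp only [F, mem_iUnion, mem_preimage, mem_Ici, mem_compl_iff, mem_Iic, not_le]
      constructor
      · rintro ⟨n, hn⟩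
        have : (0 : ℝ) < 1 / (n + 1) := Nat.one_div_pos_of_nat
        linarith
      · intro h
        obtain ⟨n, hn⟩ := exists_nat_one_div_lt (sub_pos.2 h)
        exact ⟨n, by linarith⟩
    have h1 := Stone.clopen_isLUB_ae_eq (θ.isLUB_map F)
    have h2 : θ (⟨g ⁻¹' Iic c, hmg g measurableSet_Iic⟩ : {s : Set Z // MeasurableSet s})ᶜ =
        (θ ⟨g ⁻¹' Iic c, hmg g measurableSet_Iic⟩)ᶜ := hcompl _
    rw [hF, h2, Stone.clopen_compl] at h1
    have h3 : (⋃ n, Stone.clopen (θ (F n))) ⊆ (f ⁻¹' (g ⁻¹' Iic c))ᶜ := by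
      refine iUnion_subset fun n p hp hpc => ?_
      have h4 := hf p _ (isClosed_Ici.preimage g.continuous) hp
      have h5 : g (f p) ≤ c := hpc
      have h6 : c + 1 / ((n : ℝ) + 1) ≤ g (f p) := h4
      have : (0 : ℝ) < 1 / (n + 1) := Nat.one_div_pos_of_nat
      linarith
    have h4 := (h1.le.trans h3.eventuallyLE).compl
    simpa only [compl_compl] using h4
  let m : MeasurableSpace Z :=
    { MeasurableSet' := fun E => ∃ hE : MeasurableSet E,
        f ⁻¹' E =ᵐ[Stone.measure B] Stone.clopen (θ ⟨E, hE⟩)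
      measurableSet_empty := by
        refine ⟨MeasurableSet.empty, ?_⟩
        have : θ ⟨∅, MeasurableSet.empty⟩ = ⊥ := map_bot θ
        rw [this, Stone.clopen_bot]
        exact EventuallyEq.rfl
      measurableSet_compl := by
        rintro E ⟨hE, h⟩
        refine ⟨hE.compl, ?_⟩
        have : θ ⟨Eᶜ, hE.compl⟩ = (θ ⟨E, hE⟩)ᶜ := hcompl ⟨E, hE⟩
        rw [this, Stone.clopen_compl]
        exact h.compl
      measurableSet_iUnion := by
        intro E h
        choose hE h using h
        refine ⟨MeasurableSet.iUnion hE, ?_⟩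
        rw [preimage_iUnion]
        exact (Filter.EventuallyEq.countable_iUnion h).trans
          (Stone.clopen_isLUB_ae_eq (θ.isLUB_map fun n => ⟨E n, hE n⟩)).symm }
  have hm : baireSigma Z ≤ m := by
    refine iSup_le fun g => ?_
    rw [← BorelSpace.measurable_eq (α := ℝ), ← measurable_iff_comap_le]
    exact measurable_of_Iic (mδ := m) (f := g) fun c => ⟨hmg g measurableSet_Iic, hIic g c⟩
  exact fun E => (hm _ (hbaire E.1 E.2)).2

/-- The canonical representation: conditional elements of a compact Hausdorff space correspond
bijectively to continuous maps on the canonical model. -/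
noncomputable def repEquiv : Cond B Z ≃ C(Stone B, Z) :=
  (Equiv.ofBijective ofRep ⟨ofRep_injective, ofRep_surjective⟩).symm

/-- The continuous map on the canonical model representing a conditional element. -/
noncomputable def rep (θ : Cond B Z) : C(Stone B, Z) := repEquiv θ

theorem ofRep_rep (θ : Cond B Z) : ofRep θ.rep = θ := repEquiv.symm_apply_apply θ

theorem rep_ofRep (f : C(Stone B, Z)) : (ofRep f).rep = f := repEquiv.apply_symm_apply f

/-- The representing map is characterised by `θ(E)` being the class of the preimage of `E`. -/
theorem rep_preimage_ae_eq (θ : Cond B Z) (E : {s : Set Z // MeasurableSet s}) :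
    θ.rep ⁻¹' E.1 =ᵐ[Stone.measure B] Stone.clopen (θ E) :=
  ofRep_eq_iff.1 (ofRep_rep θ) E

/-- Base change corresponds to composition with the canonical model of the morphism. -/
theorem rep_pull {A : Type*} [ProbAlg A] (φ : ProbAlgHom B A) (θ : Cond B Z) :
    (θ.pull φ).rep = θ.rep.comp (Stone.map φ) := by
  rw [← rep_ofRep (θ.rep.comp (Stone.map φ))]
  refine congrArg rep (Eq.symm (ofRep_eq_iff.2 fun E => ?_))
  have h := (Stone.measurePreserving_map φ).quasiMeasurePreserving.preimage_ae_eq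
    (rep_preimage_ae_eq θ E)
  rw [Stone.map_preimage_clopen] at h
  exact h

end Rep

section Group

variable {B K : Type*} [ProbAlg B] [Group K] [TopologicalSpace K] [IsTopologicalGroup K]
  [CompactSpace K] [T2Space K] [MeasurableSpace K] [BaireMeasurableSpace K]

/-- The group structure on conditional elements of a compact Hausdorff group: pointwise
multiplication of the representing continuous maps. -/
noncomputable instance : Group (Cond B K) := repEquiv.group

theorem rep_one : (1 : Cond B K).rep = 1 := repEquiv.apply_symm_apply _

theorem rep_mul (θ η : Cond B K) : (θ * η).rep = θ.rep * η.rep :=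
  repEquiv.apply_symm_apply _

end Group

end Cond

/-! ### The probability algebra of a concrete probability space -/

section MeasAlg

variable {Ω Ω' : Type*} [MeasurableSpace Ω] [MeasurableSpace Ω']

/-- Almost everywhere equality of measurable sets. -/
@[reducible] def aeSetoid (ν : Measure Ω) : Setoid {s : Set Ω // MeasurableSet s} where
  r s t := s.1 =ᵐ[ν] t.1
  iseqv := ⟨fun _ => EventuallyEq.rfl, fun h => h.symm, fun h h' => h.trans h'⟩

/-- The measure algebra of a measure: measurable sets modulo null sets. -/
def MeasAlg (ν : Measure Ω) : Type _ := Quotient (aeSetoid ν)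

namespace MeasAlg

variable {ν : Measure Ω} {ν' : Measure Ω'}

/-- The class of a measurable set. -/
def mk (ν : Measure Ω) (s : {s : Set Ω // MeasurableSet s}) : MeasAlg ν := Quotient.mk _ s

theorem mk_eq_mk {s t : {s : Set Ω // MeasurableSet s}} : mk ν s = mk ν t ↔ s.1 =ᵐ[ν] t.1 :=
  Quotient.eq (r := aeSetoid ν)

theorem exists_mk (a : MeasAlg ν) : ∃ s, mk ν s = a := Quotient.exists_rep a

instance : PartialOrder (MeasAlg ν) where
  le := Quotient.lift₂ (fun s t => s.1 ≤ᵐ[ν] t.1) fun _ _ _ _ h h' =>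
    propext ⟨fun k => h.symm.le.trans (k.trans h'.le), fun k => h.le.trans (k.trans h'.symm.le)⟩
  le_refl := by rintro ⟨s⟩; exact EventuallyLE.rfl
  le_trans := by rintro ⟨s⟩ ⟨t⟩ ⟨u⟩ h h'; exact EventuallyLE.trans h h'
  le_antisymm := by rintro ⟨s⟩ ⟨t⟩ h h'; exact Quotient.sound (EventuallyLE.antisymm h h')

theorem mk_le_mk {s t : {s : Set Ω // MeasurableSet s}} : mk ν s ≤ mk ν t ↔ s.1 ≤ᵐ[ν] t.1 :=
  Iff.rfl

instance : BooleanAlgebra (MeasAlg ν) where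
  sup := Quotient.map₂ (· ⊔ ·) fun _ _ h _ _ h' => h.union h'
  inf := Quotient.map₂ (· ⊓ ·) fun _ _ h _ _ h' => h.inter h'
  compl := Quotient.map (·ᶜ) fun _ _ h => h.compl
  top := mk ν ⊤
  bot := mk ν ⊥
  le_sup_left := by
    rintro ⟨s⟩ ⟨t⟩; exact LE.le.eventuallyLE (subset_union_left (s := s.1) (t := t.1))
  le_sup_right := by
    rintro ⟨s⟩ ⟨t⟩; exact LE.le.eventuallyLE (subset_union_right (s := s.1) (t := t.1))
  sup_le := by
    rintro ⟨s⟩ ⟨t⟩ ⟨u⟩ h h'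
    exact (EventuallyLE.union h h').trans (LE.le.eventuallyLE (union_self u.1).subset)
  inf_le_left := by
    rintro ⟨s⟩ ⟨t⟩; exact LE.le.eventuallyLE (inter_subset_left (s := s.1) (t := t.1))
  inf_le_right := by
    rintro ⟨s⟩ ⟨t⟩; exact LE.le.eventuallyLE (inter_subset_right (s := s.1) (t := t.1))
  le_inf := by
    rintro ⟨s⟩ ⟨t⟩ ⟨u⟩ h h'
    exact (LE.le.eventuallyLE (inter_self s.1).symm.subset).trans
      (EventuallyLE.inter h h')
  le_sup_inf := by
    rintro ⟨s⟩ ⟨t⟩ ⟨u⟩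
    exact LE.le.eventuallyLE (union_inter_distrib_left s.1 t.1 u.1).symm.subset
  le_top := by
    rintro ⟨s⟩; exact LE.le.eventuallyLE (subset_univ s.1)
  bot_le := by
    rintro ⟨s⟩; exact LE.le.eventuallyLE (empty_subset s.1)
  inf_compl_le_bot := by
    rintro ⟨s⟩; exact LE.le.eventuallyLE (inter_compl_self s.1).subset
  top_le_sup_compl := by
    rintro ⟨s⟩; exact LE.le.eventuallyLE (union_compl_self s.1).symm.subset

theorem mk_inf (s t : {s : Set Ω // MeasurableSet s}) : mk ν (s ⊓ t) = mk ν s ⊓ mk ν t := rfl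

theorem mk_sup (s t : {s : Set Ω // MeasurableSet s}) : mk ν (s ⊔ t) = mk ν s ⊔ mk ν t := rfl

theorem mk_top : mk ν ⊤ = ⊤ := rfl

theorem mk_bot : mk ν ⊥ = ⊥ := rfl

theorem isLUB_mk (f : ℕ → {s : Set Ω // MeasurableSet s}) :
    IsLUB (range fun n => mk ν (f n))
      (mk ν ⟨⋃ n, (f n).1, MeasurableSet.iUnion fun n => (f n).2⟩) := by
  constructor
  · rintro _ ⟨n, rfl⟩
    exact LE.le.eventuallyLE (subset_iUnion (fun n => (f n).1) n)
  · intro t ht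
    obtain ⟨t, rfl⟩ := exists_mk t
    have h : ∀ n, (f n).1 ≤ᵐ[ν] t.1 := fun n => mk_le_mk.1 (ht ⟨n, rfl⟩)
    refine mk_le_mk.2 ((Filter.EventuallyLE.countable_iUnion h).trans ?_)
    exact LE.le.eventuallyLE (iUnion_subset fun _ => subset_rfl)

/-- The probability algebra of a concrete probability space. -/
noncomputable instance [IsProbabilityMeasure ν] : ProbAlg (MeasAlg ν) where
  mu := Quotient.lift (fun s => ν.real s.1) fun _ _ h => measureReal_congr h
  mu_nonneg := by rintro ⟨s⟩; exact measureReal_nonneg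
  mu_top := probReal_univ
  exists_isLUB f := by
    choose s hs using fun n => exists_mk (f n)
    obtain rfl : (fun n => mk ν (s n)) = f := funext hs
    exact ⟨_, isLUB_mk s⟩
  hasSum_mu f u hd hu := by
    choose s hs using fun n => exists_mk (f n)
    obtain rfl : (fun n => mk ν (s n)) = f := funext hs
    rw [hu.unique (isLUB_mk s)]
    have hae : Pairwise (Function.onFun (AEDisjoint ν) fun n => (s n).1) := by
      intro i j hij
      have h1 : mk ν (s i ⊓ s j) = mk ν ⊥ := (hd hij).eq_bot
      exact ae_eq_empty.1 (mk_eq_mk.1 h1)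
    have h2 := measure_iUnion₀ hae fun n => (s n).2.nullMeasurableSet
    have h3 : ∑' n, ν (s n).1 ≠ ∞ := h2 ▸ measure_ne_top ν _
    have h4 := ENNReal.hasSum_toReal h3
    rw [← ENNReal.tsum_toReal_eq fun n => measure_ne_top ν _, ← h2] at h4
    exact h4
  eq_bot_of_mu_eq_zero := by
    rintro ⟨s⟩ hs
    have h1 : ν.real s.1 = 0 := hs
    exact mk_eq_mk.2 (ae_eq_empty.2 ((measureReal_eq_zero_iff).1 h1))

/-- The pullback map on probability algebras of a measure-preserving map. -/
noncomputable def comap [IsProbabilityMeasure ν] [IsProbabilityMeasure ν'] (f : Ω → Ω')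
    (hf : MeasurePreserving f ν ν') : ProbAlgHom (MeasAlg ν') (MeasAlg ν) where
  toFun := Quotient.map (fun s => ⟨f ⁻¹' s.1, hf.measurable s.2⟩) fun _ _ h =>
    hf.quasiMeasurePreserving.preimage_ae_eq h
  map_sup' := by rintro ⟨s⟩ ⟨t⟩; rfl
  map_inf' := by rintro ⟨s⟩ ⟨t⟩; rfl
  map_top' := rfl
  map_bot' := rfl
  mu_map := by
    rintro ⟨s⟩
    exact congrArg ENNReal.toReal (hf.measure_preimage s.2.nullMeasurableSet)

end MeasAlg

end MeasAlg

/-! ### Haar measure -/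

section Haar

/-- The Haar probability measure of a compact group, on the Borel σ-algebra. -/
noncomputable def borelHaar (K : Type*) [Group K] [TopologicalSpace K] [IsTopologicalGroup K]
    [CompactSpace K] : @Measure K (borel K) :=
  letI : MeasurableSpace K := borel K
  haveI : BorelSpace K := ⟨rfl⟩
  Measure.haarMeasure ⊤

theorem borelHaar_univ (K : Type*) [Group K] [TopologicalSpace K] [IsTopologicalGroup K]
    [CompactSpace K] : borelHaar K univ = 1 := by
  let : MeasurableSpace K := borel K
  have : BorelSpace K := ⟨rfl⟩
  exact Measure.haarMeasure_self (K₀ := (⊤ : TopologicalSpace.PositiveCompacts K))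

theorem borelHaar_map_mul (K : Type*) [Group K] [TopologicalSpace K] [IsTopologicalGroup K]
    [CompactSpace K] (a b : K) :
    @Measure.map K K (borel K) (borel K) (fun k => a * k * b) (borelHaar K) = borelHaar K := by
  let : MeasurableSpace K := borel K
  have : BorelSpace K := ⟨rfl⟩
  let μ : Measure K := Measure.haarMeasure ⊤
  have : IsProbabilityMeasure μ := ⟨Measure.haarMeasure_self⟩
  have hr : Measure.map (· * b) μ = μ := by
    have : IsProbabilityMeasure (Measure.map (· * b) μ) :=
      Measure.isProbabilityMeasure_map (measurable_mul_const b).aemeasurable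
    exact Measure.isHaarMeasure_eq_of_isProbabilityMeasure _ _
  have hl : Measure.map (a * ·) μ = μ := map_mul_left_eq_self μ a
  change Measure.map ((· * b) ∘ (a * ·)) μ = μ
  rw [← Measure.map_map (measurable_mul_const b) (measurable_const_mul a), hl, hr]

theorem measurable_borel_of_continuous {Z W : Type*} [TopologicalSpace Z] [TopologicalSpace W]
    {f : Z → W} (hf : Continuous f) : @Measurable Z W (borel Z) (borel W) f := by
  let : MeasurableSpace Z := borel Z
  have : BorelSpace Z := ⟨rfl⟩
  let : MeasurableSpace W := borel W
  have : BorelSpace W := ⟨rfl⟩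
  exact hf.measurable

theorem measurable_id_borel (K : Type*) [TopologicalSpace K] [m : MeasurableSpace K]
    [BaireMeasurableSpace K] : @Measurable K K (borel K) m id := by
  have h : ∀ g : C(K, ℝ), @Measurable K ℝ (borel K) _ g := fun g => by
    rw [BorelSpace.measurable_eq (α := ℝ)]
    exact measurable_borel_of_continuous g.continuous
  exact @measurable_to_baire K K (borel K) _ m _ id h

variable (K : Type*) [Group K] [TopologicalSpace K] [IsTopologicalGroup K] [CompactSpace K]
  [m : MeasurableSpace K]

/-- The Haar probability measure of a compact group, on the Baire σ-algebra. -/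
noncomputable def haar : Measure K := @Measure.map K K (borel K) m id (borelHaar K)

variable [hK : BaireMeasurableSpace K]

instance : IsProbabilityMeasure (haar K) := by
  refine ⟨?_⟩
  rw [haar, Measure.map_apply (measurable_id_borel K) MeasurableSet.univ]
  exact borelHaar_univ K

variable {K}

theorem measurePreserving_mul (a b : K) :
    MeasurePreserving (fun k => a * k * b) (haar K) (haar K) := by
  have hc : Continuous fun k : K => a * k * b := by fun_prop
  refine ⟨measurable_of_continuous hc, ?_⟩
  have hb : @Measurable K K (borel K) (borel K) fun k => a * k * b :=
    measurable_borel_of_continuous hc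
  conv_rhs => rw [haar, ← borelHaar_map_mul K a b, Measure.map_map (measurable_id_borel K) hb]
  rw [haar, Measure.map_map (measurable_of_continuous hc) (measurable_id_borel K)]
  rfl

end Haar

/-! ### Systems, cocycles and group extensions -/

/-- An action of the group `Γ` on the probability algebra `B`; `pull γ` is the pullback map
`(T^γ)^*` of the automorphism `T^γ`. -/
structure Action (Γ B : Type*) [Group Γ] [ProbAlg B] where
  /-- the pullback maps -/
  pull : Γ → ProbAlgHom B B
  pull_one : ∀ E, pull 1 E = E
  pull_mul : ∀ γ γ' E, pull (γ * γ') E = pull γ' (pull γ E)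

/-- The invariant factor: the invariant elements of the probability algebra. -/
def Action.inv {Γ B : Type*} [Group Γ] [ProbAlg B] (T : Action Γ B) : Set B :=
  {E | ∀ γ, T.pull γ E = E}

/-- Ergodicity: the invariant factor is trivial. -/
def Action.IsErgodic {Γ B : Type*} [Group Γ] [ProbAlg B] (T : Action Γ B) : Prop :=
  ∀ E ∈ T.inv, E = ⊥ ∨ E = ⊤

/-- A `K`-valued cocycle `ρ_{γγ'} = (ρ_γ ∘ Inc(T^{γ'})) ρ_{γ'}` of a system. -/
structure Cocycle {Γ B : Type*} [Group Γ] [ProbAlg B] (T : Action Γ B) (K : Type*) [Group K]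
    [TopologicalSpace K] [IsTopologicalGroup K] [CompactSpace K] [T2Space K] [MeasurableSpace K]
    [BaireMeasurableSpace K] where
  /-- the components of the cocycle -/
  toFun : Γ → Cond B K
  map_mul : ∀ γ γ', toFun (γ * γ') = (toFun γ).pull (T.pull γ') * toFun γ'

/-- A group extension by `K`, with factor map `π` from the system `S` on `A` to the system `T`
on `B`, vertical coordinate `θ` and cocycle `ρ`. -/
structure GroupExtension {Γ A B : Type*} [Group Γ] [ProbAlg A] [ProbAlg B] (S : Action Γ A)
    (T : Action Γ B) (K : Type*) [Group K] [TopologicalSpace K] [IsTopologicalGroup K]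
    [CompactSpace K] [T2Space K] [MeasurableSpace K] [BaireMeasurableSpace K] where
  /-- the factor map (as a pullback map) -/
  π : ProbAlgHom B A
  pull_π : ∀ γ b, S.pull γ (π b) = π (T.pull γ b)
  /-- the vertical coordinate -/
  θ : Cond A K
  /-- the cocycle -/
  ρ : Cocycle T K
  θ_pull : ∀ γ, θ.pull (S.pull γ) = (ρ.toFun γ).pull π * θ
  /-- `π` and `θ` jointly generate `A` as a σ-complete Boolean algebra -/
  generates : ∀ G : Set A, (∀ b, π b ∈ G) → (∀ E, θ E ∈ G) → (∀ a ∈ G, aᶜ ∈ G) →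
    (∀ (f : ℕ → A) (s : A), (∀ n, f n ∈ G) → IsLUB (range f) s → s ∈ G) → ∀ a, a ∈ G

/-! ### Skew products -/

section Skew

variable {A B K : Type*} [ProbAlg A] [ProbAlg B] [Group K] [TopologicalSpace K]
  [IsTopologicalGroup K] [CompactSpace K] [MeasurableSpace K] [BaireMeasurableSpace K]

theorem measurable_stone_prod {Z : Type*} [TopologicalSpace Z] [CompactSpace Z]
    [MeasurableSpace Z] [BaireMeasurableSpace Z] (f : C(Stone B × Z, ℝ)) : Measurable f := by
  have h : ∀ N : ℕ, ∃ F : Stone B × Z → ℝ, Measurable F ∧ ∀ x, |f x - F x| < 1 / ((N : ℝ) + 1) := by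
    intro N
    have hpos : (0 : ℝ) < 1 / ((N : ℝ) + 1) := Nat.one_div_pos_of_nat
    obtain ⟨n, g, k, hgk⟩ := f.exists_finite_sum_mul_approximation_of_mem_uniformity
      (Metric.dist_mem_uniformity hpos)
    refine ⟨fun x => ∑ i, g i x.1 * k i x.2, ?_, fun x => ?_⟩
    · refine Finset.measurable_sum _ fun i _ => ?_
      exact ((measurable_real_of_continuous (g i).continuous).comp measurable_fst).mul
        ((measurable_real_of_continuous (k i).continuous).comp measurable_snd)
    · have := hgk x.1 x.2
      simpa [Real.dist_eq] using this
  choose F hF hfF using h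
  refine measurable_of_tendsto_metrizable hF (tendsto_pi_nhds.2 fun x => ?_)
  rw [tendsto_iff_dist_tendsto_zero]
  refine squeeze_zero (fun _ => dist_nonneg) (fun N => ?_) tendsto_one_div_add_atTop_nhds_zero_nat
  rw [dist_comm, Real.dist_eq]
  exact (hfF N x).le

variable (B K) in
/-- The product of the measure of the canonical model with Haar measure. -/
noncomputable abbrev prodHaar : Measure (Stone B × K) := (Stone.measure B).prod (haar K)

/-- The map `(x, k) ↦ (f(x), r(x) k)`. -/
def skewMap (f : C(Stone A, Stone B)) (r : C(Stone A, K)) (x : Stone A × K) : Stone B × K :=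
  (f x.1, r x.1 * x.2)

theorem measurePreserving_skewMap (φ : ProbAlgHom B A) (r : C(Stone A, K)) :
    MeasurePreserving (skewMap (Stone.map φ) r) (prodHaar A K) (prodHaar B K) := by
  refine (Stone.measurePreserving_map φ).skew_product (g := fun x k => r x * k) ?_ ?_
  · refine measurable_to_baire fun g => ?_
    exact measurable_stone_prod ⟨fun x : Stone A × K => g (r x.1 * x.2), by fun_prop⟩
  · refine ae_of_all _ fun x => ?_
    have := (measurePreserving_mul (r x) 1).map_eq
    simpa using this

/-- The map `(x, k) ↦ (x, k k₀)`. -/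
def rightMap (k₀ : K) (x : Stone A × K) : Stone A × K := (x.1, x.2 * k₀)

theorem measurePreserving_rightMap (k₀ : K) :
    MeasurePreserving (rightMap k₀) (prodHaar A K) (prodHaar A K) := by
  have h : MeasurePreserving (fun k => k * k₀) (haar K) (haar K) := by
    have := measurePreserving_mul 1 k₀
    simpa using this
  exact (MeasurePreserving.id (Stone.measure A)).prod h

theorem MeasAlg.comap_congr {Ω Ω' : Type*} [MeasurableSpace Ω] [MeasurableSpace Ω']
    {ν : Measure Ω} {ν' : Measure Ω'} [IsProbabilityMeasure ν] [IsProbabilityMeasure ν']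
    {f g : Ω → Ω'} (hf : MeasurePreserving f ν ν') (hg : MeasurePreserving g ν ν') (h : f = g)
    (E : MeasAlg ν') : MeasAlg.comap f hf E = MeasAlg.comap g hg E := by
  subst h; rfl

variable [T2Space K] {Γ : Type*} [Group Γ] {T : Action Γ B}

theorem Cocycle.map_one (ρ : Cocycle T K) : ρ.toFun 1 = 1 := by
  have h := ρ.map_mul 1 1
  have h1 : (ρ.toFun 1).pull (T.pull 1) = ρ.toFun 1 := DFunLike.ext _ _ fun E => T.pull_one _
  rw [h1, mul_one] at h
  exact (mul_eq_left (a := ρ.toFun 1)).1 h.symm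

/-- The skew product `Y ⋊_ρ K` as a system: the action of `γ ∈ Γ` on the probability algebra of
the product of the canonical model of `Y` with `K` is induced by the map
`(y, k) ↦ (T^γ y, ρ_γ(y) k)`. -/
noncomputable def Cocycle.skewProduct (ρ : Cocycle T K) : Action Γ (MeasAlg (prodHaar B K)) where
  pull γ := MeasAlg.comap _ (measurePreserving_skewMap (T.pull γ) (ρ.toFun γ).rep)
  pull_one E := by
    have h : skewMap (Stone.map (T.pull 1)) (ρ.toFun 1).rep = (id : Stone B × K → Stone B × K) := by
      funext x
      refine Prod.ext ?_ ?_
      · exact Subtype.ext (funext fun b => congrArg x.1.1 (T.pull_one b))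
      · have : (ρ.toFun 1).rep x.1 = 1 := by rw [ρ.map_one, Cond.rep_one]; rfl
        change (ρ.toFun 1).rep x.1 * x.2 = x.2
        rw [this, one_mul]
    rw [MeasAlg.comap_congr _ (MeasurePreserving.id _) h]
    obtain ⟨s, rfl⟩ := MeasAlg.exists_mk E
    rfl
  pull_mul γ γ' E := by
    have h : skewMap (Stone.map (T.pull (γ * γ'))) (ρ.toFun (γ * γ')).rep =
        (skewMap (Stone.map (T.pull γ)) (ρ.toFun γ).rep ∘
          skewMap (Stone.map (T.pull γ')) (ρ.toFun γ').rep : Stone B × K → Stone B × K) := by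
      funext x
      refine Prod.ext ?_ ?_
      · exact Subtype.ext (funext fun b => congrArg x.1.1 (T.pull_mul γ γ' b))
      · change (ρ.toFun (γ * γ')).rep x.1 * x.2 = (ρ.toFun γ).rep (Stone.map (T.pull γ') x.1) *
          ((ρ.toFun γ').rep x.1 * x.2)
        rw [ρ.map_mul, Cond.rep_mul, Cond.rep_pull, ← mul_assoc]
        rfl
    rw [MeasAlg.comap_congr _ ((measurePreserving_skewMap (T.pull γ) (ρ.toFun γ).rep).comp
      (measurePreserving_skewMap (T.pull γ') (ρ.toFun γ').rep)) h]
    obtain ⟨s, rfl⟩ := MeasAlg.exists_mk E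
    rfl

variable (A K) in
/-- The action of `k₀ ∈ K^op` on a skew product with `K`: the pullback map of
`(y, k) ↦ (y, k k₀)`. -/
noncomputable def rightPull (k₀ : K) : ProbAlgHom (MeasAlg (prodHaar A K)) (MeasAlg (prodHaar A K)) :=
  MeasAlg.comap _ (measurePreserving_rightMap k₀)

variable (A K) in
/-- The pullback map of the vertical coordinate `(x, k) ↦ k` of a skew product with `K`. -/
noncomputable def vertPull : ProbAlgHom (MeasAlg (haar K)) (MeasAlg (prodHaar A K)) :=
  MeasAlg.comap Prod.snd measurePreserving_snd

end Skew

/-! ### Spaces of right cosets -/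

section RightCosets

variable {K : Type*} [Group K] [TopologicalSpace K] (H : Subgroup K)

/-- The space `H \ K` of right cosets `Hk`. -/
def RightCosets : Type _ := Quotient (QuotientGroup.rightRel H)

namespace RightCosets

instance : TopologicalSpace (RightCosets H) :=
  inferInstanceAs (TopologicalSpace (Quotient (QuotientGroup.rightRel H)))

/-- The space of right cosets is equipped with its Baire σ-algebra. -/
instance : MeasurableSpace (RightCosets H) := baireSigma (RightCosets H)

instance : BaireMeasurableSpace (RightCosets H) := ⟨rfl⟩

/-- The projection `k ↦ Hk`. -/
def mk : C(K, RightCosets H) where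
  toFun k := Quotient.mk (QuotientGroup.rightRel H) k
  continuous_toFun := continuous_quotient_mk'

variable {H} in
/-- The right translation `Hk ↦ Hkk₀`. -/
def translate (k₀ : K) : RightCosets H → RightCosets H :=
  Quotient.map (· * k₀) fun a b h => by
    have h' := QuotientGroup.rightRel_apply.1 h
    refine QuotientGroup.rightRel_apply.2 ?_
    simpa [mul_assoc] using h'

theorem measurable_mk [MeasurableSpace K] [BaireMeasurableSpace K] : Measurable (mk H) :=
  measurable_of_continuous (mk H).continuous

variable [IsTopologicalGroup K] [CompactSpace K] [MeasurableSpace K] [BaireMeasurableSpace K]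

/-- The Haar probability measure of `H \ K`. -/
noncomputable def haar : Measure (RightCosets H) := Measure.map (mk H) (MackeyZimmer.haar K)

theorem measurePreserving_mk : MeasurePreserving (mk H) (MackeyZimmer.haar K) (haar H) :=
  ⟨measurable_mk H, rfl⟩

instance : IsProbabilityMeasure (haar H) :=
  Measure.isProbabilityMeasure_map (measurable_mk H).aemeasurable

variable {H}

theorem measurePreserving_translate (k₀ : K) :
    MeasurePreserving (translate k₀) (haar H) (haar H) := by
  have hc : Continuous (translate (H := H) k₀) :=
    continuous_quot_lift _ ((mk H).continuous.comp (continuous_mul_const k₀))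
  have hm : Measurable (translate (H := H) k₀) := measurable_of_continuous hc
  refine ⟨hm, ?_⟩
  have h1 := (measurePreserving_mul 1 k₀ (K := K))
  conv_rhs => rw [haar, ← h1.map_eq, Measure.map_map (measurable_mk H) h1.measurable]
  rw [haar, Measure.map_map hm (measurable_mk H)]
  congr 1
  funext k
  simp only [Function.comp, one_mul]
  rfl

end RightCosets

end RightCosets

/-! ### The Mackey range -/

namespace GroupExtension

variable {Γ A B K : Type*} [Group Γ] [ProbAlg A] [ProbAlg B] [Group K] [TopologicalSpace K]
  [IsTopologicalGroup K] [CompactSpace K] [T2Space K] [MeasurableSpace K] [BaireMeasurableSpace K]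
  {S : Action Γ A} {T : Action Γ B}

/-- The morphism `Π : X ⋊_1 K → Y ⋊_ρ K`, `Π(x, k) = (π(x), θ(x) k)`, as a pullback map. -/
noncomputable def prodPull (X : GroupExtension S T K) :
    ProbAlgHom (MeasAlg (prodHaar B K)) (MeasAlg (prodHaar A K)) :=
  MeasAlg.comap _ (measurePreserving_skewMap X.π X.θ.rep)

/-- The subgroup `H` is the Mackey range of the extension: the invariant factor of `Y ⋊_ρ K` is
isomorphic, as a factor of `K`, to `H \ K`. Here `ψ` is the pullback map of the resulting factor
map `Y ⋊_ρ K → H \ K`; it has to identify the probability algebra of `H \ K` with the algebra of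
`Γ`-invariant elements of `Y ⋊_ρ K`, to respect the action of `K^op` (`Γ` acts trivially on both
sides), and to be compatible with the projection `K → H \ K` and the map from `K` to
the invariant factor, which is induced by `Π` upon identifying the invariant factor of `X ⋊_1 K`
with `K` by the vertical coordinate. -/
def IsMackeyRange (X : GroupExtension S T K) (H : Subgroup K) : Prop :=
  ∃ ψ : ProbAlgHom (MeasAlg (RightCosets.haar H)) (MeasAlg (prodHaar B K)),
    range ψ = X.ρ.skewProduct.inv ∧
    (∀ k₀ F, ψ (MeasAlg.comap _ (RightCosets.measurePreserving_translate k₀) F) =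
      rightPull B K k₀ (ψ F)) ∧
    ∀ F, X.prodPull (ψ F) =
      vertPull A K (MeasAlg.comap _ (RightCosets.measurePreserving_mk H) F)

end GroupExtension

end MackeyZimmer

open MackeyZimmer

/-!
Write `Y` and `X` for the canonical models of the two systems, and `Π : X × K → Y × K`,
`Π(x, k) = (π(x), θ(x) k)`. No separability or metrizability is available, so every argument is
carried out on measure algebras, on integrals, or on continuous representatives.

*Existence.* Since `X` is ergodic, an invariant set of `Y ⋊_ρ K` pulls back under `Π` to a set
that depends on the vertical coordinate alone (`exists_preimage_prodFun_ae_eq`), and conversely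
(`invariant_of_preimage_prodFun_ae_eq`). The invariant factor is thus a σ-algebra on `K`
(`mackeySigma`), which is right invariant because `Π` commutes with right translations. A
right-invariant σ-algebra on a compact group consists of the sets that come from `H \ K` for a
closed subgroup `H` (`exists_subgroup_of_rightInvariant`): convolution with an approximate unit
shows that its continuous functions are dense, they form a right-invariant algebra, and
Stone–Weierstrass identifies this algebra with `C(H \ K)`, where `H` is the group of its left
periods.

*The coordinate change `Φ`.* On the canonical model of the algebra of `Y × K`, the factor map to
`H \ K` is a continuous map. Dividing it by the vertical coordinate gives a `K^op`-invariant map,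
which therefore comes from a continuous map `q : Y → H \ K`. The space `Y` is extremally
disconnected, so by Gleason's theorem `q` lifts to a continuous `Φ : Y → K`
(`exists_rep_eq_mk_mul`). Compatibility of the factor map with `Π` says `HΦ(π(x))θ(x)k = Hk`, that
is, `Φ(π(x))θ(x) ∈ H`.

*The distribution of `(π, θs)`.* For `h ∈ H` and `C ⊆ K`, the images under `Π` of the slices
`X × C` and `X × h⁻¹C` are invariant measures on `Y ⋊_ρ K`, and they agree on invariant sets
since those are pulled back from `H \ K`. An invariant absolutely continuous measure is determined
by its values on invariant sets (`measure_eq_of_eq_on_invariant`), so the images agree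
(`IsMackeyRange.sliceMeasure_preimage`). Consequently the continuous function
`k ↦ ∫ f(π(x)) g(θs(x) k)` is invariant under left translation by `H`; averaging over `H` yields
the product formula.
-/

namespace MackeyZimmer

open ProbAlg

/-! ### Baire σ-algebras of products -/

section BaireProd

/-- A σ-algebra on a compact space for which enough continuous functions are measurable to
separate points contains the Baire σ-algebra. -/
theorem measurable_of_separatesPoints {Z : Type*} [TopologicalSpace Z] [CompactSpace Z]
    {m : MeasurableSpace Z}
    (hm : ∀ x y : Z, x ≠ y → ∃ f : C(Z, ℝ), Measurable[m] f ∧ f x ≠ f y) (g : C(Z, ℝ)) :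
    Measurable[m] g := by
  let 𝓐 : Subalgebra ℝ C(Z, ℝ) :=
    { carrier := {f | Measurable[m] f}
      mul_mem' := fun hf hg => Measurable.mul hf hg
      add_mem' := fun hf hg => Measurable.add hf hg
      algebraMap_mem' := fun _ => measurable_const }
  have hsep : 𝓐.SeparatesPoints := by
    intro x y hxy
    obtain ⟨f, hf, hne⟩ := hm x y hxy
    exact ⟨f, ⟨f, hf, rfl⟩, hne⟩
  have hg : g ∈ closure (𝓐 : Set C(Z, ℝ)) := by
    rw [← Subalgebra.topologicalClosure_coe,
      ContinuousMap.subalgebra_topologicalClosure_eq_top_of_separatesPoints 𝓐 hsep]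
    trivial
  obtain ⟨u, hu, hlim⟩ := mem_closure_iff_seq_limit.1 hg
  refine measurable_of_tendsto_metrizable hu (tendsto_pi_nhds.2 fun x => ?_)
  exact ((continuous_eval_const x : Continuous fun f : C(Z, ℝ) => f x).tendsto g).comp hlim

theorem measurable_prod_of_continuous {Z W : Type*} [TopologicalSpace Z] [CompactSpace Z]
    [T2Space Z] [MeasurableSpace Z] [BaireMeasurableSpace Z] [TopologicalSpace W] [CompactSpace W]
    [T2Space W] [MeasurableSpace W] [BaireMeasurableSpace W] (f : C(Z × W, ℝ)) :
    Measurable f := by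
  refine measurable_of_separatesPoints (fun x y hxy => ?_) f
  by_cases h : x.1 = y.1
  · obtain ⟨g, h0, h1⟩ := Cond.exists_separating (fun h' => hxy (Prod.ext h h'))
    exact ⟨g.comp ⟨Prod.snd, continuous_snd⟩,
      (measurable_real_of_continuous g.continuous).comp measurable_snd, by simp [h0, h1]⟩
  · obtain ⟨g, h0, h1⟩ := Cond.exists_separating h
    exact ⟨g.comp ⟨Prod.fst, continuous_fst⟩,
      (measurable_real_of_continuous g.continuous).comp measurable_fst, by simp [h0, h1]⟩

/-- For compact Hausdorff spaces, the product of the Baire σ-algebras is the Baire σ-algebra of the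
product. -/
instance {Z W : Type*} [TopologicalSpace Z] [CompactSpace Z] [T2Space Z]
    [MeasurableSpace Z] [BaireMeasurableSpace Z] [TopologicalSpace W] [CompactSpace W]
    [T2Space W] [MeasurableSpace W] [BaireMeasurableSpace W] : BaireMeasurableSpace (Z × W) where
  eq_baire := by
    have hb : @BaireMeasurableSpace (Z × W) _ (baireSigma (Z × W)) :=
      @BaireMeasurableSpace.mk _ _ (_) rfl
    apply le_antisymm
    · refine sup_le ?_ ?_
      · rw [← measurable_iff_comap_le]
        exact @measurable_of_continuous (Z × W) Z _ (baireSigma (Z × W)) hb _ _ _ _ continuous_fst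
      · rw [← measurable_iff_comap_le]
        exact @measurable_of_continuous (Z × W) W _ (baireSigma (Z × W)) hb _ _ _ _ continuous_snd
    · refine iSup_le fun g => ?_
      rw [← BorelSpace.measurable_eq (α := ℝ)]
      exact (measurable_prod_of_continuous g).comap_le

end BaireProd

/-! ### Factoring through morphisms of probability algebras -/

section Hom
variable {A B C : Type*} [ProbAlg A] [ProbAlg B] [ProbAlg C]

/-- Morphisms are injective since the measures are strictly positive. -/
theorem ProbAlgHom.injective (φ : ProbAlgHom B A) : Function.Injective φ := by
  have key : ∀ a b, φ a = φ b → a ≤ b := by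
    intro a b h
    have h1 : φ (a \ b) = ⊥ := by rw [map_sdiff', h]; exact sdiff_self
    have h2 := φ.mu_apply (a \ b)
    rw [h1, mu_bot] at h2
    exact sdiff_eq_bot_iff.1 (eq_bot_of_mu_eq_zero _ h2.symm)
  exact fun a b h => le_antisymm (key a b h) (key b a h.symm)

theorem ProbAlgHom.le_iff_le (φ : ProbAlgHom B A) {a b : B} : φ a ≤ φ b ↔ a ≤ b := by
  rw [← inf_eq_left, ← InfHomClass.map_inf, φ.injective.eq_iff, inf_eq_left]

/-- A morphism whose range lies in the range of another one factors through it. -/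
theorem ProbAlgHom.exists_factor (φ : ProbAlgHom B A) (χ : ProbAlgHom C A)
    (h : ∀ c, ∃ b, φ b = χ c) : ∃ ψ : ProbAlgHom C B, ∀ c, φ (ψ c) = χ c := by
  choose f hf using h
  refine ⟨{ toFun := f, map_sup' := ?_, map_inf' := ?_, map_top' := ?_, map_bot' := ?_,
            mu_map := ?_ }, hf⟩
  · intro a b; apply φ.injective; simp [hf]
  · intro a b; apply φ.injective; simp [hf]
  · apply φ.injective; simp [hf]
  · apply φ.injective; simp [hf]
  · intro b
    rw [← φ.mu_apply, hf, χ.mu_apply]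

/-- A conditional element with values in the range of a morphism is a base change. -/
theorem Cond.exists_pull_eq {Z : Type*} [MeasurableSpace Z] (φ : ProbAlgHom B A) (θ : Cond A Z)
    (h : ∀ E, ∃ b, φ b = θ E) : ∃ η : Cond B Z, η.pull φ = θ := by
  choose f hf using h
  refine ⟨{ toFun := f, map_sup' := ?_, map_inf' := ?_, map_top' := ?_, map_bot' := ?_,
            isLUB_map' := ?_ }, DFunLike.ext _ _ hf⟩
  · intro a b; apply φ.injective; rw [SupHomClass.map_sup, hf, hf, hf]; exact SupHomClass.map_sup θ a b
  · intro a b; apply φ.injective; rw [InfHomClass.map_inf, hf, hf, hf]; exact InfHomClass.map_inf θ a b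
  · apply φ.injective; simp [hf]
  · apply φ.injective; simp [hf]
  · intro s
    have h1 := θ.isLUB_map s
    change IsLUB (range fun n => f (s n)) (f _)
    constructor
    · rintro _ ⟨n, rfl⟩
      change f (s n) ≤ _
      rw [← φ.le_iff_le, hf, hf]
      exact h1.1 ⟨n, rfl⟩
    · intro b hb
      rw [← φ.le_iff_le, hf]
      refine h1.2 ?_
      rintro _ ⟨n, rfl⟩
      change θ (s n) ≤ _
      rw [← hf, φ.le_iff_le]
      exact hb ⟨n, rfl⟩

theorem Stone.map_surjective (φ : ProbAlgHom B A) : Function.Surjective (Stone.map φ) := by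
  intro x
  by_contra hx
  have hc : IsClosed (range (Stone.map φ)) := (isCompact_range (Stone.map φ).continuous).isClosed
  obtain ⟨a, ha, hsub⟩ := Stone.exists_clopen_mem_subset hc.isOpen_compl (p := x) hx
  have h1 : Stone.clopen (φ a) = ∅ := by
    rw [← Stone.map_preimage_clopen]
    exact eq_empty_of_forall_notMem fun p hp => hsub hp ⟨p, rfl⟩
  rw [← Stone.clopen_bot, Stone.clopen_injective.eq_iff, ← map_bot φ, φ.injective.eq_iff] at h1
  rw [h1, Stone.clopen_bot] at ha
  exact ha

end Hom

/-! ### Representatives of measurable maps -/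

section Reps

variable {B Z W V : Type*} [ProbAlg B] [TopologicalSpace Z] [MeasurableSpace Z]
  [BaireMeasurableSpace Z] [CompactSpace Z] [T2Space Z] [TopologicalSpace W] [MeasurableSpace W]
  [BaireMeasurableSpace W] [CompactSpace W] [T2Space W]

theorem Cond.rep_injective : Function.Injective (Cond.rep : Cond B Z → C(Stone B, Z)) :=
  Cond.repEquiv.injective

theorem Cond.rep_map (θ : Cond B Z) (f : C(Z, W)) :
    (θ.map f (measurable_of_continuous f.continuous)).rep = f.comp θ.rep := by
  rw [← Cond.rep_ofRep (f.comp θ.rep)]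
  refine congrArg _ (Eq.symm (Cond.ofRep_eq_iff.2 fun E => ?_))
  exact Cond.rep_preimage_ae_eq θ ⟨f ⁻¹' E.1, _⟩

variable {Ω Ω' : Type*} [MeasurableSpace Ω] [MeasurableSpace Ω'] {ν : Measure Ω}
  [IsProbabilityMeasure ν] {ν' : Measure Ω'} [IsProbabilityMeasure ν']

/-- The conditional element over the probability algebra of a concrete probability space
that is given by a measurable map. -/
def Cond.ofMeasurable {Z : Type*} [MeasurableSpace Z] (ν : Measure Ω) [IsProbabilityMeasure ν]
    (u : Ω → Z) (hu : Measurable u) : Cond (MeasAlg ν) Z where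
  toFun E := MeasAlg.mk ν ⟨u ⁻¹' E.1, hu E.2⟩
  map_sup' _ _ := rfl
  map_inf' _ _ := rfl
  map_top' := rfl
  map_bot' := rfl
  isLUB_map' s := by
    have := MeasAlg.isLUB_mk (ν := ν) fun n => ⟨u ⁻¹' (s n).1, hu (s n).2⟩
    simpa only [preimage_iUnion] using this

/-- The continuous map on the canonical model representing a measurable map. -/
noncomputable def measRep (ν : Measure Ω) [IsProbabilityMeasure ν] (u : Ω → Z)
    (hu : Measurable u) : C(Stone (MeasAlg ν), Z) :=
  (Cond.ofMeasurable ν u hu).rep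

theorem measRep_comp (u : Ω → Z) (hu : Measurable u) (f : C(Z, W)) :
    measRep ν (f ∘ u) ((measurable_of_continuous f.continuous).comp hu) = f.comp (measRep ν u hu) :=
  Cond.rep_map (Cond.ofMeasurable ν u hu) f

theorem measRep_prodMk (u : Ω → Z) (hu : Measurable u) (v : Ω → W) (hv : Measurable v) :
    measRep ν (fun ω => (u ω, v ω)) (hu.prodMk hv) =
      (measRep ν u hu).prodMk (measRep ν v hv) := by
  have h1 := measRep_comp (ν := ν) _ (hu.prodMk hv) ⟨Prod.fst, continuous_fst⟩
  have h2 := measRep_comp (ν := ν) _ (hu.prodMk hv) ⟨Prod.snd, continuous_snd⟩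
  ext w
  · exact (congrArg (fun F : C(_, Z) => F w) h1).symm
  · exact (congrArg (fun F : C(_, W) => F w) h2).symm

theorem measRep_comap (u : Ω' → Z) (hu : Measurable u) (f : Ω → Ω')
    (hf : MeasurePreserving f ν ν') :
    (measRep ν' u hu).comp (Stone.map (MeasAlg.comap f hf)) =
      measRep ν (u ∘ f) (hu.comp hf.measurable) :=
  (Cond.rep_pull _ _).symm

end Reps

/-! ### Extremal disconnectedness of the canonical model -/

section Gleason

universe u v w

variable {B : Type u} [ProbAlg B]

/-- The canonical model is extremally disconnected, because a probability algebra is a complete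
Boolean algebra. -/
instance : ExtremallyDisconnected (Stone B) where
  open_closure := by
    intro U hU
    let D : Set B := {a | Stone.clopen a ⊆ U}
    have hD : ∀ a ∈ D, ∀ b ∈ D, a ⊔ b ∈ D := fun a ha b hb => by
      change Stone.clopen (a ⊔ b) ⊆ U
      rw [Stone.clopen_sup]; exact union_subset ha hb
    have hbot : (⊥ : B) ∈ D := by change Stone.clopen (⊥ : B) ⊆ U; simp
    let M : Set ℝ := mu '' D
    have hMne : M.Nonempty := ⟨_, ⊥, hbot, rfl⟩
    have hMb : BddAbove M := ⟨1, by
      rintro _ ⟨a, -, rfl⟩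
      rw [← mu_top (B := B)]; exact mu_mono le_top⟩
    -- by exhaustion, the ideal `D` has a supremum `s`, which is that of a sequence in `D`
    have hn : ∀ n : ℕ, ∃ a ∈ D, sSup M - 1 / (n + 1) < mu a := fun n => by
      obtain ⟨_, ⟨a, ha, rfl⟩, h⟩ := exists_lt_of_lt_csSup hMne
        (show sSup M - 1 / ((n : ℝ) + 1) < sSup M by
          have : (0 : ℝ) < 1 / (n + 1) := Nat.one_div_pos_of_nat
          linarith)
      exact ⟨a, ha, h⟩
    choose a haD ha using hn
    obtain ⟨s, hs⟩ := exists_isLUB a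
    have hle : ∀ b ∈ D, b ≤ s := by
      intro b hb
      refine sdiff_eq_bot_iff.1 (eq_bot_of_mu_eq_zero _ (le_antisymm ?_ (mu_nonneg _)))
      have hb' : ∀ n : ℕ, mu (b \ s) ≤ 1 / ((n : ℝ) + 1) := by
        intro n
        have has : a n ≤ s := hs.1 ⟨n, rfl⟩
        have hd : Disjoint (b \ s) (a n) := disjoint_sdiff_self_left.mono_right has
        have h1 := mu_sup hd
        have h2 : mu (b \ s ⊔ a n) ≤ mu (b ⊔ a n) := mu_mono (sup_le_sup_right sdiff_le _)
        have h3 : mu (b ⊔ a n) ≤ sSup M := le_csSup hMb ⟨_, hD _ hb _ (haD n), rfl⟩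
        have h4 := ha n
        linarith
      exact ge_of_tendsto' tendsto_one_div_add_atTop_nhds_zero_nat hb'
    have : closure U = Stone.clopen s := by
      apply subset_antisymm
      · refine closure_minimal (fun p hp => ?_) (Stone.isClopen_clopen s).isClosed
        obtain ⟨c, hc, hcU⟩ := Stone.exists_clopen_mem_subset hU hp
        exact Stone.clopen_subset_clopen.2 (hle c hcU) hc
      · intro p hp
        by_contra hpU
        obtain ⟨c, hc, hcU⟩ := Stone.exists_clopen_mem_subset isClosed_closure.isOpen_compl
          (show p ∈ (closure U)ᶜ from hpU)
        have h1 : s ≤ cᶜ := hs.2 (by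
          rintro _ ⟨n, rfl⟩
          rw [← Stone.clopen_subset_clopen, Stone.clopen_compl]
          exact fun q hq hqc => hcU hqc (subset_closure (haD n hq)))
        have h2 := Stone.clopen_subset_clopen.2 h1 hp
        rw [Stone.clopen_compl] at h2
        exact h2 hc
    rw [this]
    exact (Stone.isClopen_clopen s).isOpen

/-- Gleason's theorem for the canonical model: continuous maps to compact Hausdorff spaces lift along
continuous surjections. Mathlib's `CompactT2.Projective` asks for all spaces in one universe, hence
the use of `ULift`. -/
theorem Stone.exists_lift {Z : Type v} {W : Type w} [TopologicalSpace Z] [CompactSpace Z] [T2Space Z]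
    [TopologicalSpace W] [CompactSpace W] [T2Space W] (p : C(Z, W)) (hp : Function.Surjective p)
    (q : C(Stone B, W)) : ∃ r : C(Stone B, Z), ∀ x, p (r x) = q x := by
  have e : ExtremallyDisconnected (ULift.{max v w} (Stone B)) :=
    extremallyDisconnected_of_homeo Homeomorph.ulift.symm
  have hP : CompactT2.Projective (ULift.{max v w} (Stone B)) :=
    CompactT2.ExtremallyDisconnected.projective
  obtain ⟨h, hc, hh⟩ := hP (Y := ULift.{max u w} Z) (Z := ULift.{max u v} W)
    (f := fun x => ⟨q x.down⟩) (g := fun z => ⟨p z.down⟩)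
    (continuous_uliftUp.comp (q.continuous.comp continuous_uliftDown))
    (continuous_uliftUp.comp (p.continuous.comp continuous_uliftDown))
    (fun w => let ⟨z, hz⟩ := hp w.down; ⟨⟨z⟩, ULift.ext _ _ hz⟩)
  exact ⟨⟨fun x => (h ⟨x⟩).down, continuous_uliftDown.comp (hc.comp continuous_uliftUp)⟩,
    fun x => congrArg ULift.down (congrFun hh ⟨x⟩)⟩

end Gleason

/-! ### Invariant measures and invariant sets -/

section Invariant

/-- The density of an invariant measure is invariant. -/
theorem rnDeriv_comp_ae_eq {Ω : Type*} [MeasurableSpace Ω] {ν lam : Measure Ω}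
    [IsFiniteMeasure ν] [IsFiniteMeasure lam] {τ τ' : Ω → Ω} (hτ : MeasurePreserving τ ν ν)
    (hτ' : Measurable τ') (hinv : ∀ ω, τ' (τ ω) = ω) (hac : lam ≪ ν)
    (hlam : MeasurePreserving τ' lam lam) :
    lam.rnDeriv ν ∘ τ =ᵐ[ν] lam.rnDeriv ν := by
  have hm := Measure.measurable_rnDeriv lam ν
  refine (withDensity_eq_iff (hm.comp hτ.measurable).aemeasurable hm.aemeasurable ?_).1 ?_
  · rw [show ∫⁻ x, (lam.rnDeriv ν ∘ τ) x ∂ν = _ from hτ.lintegral_comp hm]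
    exact (Measure.lintegral_rnDeriv_lt_top lam ν).ne
  · rw [Measure.withDensity_rnDeriv_eq _ _ hac]
    ext s hs
    have h : s = τ ⁻¹' (τ' ⁻¹' s) := by
      ext ω; simp [hinv]
    rw [withDensity_apply _ hs, h]
    change ∫⁻ a in τ ⁻¹' (τ' ⁻¹' s), lam.rnDeriv ν (τ a) ∂ν = _
    rw [hτ.setLIntegral_comp_preimage (hτ' hs) hm, ← withDensity_apply _ (hτ' hs),
      Measure.withDensity_rnDeriv_eq _ _ hac, ← h, hlam.measure_preimage hs.nullMeasurableSet]

/-- Invariant absolutely continuous measures are determined by their values on the invariant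
sets: the set where one density is smaller than the other is itself invariant. -/
theorem measure_eq_of_eq_on_invariant {Γ Ω : Type*} [Group Γ] [MeasurableSpace Ω]
    {ν lam lam' : Measure Ω} [IsFiniteMeasure ν] [IsFiniteMeasure lam] [IsFiniteMeasure lam'] {τ : Γ → Ω → Ω}
    (hτ : ∀ γ, MeasurePreserving (τ γ) ν ν) (hinv : ∀ γ ω, τ γ⁻¹ (τ γ ω) = ω)
    (hac : lam ≪ ν) (hac' : lam' ≪ ν) (hlam : ∀ γ, MeasurePreserving (τ γ) lam lam)
    (hlam' : ∀ γ, MeasurePreserving (τ γ) lam' lam')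
    (h : ∀ D, MeasurableSet D → (∀ γ, τ γ ⁻¹' D =ᵐ[ν] D) → lam D = lam' D) : lam = lam' := by
  have key : ∀ (lam lam' : Measure Ω) [IsFiniteMeasure lam] [IsFiniteMeasure lam'], lam ≪ ν →
      lam' ≪ ν → (∀ γ, MeasurePreserving (τ γ) lam lam) →
      (∀ γ, MeasurePreserving (τ γ) lam' lam') →
      (∀ D, MeasurableSet D → (∀ γ, τ γ ⁻¹' D =ᵐ[ν] D) → lam D = lam' D) →
      lam'.rnDeriv ν ≤ᵐ[ν] lam.rnDeriv ν := by
    intro lam lam' _ _ hac hac' hlam hlam' h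
    have hm := Measure.measurable_rnDeriv lam ν
    have hm' := Measure.measurable_rnDeriv lam' ν
    let D := {ω | lam.rnDeriv ν ω < lam'.rnDeriv ν ω}
    have hD : MeasurableSet D := measurableSet_lt hm hm'
    have hDi : ∀ γ, τ γ ⁻¹' D =ᵐ[ν] D := by
      intro γ
      filter_upwards [rnDeriv_comp_ae_eq (hτ γ) (hτ γ⁻¹).measurable (hinv γ) hac (hlam γ⁻¹),
        rnDeriv_comp_ae_eq (hτ γ) (hτ γ⁻¹).measurable (hinv γ) hac' (hlam' γ⁻¹)] with ω h1 h2
      simp only [Function.comp] at h1 h2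
      have : (τ γ ω ∈ D) = (ω ∈ D) := by simp only [D, mem_ofPred_eq, h1, h2]
      exact this
    have hEq := h D hD hDi
    by_contra hne
    have hpos : ν D ≠ 0 := by
      intro h0
      refine hne ?_
      filter_upwards [measure_eq_zero_iff_ae_notMem.1 h0] with ω hω
      exact not_lt.1 hω
    rw [← Measure.withDensity_rnDeriv_eq lam ν hac, ← Measure.withDensity_rnDeriv_eq lam' ν hac',
      withDensity_apply _ hD, withDensity_apply _ hD] at hEq
    refine (setLIntegral_strict_mono hD hpos hm' ?_ (ae_of_all _ fun ω hω => hω)).ne hEq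
    exact ((setLIntegral_le_lintegral _ _).trans_lt (Measure.lintegral_rnDeriv_lt_top lam ν)).ne
  have h1 := key lam lam' hac hac' hlam hlam' h
  have h2 := key lam' lam hac' hac hlam' hlam fun D hD hDi => (h D hD hDi).symm
  rw [← Measure.withDensity_rnDeriv_eq lam ν hac, ← Measure.withDensity_rnDeriv_eq lam' ν hac']
  exact withDensity_congr_ae (h2.antisymm h1)

/-- If `τ` acts ergodically on `Ω`, the sets in `Ω × Ω'` that are invariant under `τ × id` come
from the second factor. -/
theorem exists_ae_eq_preimage_snd {Γ Ω Ω' : Type*} [Group Γ] [MeasurableSpace Ω]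
    [MeasurableSpace Ω'] {ν : Measure Ω} {ν' : Measure Ω'} [IsProbabilityMeasure ν]
    [IsProbabilityMeasure ν'] {τ : Γ → Ω → Ω} (hτ : ∀ γ, MeasurePreserving (τ γ) ν ν)
    (hinv : ∀ γ ω, τ γ⁻¹ (τ γ ω) = ω)
    (herg : ∀ D, MeasurableSet D → (∀ γ, τ γ ⁻¹' D =ᵐ[ν] D) → ν D = 0 ∨ ν Dᶜ = 0)
    {E : Set (Ω × Ω')} (hE : MeasurableSet E)
    (hEi : ∀ γ, Prod.map (τ γ) id ⁻¹' E =ᵐ[ν.prod ν'] E) :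
    ∃ F : Set Ω', MeasurableSet F ∧ E =ᵐ[ν.prod ν'] Prod.snd ⁻¹' F := by
  -- for measurable `C ⊆ Ω'`, the measure `s ↦ (ν × ν') (E ∩ s × C)` is a multiple of `ν`
  have hprod : ∀ s C, MeasurableSet s → MeasurableSet C →
      ν.prod ν' (E ∩ s ×ˢ C) = ν.prod ν' (E ∩ univ ×ˢ C) * ν s := by
    intro s C hs hC
    let lam := (((ν.prod ν').restrict (E ∩ univ ×ˢ C))).map Prod.fst
    have hEC : MeasurableSet (E ∩ univ ×ˢ C) := hE.inter (MeasurableSet.univ.prod hC)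
    have hl : ∀ t, MeasurableSet t → lam t = ν.prod ν' (E ∩ t ×ˢ C) := by
      intro t ht
      rw [Measure.map_apply measurable_fst ht, Measure.restrict_apply (measurable_fst ht)]
      congr 1; ext ω; simp only [mem_inter_iff, mem_preimage, mem_prod, mem_univ, true_and]; tauto
    have hac : lam ≪ ν := by
      have h1 : lam ≪ (ν.prod ν').map Prod.fst :=
        Measure.restrict_le_self.absolutelyContinuous.map measurable_fst
      rwa [measurePreserving_fst.map_eq] at h1
    have : IsFiniteMeasure (ν.prod ν' (E ∩ univ ×ˢ C) • ν) :=
      ν.smul_finite (measure_ne_top _ _)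
    have := measure_eq_of_eq_on_invariant (lam := lam) (lam' := ν.prod ν' (E ∩ univ ×ˢ C) • ν) hτ hinv
      hac (Measure.smul_absolutelyContinuous) (fun γ => ⟨(hτ γ).measurable, ?_⟩)
      (fun γ => (hτ γ).smul_measure _) ?_
    · rw [← hl s hs, this]; simp
    · ext t ht
      rw [Measure.map_apply (hτ γ).measurable ht, hl _ ((hτ γ).measurable ht), hl _ ht]
      have hp : MeasurePreserving (Prod.map (τ γ) id) (ν.prod ν') (ν.prod ν') :=
        (hτ γ).prod (MeasurePreserving.id ν')
      have h1 : (E ∩ (τ γ ⁻¹' t) ×ˢ C : Set (Ω × Ω')) =ᵐ[ν.prod ν']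
          (Prod.map (τ γ) id ⁻¹' (E ∩ t ×ˢ C) : Set (Ω × Ω')) :=
        ae_eq_set_inter (hEi γ).symm EventuallyEq.rfl
      rw [measure_congr h1, hp.measure_preimage (hE.inter (ht.prod hC)).nullMeasurableSet]
    · intro D hD hDi
      rcases herg D hD hDi with h0 | h0
      · rw [hac h0]; simp [h0]
      · have h1 : ν D = 1 := (prob_compl_eq_zero_iff hD).1 h0
        have h2 : lam Dᶜ = 0 := hac h0
        have h3 : lam D = lam univ := by
          rw [← measure_add_measure_compl hD, h2, add_zero]
        rw [h3, hl _ MeasurableSet.univ]; simp [h1]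
  -- hence the indicator of `E` and the function `e ∘ snd` are densities of the same measure
  let e : Ω' → ℝ≥0∞ := fun y => ν ((fun x => (x, y)) ⁻¹' E)
  have he : Measurable e := measurable_measure_prodMk_right hE
  have hC : ∀ C, MeasurableSet C → ν.prod ν' (E ∩ univ ×ˢ C) = ∫⁻ y in C, e y ∂ν' := by
    intro C hC
    rw [Measure.prod_apply_symm (hE.inter (MeasurableSet.univ.prod hC)), ← lintegral_indicator hC]
    refine lintegral_congr fun y => ?_
    by_cases hy : y ∈ C <;> simp [hy, e, preimage]
  have h1 : (ν.prod ν').withDensity (E.indicator 1) = (ν.prod ν').withDensity (e ∘ Prod.snd) := by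
    rw [withDensity_indicator_one hE]
    have : (ν.prod ν').withDensity (e ∘ Prod.snd) = ν.prod (ν'.withDensity e)  :=
      (prod_withDensity_right he).symm
    rw [this]
    have hf : IsFiniteMeasure (ν'.withDensity e) := by
      refine isFiniteMeasure_withDensity ?_
      rw [← setLIntegral_univ, ← hC univ MeasurableSet.univ]
      exact measure_ne_top _ _
    refine (Measure.prod_eq fun s C hs hC' => ?_).symm
    rw [Measure.restrict_apply (hs.prod hC'), inter_comm, hprod s C hs hC', hC C hC',
      withDensity_apply _ hC', mul_comm]
  have h2 : E.indicator 1 =ᵐ[ν.prod ν'] e ∘ Prod.snd := by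
    refine (withDensity_eq_iff (measurable_one.indicator hE).aemeasurable
      (he.comp measurable_snd).aemeasurable ?_).1 h1
    rw [lintegral_indicator_one hE]
    exact measure_ne_top _ _
  refine ⟨e ⁻¹' {1}, he (measurableSet_singleton 1), ?_⟩
  filter_upwards [h2] with ω hω
  have : (ω ∈ E) = (e ω.2 = 1) := by
    by_cases h : ω ∈ E
    · simp [h] at hω ⊢; exact hω.symm
    · simp [h] at hω ⊢; rw [← hω]; exact zero_ne_one
  exact this

end Invariant

/-! ### The topology of `H \ K` -/

section Cosets

variable {K : Type*} [Group K] [TopologicalSpace K] (H : Subgroup K)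

namespace RightCosets

variable {H} in
theorem mk_eq_mk {a b : K} : mk H a = mk H b ↔ b * a⁻¹ ∈ H := by
  change Quotient.mk (QuotientGroup.rightRel H) a = Quotient.mk _ b ↔ _
  rw [Quotient.eq, QuotientGroup.rightRel_apply]

theorem mk_surjective : Function.Surjective (mk H) := Quotient.mk_surjective

instance [CompactSpace K] : CompactSpace (RightCosets H) :=
  inferInstanceAs (CompactSpace (Quotient _))

theorem translate_mk (a k : K) : translate k (mk H a) = mk H (a * k) := rfl

theorem translate_translate (k k' : K) (c : RightCosets H) :
    translate k' (translate k c) = translate (k * k') c := by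
  obtain ⟨a, rfl⟩ := mk_surjective H c
  simp only [translate_mk, mul_assoc]

variable [IsTopologicalGroup K]

theorem isOpenQuotientMap_mk : IsOpenQuotientMap (mk H) := by
  refine ⟨mk_surjective H, (mk H).continuous, fun U hU => ?_⟩
  have hq : IsQuotientMap (mk H) := isQuotientMap_quotient_mk'
  rw [← hq.isOpen_preimage]
  have : mk H ⁻¹' (mk H '' U) = ⋃ h : H, (fun k => (h : K) * k) ⁻¹' U := by
    ext k
    simp only [mem_preimage, mem_image, mem_iUnion, mk_eq_mk]
    constructor
    · rintro ⟨u, hu, hk⟩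
      exact ⟨⟨_, H.inv_mem hk⟩, by simpa using hu⟩
    · rintro ⟨h, hh⟩
      exact ⟨_, hh, by simp⟩
  rw [this]
  exact isOpen_iUnion fun h => hU.preimage (continuous_const_mul _)

instance [T2Space K] [CompactSpace H] : T2Space (RightCosets H) := by
  rw [t2Space_iff_of_isOpenQuotientMap (isOpenQuotientMap_mk H)]
  have hH : IsClosed (H : Set K) := (isCompact_iff_compactSpace.2 ‹_›).isClosed
  simp only [mk_eq_mk]
  exact hH.preimage (f := fun q : K × K => q.2 * q.1⁻¹) (by fun_prop)

theorem continuous_translate : Continuous fun x : RightCosets H × K => translate x.2 x.1 := by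
  have hq := ((isOpenQuotientMap_mk H).prodMap (IsOpenQuotientMap.id (X := K))).isQuotientMap
  rw [hq.continuous_iff]
  exact (mk H).continuous.comp continuous_mul

end RightCosets

end Cosets

/-! ### Haar measure and continuous functions -/

section HaarTools

variable {K : Type*} [Group K] [TopologicalSpace K] [IsTopologicalGroup K] [CompactSpace K]
  [MeasurableSpace K] [BaireMeasurableSpace K]

theorem haar_pos_of_isOpen {U : Set K} (hU : IsOpen U) (hm : MeasurableSet U)
    (hne : U.Nonempty) : 0 < haar K U := by
  rw [haar, Measure.map_apply (measurable_id_borel K) hm]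
  let : MeasurableSpace K := borel K
  have : BorelSpace K := ⟨rfl⟩
  exact hU.measure_pos (Measure.haarMeasure ⊤) hne

theorem eq_of_ae_eq_haar {f g : C(K, ℝ)} (h : f =ᵐ[haar K] g) : f = g := by
  by_contra hne
  obtain ⟨k, hk⟩ : ∃ k, f k ≠ g k := by
    by_contra! hh
    exact hne (ContinuousMap.ext hh)
  have hm : Measurable fun k => f k - g k :=
    measurable_real_of_continuous (f.continuous.sub g.continuous)
  have hpos := haar_pos_of_isOpen (U := (fun k => f k - g k) ⁻¹' {0}ᶜ)
    (isOpen_compl_singleton.preimage (f.continuous.sub g.continuous))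
    (hm (measurableSet_singleton 0).compl) ⟨k, by simpa [sub_eq_zero] using hk⟩
  refine hpos.ne' (measure_mono_null (fun x hx => ?_) h)
  simpa [sub_eq_zero] using hx

/-- Continuous functions are dense in `L¹` of Haar measure on the Baire σ-algebra. -/
theorem exists_continuous_integral_sub_le [T2Space K] {s : Set K} (hs : MeasurableSet s) {ε : ℝ}
    (hε : 0 < ε) : ∃ g : C(K, ℝ), ∫ k, |s.indicator 1 k - g k| ∂(haar K) ≤ ε := by
  have hsb : MeasurableSet[borel K] s := measurable_id_borel K hs
  have hb : ∃ g : C(K, ℝ), @integral K ℝ _ _ (borel K) (borelHaar K)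
      (fun k => |s.indicator (1 : K → ℝ) k - g k|) ≤ ε := by
    let : MeasurableSpace K := borel K
    have : BorelSpace K := ⟨rfl⟩
    have hP : IsProbabilityMeasure (borelHaar K) := ⟨borelHaar_univ K⟩
    have : (borelHaar K).Regular := inferInstanceAs (Measure.haarMeasure _).Regular
    have hi : Integrable (s.indicator (1 : K → ℝ)) (borelHaar K) :=
      (integrable_const (1 : ℝ)).indicator hsb
    obtain ⟨g, hg, -⟩ := hi.exists_boundedContinuous_integral_sub_le hε
    exact ⟨g.toContinuousMap, hg⟩
  obtain ⟨g, hg⟩ := hb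
  refine ⟨g, ?_⟩
  have hm : Measurable fun k => |s.indicator 1 k - g k| :=
    ((measurable_one.indicator hs).sub (measurable_real_of_continuous g.continuous)).norm
  rw [haar, @integral_map K ℝ _ _ (borel K) (borelHaar K) K _ id (measurable_id_borel K).aemeasurable _
    hm.stronglyMeasurable.aestronglyMeasurable]
  exact hg

end HaarTools

section Param

variable {Z P : Type*} [TopologicalSpace Z] [CompactSpace Z] [MeasurableSpace Z]
  [BaireMeasurableSpace Z] [TopologicalSpace P]

/-- Integrals of continuous functions against a weight depend continuously on a parameter. -/
theorem continuous_integral_mul {μ : Measure Z} [IsProbabilityMeasure μ] {f : Z → ℝ}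
    (hf : Measurable f) (hf1 : ∀ z, |f z| ≤ 1) {F : P → Z → ℝ}
    (hF : Continuous fun x : P × Z => F x.1 x.2) :
    Continuous fun p => ∫ z, f z * F p z ∂μ := by
  have hi : ∀ G : C(Z, ℝ), Integrable (fun z => f z * G z) μ := fun G =>
    Integrable.of_bound (hf.mul (measurable_real_of_continuous G.continuous)).aestronglyMeasurable
      ‖G‖ (ae_of_all _ fun z => by
        rw [norm_mul]
        exact (mul_le_of_le_one_left (norm_nonneg _) (hf1 z)).trans (G.norm_coe_le_norm z))
  have hL : LipschitzWith 1 fun G : C(Z, ℝ) => ∫ z, f z * G z ∂μ := by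
    refine LipschitzWith.of_dist_le_mul fun G G' => ?_
    rw [dist_eq_norm, ← integral_sub (hi G) (hi G'), NNReal.coe_one, one_mul, dist_eq_norm]
    have := norm_integral_le_of_norm_le_const (μ := μ) (f := fun z => f z * G z - f z * G' z)
      (C := ‖G - G'‖) (ae_of_all _ fun z => by
        rw [← mul_sub, norm_mul]
        exact (mul_le_of_le_one_left (norm_nonneg _) (hf1 z)).trans
          ((G - G').norm_coe_le_norm z))
    simpa using this
  exact hL.continuous.comp (ContinuousMap.curry ⟨fun x : P × Z => F x.1 x.2, hF⟩).continuous

end Param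

/-- A function with vanishing conditional expectation is orthogonal to the bounded functions of the
smaller σ-algebra. -/
theorem integral_mul_eq_zero_of_condExp {Ω : Type*} {m0 m : MeasurableSpace Ω} (hm : m0 ≤ m)
    {μ : Measure Ω} [IsFiniteMeasure μ] {u w : Ω → ℝ} (hu : StronglyMeasurable[m0] u) {C : ℝ}
    (huC : ∀ᵐ ω ∂μ, ‖u ω‖ ≤ C) (hw : Integrable w μ) (h0 : μ[w|m0] =ᵐ[μ] 0) :
    ∫ ω, u ω * w ω ∂μ = 0 := by
  have h1 := condExp_stronglyMeasurable_mul_of_bound hm hu hw C huC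
  have h2 := integral_condExp (μ := μ) hm (f := u * w)
  change ∫ ω, (u * w) ω ∂μ = 0
  have h3 : μ[u * w|m0] =ᵐ[μ] 0 := by
    filter_upwards [h0, h1] with ω hω hω'
    simp [hω, hω']
  rw [← h2, integral_congr_ae h3]
  simp

/-! ### Right-invariant σ-algebras on a compact group -/

section RightInvariant

variable {K : Type*} {m0 : MeasurableSpace K} [Group K] [TopologicalSpace K] [IsTopologicalGroup K]
  [CompactSpace K] [T2Space K] [m : MeasurableSpace K] [BaireMeasurableSpace K]

/-- Averages of right translates of an `m0`-measurable function are again `m0`-measurable: such an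
average is orthogonal to every function whose conditional expectation vanishes. -/
theorem measurable_of_eq_average (hm : m0 ≤ m)
    (hnull : ∀ s t, MeasurableSet[m0] s → MeasurableSet t → t =ᵐ[haar K] s → MeasurableSet[m0] t)
    (hright : ∀ (s : Set K) (k₀ : K), MeasurableSet[m0] s → MeasurableSet[m0] ((· * k₀) ⁻¹' s))
    {f : K → ℝ} (hf0 : Measurable[m0] f) (hf1 : ∀ k, |f k| ≤ 1) {φ : C(K, ℝ)}
    (hφb : ∀ v, |φ v| ≤ 1) {c : ℝ} {a : C(K, ℝ)}
    (ha : ∀ k, a k = c * ∫ v, f (k * v) * φ v ∂(haar K)) : Measurable[m0] a := by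
  have hfmul : Measurable fun x : K × K => f (x.1 * x.2) :=
    (hf0.mono hm le_rfl).comp (measurable_of_continuous continuous_mul)
  have hφm : Measurable φ := measurable_real_of_continuous φ.continuous
  have ham : Measurable a := measurable_real_of_continuous a.continuous
  have hai : Integrable a (haar K) :=
    Integrable.of_bound ham.aestronglyMeasurable _ (ae_of_all _ a.norm_coe_le_norm)
  let e := (haar K)[a|m0]
  have hei : Integrable e (haar K) := integrable_condExp
  let w := a - e
  have hw : Integrable w (haar K) := hai.sub hei
  have heb : ∀ᵐ k ∂(haar K), |e k| ≤ ‖a‖ :=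
    ae_bdd_abs_condExp_of_ae_bdd_abs (ae_of_all _ a.norm_coe_le_norm)
  have hwb : ∀ᵐ k ∂(haar K), ‖w k‖ ≤ ‖a‖ + ‖a‖ := by
    filter_upwards [heb] with k hk
    exact (norm_sub_le _ _).trans (add_le_add (a.norm_coe_le_norm k) hk)
  have hw0 : (haar K)[w|m0] =ᵐ[haar K] 0 := by
    have h1 := condExp_sub hai hei m0
    have h2 : (haar K)[e|m0] = e :=
      condExp_of_stronglyMeasurable hm stronglyMeasurable_condExp hei
    rw [h2] at h1
    filter_upwards [h1] with k hk
    simpa [e] using hk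
  have he0 : ∫ k, e k * w k ∂(haar K) = 0 :=
    integral_mul_eq_zero_of_condExp hm stronglyMeasurable_condExp
      heb hw hw0
  have ha0 : ∫ k, a k * w k ∂(haar K) = 0 := by
    have h1 : ∀ k, a k * w k = c * ∫ v, f (k * v) * φ v * w k ∂(haar K) := by
      intro k
      rw [integral_mul_const, ← mul_assoc]
      exact congrArg (· * w k) (ha k)
    have h2 : Integrable (Function.uncurry fun k v => f (k * v) * φ v * w k)
        ((haar K).prod (haar K)) := by
      refine (hw.comp_fst (haar K)).bdd_mul (c := 1) (f := fun x : K × K => f (x.1 * x.2) * φ x.2) ?_ ?_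
      · exact (hfmul.mul (hφm.comp measurable_snd)).aestronglyMeasurable
      · refine ae_of_all _ fun x => ?_
        rw [norm_mul]
        exact mul_le_one₀ (hf1 _) (norm_nonneg _) (hφb _)
    simp only [h1]
    rw [integral_const_mul, integral_integral_swap h2]
    have h3 : ∀ v, ∫ k, f (k * v) * φ v * w k ∂(haar K) = 0 := by
      intro v
      have h4 : Measurable[m0] fun k => f (k * v) := by
        intro t ht
        exact hright _ v (hf0 ht)
      have h5 := integral_mul_eq_zero_of_condExp hm h4.stronglyMeasurable
        (ae_of_all (haar K) fun k => hf1 (k * v)) hw hw0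
      have h6 : ∀ k, f (k * v) * φ v * w k = φ v * (f (k * v) * w k) := fun k => by ring
      simp only [h6]
      rw [integral_const_mul, h5, mul_zero]
    simp [h3]
  have hww : ∫ k, w k * w k ∂(haar K) = 0 := by
    have h1 : ∀ k, w k * w k = a k * w k - e k * w k := fun k => by
      simp only [w, Pi.sub_apply]; ring
    simp only [h1]
    rw [integral_sub, ha0, he0, sub_zero]
    · exact hai.mul_bdd hw.aestronglyMeasurable hwb
    · exact hei.mul_bdd hw.aestronglyMeasurable hwb
  have hae : a =ᵐ[haar K] e := by
    have h1 := (integral_eq_zero_iff_of_nonneg (fun k => mul_self_nonneg (w k))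
      (hw.mul_bdd hw.aestronglyMeasurable hwb)).1 hww
    filter_upwards [h1] with k hk
    exact sub_eq_zero.1 (mul_self_eq_zero.1 hk)
  intro t ht
  refine hnull _ _ ((stronglyMeasurable_condExp (m := m0) (μ := haar K) (f := a)).measurable ht)
    (ham ht) ?_
  filter_upwards [hae] with k hk
  have : (a k ∈ t) = (e k ∈ t) := by rw [hk]
  exact this

/-- Averaging a set of a right-invariant σ-algebra over small right translations gives
continuous functions that are measurable with respect to this σ-algebra. -/
theorem exists_continuous_measurable_integral_sub_le (hm : m0 ≤ m)
    (hnull : ∀ s t, MeasurableSet[m0] s → MeasurableSet t → t =ᵐ[haar K] s → MeasurableSet[m0] t)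
    (hright : ∀ (s : Set K) (k₀ : K), MeasurableSet[m0] s → MeasurableSet[m0] ((· * k₀) ⁻¹' s))
    {s : Set K} (hs : MeasurableSet[m0] s) {ε : ℝ} (hε : 0 < ε) :
    ∃ a : C(K, ℝ), Measurable[m0] a ∧ ∫ k, |s.indicator 1 k - a k| ∂(haar K) ≤ ε := by
  let δ := ε / 3
  have hδ : 0 < δ := by positivity
  let f : K → ℝ := s.indicator 1
  have hf0 : Measurable[m0] f := by
    refine Measurable.indicator (f := 1) ?_ hs
    exact measurable_const
  have hf : Measurable f := hf0.mono hm le_rfl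
  have hf1 : ∀ k, |f k| ≤ 1 := fun k => by
    by_cases h : k ∈ s <;> simp [f, h]
  obtain ⟨g, hg⟩ := exists_continuous_integral_sub_le (hm s hs) hδ
  have hgm : Measurable g := measurable_real_of_continuous g.continuous
  -- a neighbourhood of the unit on which `g` hardly changes under right translation
  let R : C(K, C(K, ℝ)) := ContinuousMap.curry ⟨fun x : K × K => g (x.2 * x.1), by fun_prop⟩
  have hR : ∀ v k, R v k = g (k * v) := fun v k => rfl
  have hU : IsOpen {v | dist (R v) g < δ} :=
    isOpen_lt (R.continuous.dist continuous_const) continuous_const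
  have h1U : (1 : K) ∈ {v | dist (R v) g < δ} := by
    have : R 1 = g := by ext k; simp [hR]
    simpa [this] using hδ
  obtain ⟨φ, hφ0, hφ1, hφ⟩ := exists_continuous_zero_one_of_isClosed hU.isClosed_compl
    (isClosed_singleton (x := (1 : K))) (by simpa using h1U)
  have hφm : Measurable φ := measurable_real_of_continuous φ.continuous
  have hφn : ∀ v, 0 ≤ φ v := fun v => (hφ v).1
  have hφb : ∀ v, |φ v| ≤ 1 := fun v => by rw [abs_of_nonneg (hφn v)]; exact (hφ v).2
  have hφi : Integrable φ (haar K) := Integrable.of_bound hφm.aestronglyMeasurable 1 (ae_of_all _ hφb)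
  let c := ∫ v, φ v ∂(haar K)
  have hc : 0 < c := by
    refine (integral_pos_iff_support_of_nonneg hφn hφi).2
      (haar_pos_of_isOpen ?_ (hφm (measurableSet_singleton 0).compl) ⟨1, ?_⟩)
    · exact isOpen_compl_singleton.preimage φ.continuous
    · simp [hφ1 rfl]
  have hmul : Measurable fun x : K × K => x.1 * x.2 := measurable_of_continuous continuous_mul
  have hfmul : Measurable fun x : K × K => f (x.1 * x.2) := hf.comp hmul
  -- the average of the right translates of `f`
  let a' : K → ℝ := fun k => c⁻¹ * ∫ v, f (k * v) * φ v ∂(haar K)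
  have ha' : ∀ k, a' k = c⁻¹ * ∫ v, f v * φ (k⁻¹ * v) ∂(haar K) := by
    intro k
    have h1 := measurePreserving_mul k 1
    simp only [mul_one] at h1
    have h2 : AEStronglyMeasurable (fun v => f v * φ (k⁻¹ * v)) (haar K) :=
      (hf.mul (measurable_real_of_continuous
        (φ.continuous.comp (continuous_const_mul k⁻¹)))).aestronglyMeasurable
    rw [← h1.map_eq] at h2
    have h3 := integral_map h1.measurable.aemeasurable h2
    rw [h1.map_eq] at h3
    simp only [a', h3, inv_mul_cancel_left]
  -- moving the translation to `φ` shows that the average is continuous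
  have hac : Continuous a' := by
    rw [funext ha']
    exact continuous_const.mul (continuous_integral_mul hf hf1
      (F := fun k v => φ (k⁻¹ * v)) (by fun_prop))
  let a : C(K, ℝ) := ⟨a', hac⟩
  refine ⟨a, measurable_of_eq_average hm hnull hright hf0 hf1 hφb (c := c⁻¹) fun k => rfl, ?_⟩
  have hφc : ∀ k, f k - a k = c⁻¹ * ∫ v, (f k - f (k * v)) * φ v ∂(haar K) := by
    intro k
    have hi1 : Integrable (fun v => f (k * v) * φ v) (haar K) := by
      refine hφi.bdd_mul (c := 1) ?_ (ae_of_all _ fun v => hf1 _)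
      exact (hfmul.comp (measurable_const.prodMk measurable_id)).aestronglyMeasurable
    simp only [sub_mul]
    rw [integral_sub (hφi.const_mul _) hi1, integral_const_mul, mul_sub, mul_left_comm,
      inv_mul_cancel₀ hc.ne', mul_one]
    rfl
  have hbd : ∀ x : K × K, |f x.1 - f (x.1 * x.2)| ≤ 2 := fun x =>
    (abs_sub _ _).trans (by linarith [hf1 x.1, hf1 (x.1 * x.2)])
  have hdm : Measurable fun x : K × K => |f x.1 - f (x.1 * x.2)| :=
    ((hf.comp measurable_fst).sub hfmul).norm
  have hi2 : Integrable (Function.uncurry fun k v => |f k - f (k * v)| * φ v)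
      ((haar K).prod (haar K)) := by
    refine (hφi.comp_snd (haar K)).bdd_mul (c := 2)
      (f := fun x : K × K => |f x.1 - f (x.1 * x.2)|) hdm.aestronglyMeasurable
      (ae_of_all _ fun x => ?_)
    rw [Real.norm_eq_abs, abs_abs]
    exact hbd x
  have hgi : Integrable g (haar K) :=
    Integrable.of_bound hgm.aestronglyMeasurable _ (ae_of_all _ g.norm_coe_le_norm)
  have hfi : Integrable f (haar K) := Integrable.of_bound hf.aestronglyMeasurable 1 (ae_of_all _ hf1)
  have htr : ∀ v, ∫ k, |f k - f (k * v)| * φ v ∂(haar K) ≤ 3 * δ * φ v := by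
    intro v
    rw [integral_mul_const]
    by_cases hv : v ∈ {v | dist (R v) g < δ}
    · refine mul_le_mul_of_nonneg_right ?_ (hφn v)
      have hmp : MeasurePreserving (fun k => k * v) (haar K) (haar K) := by
        simpa using measurePreserving_mul 1 v
      have h1 : ∀ k, |f k - f (k * v)| ≤ |f k - g k| + (δ + |f (k * v) - g (k * v)|) := by
        intro k
        have h2 : |g (k * v) - g k| ≤ δ := by
          have h3 := (ContinuousMap.dist_apply_le_dist (f := R v) (g := g) k).trans hv.le
          rwa [Real.dist_eq, hR] at h3
        have h4 : f k - f (k * v) = (f k - g k) - ((g (k * v) - g k) + (f (k * v) - g (k * v))) := by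
          ring
        rw [h4]
        refine (abs_sub _ _).trans (add_le_add_right ((abs_add_le _ _).trans ?_) _)
        exact add_le_add_left h2 _
      have hi3 : Integrable (fun k => |f k - g k|) (haar K) := (hfi.sub hgi).abs
      have hi4 : Integrable (fun k => |f (k * v) - g (k * v)|) (haar K) :=
        hmp.integrable_comp_of_integrable hi3
      have h5 : ∫ k, |f (k * v) - g (k * v)| ∂(haar K) = ∫ k, |f k - g k| ∂(haar K) := by
        have h6 := hi3.aestronglyMeasurable
        rw [← hmp.map_eq] at h6
        have h7 := integral_map hmp.measurable.aemeasurable h6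
        rw [hmp.map_eq] at h7
        exact h7.symm
      refine (integral_mono ((hfi.sub (hmp.integrable_comp_of_integrable hfi)).abs)
        (hi3.add ((integrable_const δ).add hi4)) h1).trans ?_
      rw [integral_add' hi3 ((integrable_const δ).add hi4), integral_add' (integrable_const δ) hi4, h5]
      simp only [integral_const, probReal_univ, one_smul]
      linarith
    · have : φ v = 0 := hφ0 hv
      simp [this]
  calc ∫ k, |f k - a k| ∂(haar K)
      ≤ ∫ k, c⁻¹ * ∫ v, |f k - f (k * v)| * φ v ∂(haar K) ∂(haar K) := by
        refine integral_mono_of_nonneg (ae_of_all _ fun k => abs_nonneg _)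
          (hi2.integral_prod_left.const_mul _) (ae_of_all _ fun k => ?_)
        change |f k - a k| ≤ _
        rw [hφc, abs_mul, abs_of_pos (inv_pos.2 hc)]
        refine mul_le_mul_of_nonneg_left ?_ (inv_pos.2 hc).le
        refine abs_integral_le_integral_abs.trans
          (le_of_eq (integral_congr_ae (ae_of_all _ fun v => ?_)))
        simp only [abs_mul, abs_of_nonneg (hφn v)]
    _ = c⁻¹ * ∫ v, ∫ k, |f k - f (k * v)| * φ v ∂(haar K) ∂(haar K) := by
        rw [integral_const_mul, integral_integral_swap hi2]
    _ ≤ c⁻¹ * ∫ v, 3 * δ * φ v ∂(haar K) :=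
        mul_le_mul_of_nonneg_left (integral_mono hi2.integral_prod_right (hφi.const_mul _) htr)
          (inv_pos.2 hc).le
    _ = ε := by
        rw [integral_const_mul]
        change c⁻¹ * (3 * δ * c) = ε
        rw [mul_left_comm, inv_mul_cancel₀ hc.ne']
        simp only [δ]; ring

/-- A right-invariant σ-algebra on a compact group consists, up to null sets, of the preimages of
sets of right cosets of a closed subgroup: the subgroup of the common left periods of its continuous
functions. -/
theorem exists_subgroup_of_rightInvariant (hm : m0 ≤ m)
    (hnull : ∀ s t, MeasurableSet[m0] s → MeasurableSet t → t =ᵐ[haar K] s → MeasurableSet[m0] t)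
    (hright : ∀ (s : Set K) (k₀ : K), MeasurableSet[m0] s → MeasurableSet[m0] ((· * k₀) ⁻¹' s)) :
    ∃ H : Subgroup K, CompactSpace H ∧
      (∀ E : Set (RightCosets H), MeasurableSet E → MeasurableSet[m0] (RightCosets.mk H ⁻¹' E)) ∧
      ∀ s, MeasurableSet[m0] s →
        ∃ E : Set (RightCosets H), MeasurableSet E ∧ s =ᵐ[haar K] RightCosets.mk H ⁻¹' E := by
  let H : Subgroup K :=
    { carrier := {h | ∀ f : C(K, ℝ), Measurable[m0] f → ∀ k, f (h * k) = f k}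
      one_mem' := fun f _ k => by rw [one_mul]
      mul_mem' := fun {a b} ha hb f hf k => by rw [mul_assoc, ha f hf, hb f hf]
      inv_mem' := fun {a} ha f hf k => by rw [← ha f hf, mul_inv_cancel_left] }
  have hHc : IsClosed (H : Set K) := by
    have : (H : Set K) = ⋂ (f : C(K, ℝ)) (_ : Measurable[m0] f) (k : K), {h | f (h * k) = f k} := by
      ext h; simp only [mem_iInter]; rfl
    rw [this]
    exact isClosed_iInter fun f => isClosed_iInter fun _ => isClosed_iInter fun k =>
      isClosed_eq (by fun_prop) continuous_const
  -- every `m0`-measurable continuous function descends to the cosets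
  have hdesc : ∀ f : C(K, ℝ), Measurable[m0] f →
      ∃ u : C(RightCosets H, ℝ), ∀ k, u (RightCosets.mk H k) = f k := by
    intro f hf
    have hl : ∀ a b, QuotientGroup.rightRel H a b → f a = f b := by
      intro a b hab
      have := (QuotientGroup.rightRel_apply.1 hab : b * a⁻¹ ∈ H) f hf a
      rw [← this, inv_mul_cancel_right]
    exact ⟨⟨Quotient.lift f hl, f.continuous.quotient_lift hl⟩, fun k => rfl⟩
  -- these functions separate cosets, as the algebra they form is right invariant
  have hmk : ∀ g : C(RightCosets H, ℝ), Measurable[m0] fun k => g (RightCosets.mk H k) := by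
    intro g
    refine (measurable_of_separatesPoints (m := MeasurableSpace.map (RightCosets.mk H) m0) ?_ g)
    intro x y hxy
    obtain ⟨a, rfl⟩ := RightCosets.mk_surjective H x
    obtain ⟨b, rfl⟩ := RightCosets.mk_surjective H y
    by_contra! hall
    refine hxy (RightCosets.mk_eq_mk.2 fun f hf k => ?_)
    have hfr : Measurable[m0] (f.comp ⟨fun x => x * (a⁻¹ * k), continuous_mul_const _⟩) := by
      intro t ht
      exact hright _ (a⁻¹ * k) (hf ht)
    obtain ⟨u, hu⟩ := hdesc _ hfr
    have h1 := hall u (by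
      intro t ht
      have := hfr ht
      change MeasurableSet[m0] (RightCosets.mk H ⁻¹' (u ⁻¹' t))
      convert this using 1
      ext k; simp only [mem_preimage, hu])
    rw [hu, hu] at h1
    simpa [mul_assoc] using h1.symm
  refine ⟨H, isCompact_iff_compactSpace.1 hHc.isCompact, ?_, ?_⟩
  · have := @measurable_to_baire K (RightCosets H) m0 _ _ _ (RightCosets.mk H) hmk
    exact fun E hE => this hE
  · intro s hs
    have hn : ∀ n : ℕ, ∃ a : C(K, ℝ), Measurable[m0] a ∧
        ∫ k, |s.indicator 1 k - a k| ∂(haar K) ≤ 1 / ((n : ℝ) + 1) := fun n =>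
      exists_continuous_measurable_integral_sub_le hm hnull hright hs Nat.one_div_pos_of_nat
    choose a ham ha using hn
    have haM : ∀ n, Measurable (a n) := fun n => measurable_real_of_continuous (a n).continuous
    have hsM : Measurable (s.indicator (1 : K → ℝ)) := measurable_one.indicator (hm s hs)
    choose u hu using fun n => hdesc (a n) (ham n)
    have hint : ∀ n, Integrable (fun k => s.indicator 1 k - a n k) (haar K) := by
      intro n
      exact ((integrable_const (1 : ℝ)).indicator (hm s hs)).sub
        (Integrable.of_bound (haM n).aestronglyMeasurable _ (ae_of_all _ (a n).norm_coe_le_norm))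
    have hlim : TendstoInMeasure (haar K) (fun n k => a n k) atTop (s.indicator (1 : K → ℝ)) := by
      refine tendstoInMeasure_of_tendsto_eLpNorm one_ne_zero (fun n => (haM n).aestronglyMeasurable)
        hsM.aestronglyMeasurable ?_
      have h1 : ∀ n, eLpNorm ((fun k => a n k) - s.indicator (1 : K → ℝ)) 1 (haar K) ≤
          ENNReal.ofReal (1 / ((n : ℝ) + 1)) := by
        intro n
        rw [eLpNorm_sub_comm, eLpNorm_one_eq_lintegral_enorm]
        change ∫⁻ k, ‖s.indicator 1 k - a n k‖ₑ ∂(haar K) ≤ _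
        rw [← ofReal_integral_norm_eq_lintegral_enorm (hint n)]
        exact ENNReal.ofReal_le_ofReal (ha n)
      have h2 := ENNReal.tendsto_ofReal (tendsto_one_div_add_atTop_nhds_zero_nat (𝕜 := ℝ))
      rw [ENNReal.ofReal_zero] at h2
      exact tendsto_of_tendsto_of_tendsto_of_le_of_le tendsto_const_nhds h2 (fun _ => zero_le) h1
    obtain ⟨ns, -, hns⟩ := hlim.exists_seq_tendsto_ae
    -- the functions `u (ns n)` on the cosets tend to the indicator of `s` almost everywhere
    refine ⟨{x | ∃ N, ∀ n ≥ N, 1 / 2 < u (ns n) x}, ?_, ?_⟩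
    · have : {x | ∃ N, ∀ n ≥ N, 1 / 2 < u (ns n) x} =
          ⋃ N, ⋂ n, ⋂ (_ : n ≥ N), u (ns n) ⁻¹' Ioi (1 / 2) := by
        ext x; simp only [mem_iUnion, mem_iInter]; rfl
      rw [this]
      exact MeasurableSet.iUnion fun N => MeasurableSet.iInter fun n => MeasurableSet.iInter fun _ =>
        measurable_real_of_continuous (u (ns n)).continuous measurableSet_Ioi
    · filter_upwards [hns] with k hk
      have : (k ∈ s) = ∃ N, ∀ n ≥ N, 1 / 2 < u (ns n) (RightCosets.mk H k) := by
        simp only [hu, eq_iff_iff, ← eventually_atTop]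
        by_cases h : k ∈ s
        · rw [indicator_of_mem h] at hk
          simp only [h, true_iff]
          exact hk.eventually_const_lt (by norm_num)
        · rw [indicator_of_notMem h] at hk
          simp only [h, false_iff]
          intro hev
          obtain ⟨n, h1, h2⟩ := (hev.and (hk.eventually_lt_const (u := 1 / 2) (by norm_num))).exists
          linarith
      exact this

end RightInvariant

/-! ### Ergodic actions -/

section Ergodicity

theorem Action.IsErgodic.measure_eq_zero_or {Γ A : Type*} [Group Γ] [ProbAlg A] {S : Action Γ A}
    (hS : S.IsErgodic) {D : Set (Stone A)} (hD : MeasurableSet D)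
    (hDi : ∀ γ, Stone.map (S.pull γ) ⁻¹' D =ᵐ[Stone.measure A] D) :
    Stone.measure A D = 0 ∨ Stone.measure A Dᶜ = 0 := by
  obtain ⟨a, ha⟩ := Stone.exists_clopen_ae_eq hD
  have hinv : a ∈ S.inv := by
    intro γ
    rw [← Stone.clopen_ae_eq_iff, ← Stone.map_preimage_clopen]
    exact (((Stone.measurePreserving_map (S.pull γ)).quasiMeasurePreserving.preimage_ae_eq
      ha).symm.trans (hDi γ)).trans ha
  rcases hS a hinv with rfl | rfl
  · left; rw [measure_congr ha]; simp
  · right; rw [measure_congr ha.compl]; simp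

theorem Action.map_inv_map {Γ A : Type*} [Group Γ] [ProbAlg A] (S : Action Γ A) (γ : Γ)
    (x : Stone A) : Stone.map (S.pull γ⁻¹) (Stone.map (S.pull γ) x) = x := by
  refine Subtype.ext (funext fun b => ?_)
  change x.1 (S.pull γ (S.pull γ⁻¹ b)) = x.1 b
  rw [← S.pull_mul, inv_mul_cancel, S.pull_one]

variable {K : Type*} [Group K] [TopologicalSpace K] [IsTopologicalGroup K] [CompactSpace K]
  [MeasurableSpace K] [BaireMeasurableSpace K]

theorem measurePreserving_mul_const (k₀ : K) :
    MeasurePreserving (fun k => k * k₀) (haar K) (haar K) := by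
  simpa using measurePreserving_mul 1 k₀

theorem measurePreserving_map_id {Γ A : Type*} [Group Γ] [ProbAlg A] (S : Action Γ A) (γ : Γ) :
    MeasurePreserving (Prod.map (Stone.map (S.pull γ)) id) (prodHaar A K) (prodHaar A K) :=
  (Stone.measurePreserving_map (S.pull γ)).prod (MeasurePreserving.id (haar K))

variable [T2Space K]

/-- The right translations of a compact group are ergodic for Haar measure. -/
theorem haar_eq_zero_or_of_rightInvariant {D : Set K} (hD : MeasurableSet D)
    (hDi : ∀ k₀ : K, (· * k₀) ⁻¹' D =ᵐ[haar K] D) : haar K D = 0 ∨ haar K Dᶜ = 0 := by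
  -- by invariance, almost no pair `(k, k₀)` satisfies `k ∉ D` and `k * k₀ ∈ D`
  let P : Set (K × K) := {x | x.1 ∈ Dᶜ ∧ x.1 * x.2 ∈ D}
  have hP : MeasurableSet P :=
    (measurable_fst hD.compl).inter (measurable_of_continuous continuous_mul hD)
  have h1 : (haar K).prod (haar K) P = 0 := by
    rw [Measure.prod_apply_symm hP]
    refine (lintegral_eq_zero_iff (measurable_measure_prodMk_right hP)).2 (ae_of_all _ fun k₀ => ?_)
    change haar K (Dᶜ ∩ (· * k₀) ⁻¹' D) = 0
    have h : (Dᶜ ∩ (· * k₀) ⁻¹' D : Set K) =ᵐ[haar K] (Dᶜ ∩ D : Set K) :=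
      ae_eq_set_inter EventuallyEq.rfl (hDi k₀)
    rw [measure_congr h, compl_inter_self, measure_empty]
  have h2 : (haar K).prod (haar K) P = haar K D * haar K Dᶜ := by
    rw [Measure.prod_apply hP]
    have : ∀ k, haar K (Prod.mk k ⁻¹' P) = Dᶜ.indicator (fun _ => haar K D) k := by
      intro k
      by_cases hk : k ∈ D
      · have : Prod.mk k ⁻¹' P = ∅ := by ext x; simp [P, hk]
        simp [this, hk]
      · have h3 : Prod.mk k ⁻¹' P = (fun x => k * x * 1) ⁻¹' D := by ext x; simp [P, hk]
        rw [h3, (measurePreserving_mul k 1).measure_preimage hD.nullMeasurableSet]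
        simp [hk]
    simp only [this]
    rw [lintegral_indicator hD.compl, setLIntegral_const]
  rw [h1] at h2
  exact mul_eq_zero.1 h2.symm

/-- The elements of a skew product that are invariant under `K^op` come from the base. -/
theorem exists_ae_eq_preimage_fst_of_rightInvariant {B : Type*} [ProbAlg B]
    {E : Set (Stone B × K)} (hE : MeasurableSet E)
    (hEi : ∀ k₀, rightMap k₀ ⁻¹' E =ᵐ[prodHaar B K] E) :
    ∃ F : Set (Stone B), MeasurableSet F ∧ E =ᵐ[prodHaar B K] Prod.fst ⁻¹' F := by
  have hsw : MeasurePreserving Prod.swap ((haar K).prod (Stone.measure B)) (prodHaar B K) :=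
    Measure.measurePreserving_swap
  have hsw' : MeasurePreserving Prod.swap (prodHaar B K) ((haar K).prod (Stone.measure B)) :=
    Measure.measurePreserving_swap
  obtain ⟨F, hF, h⟩ := exists_ae_eq_preimage_snd (Γ := K) (τ := fun k₀ (k : K) => k * k₀)
    measurePreserving_mul_const (fun γ ω => by simp)
    (fun D hD hDi => haar_eq_zero_or_of_rightInvariant hD hDi)
    (E := Prod.swap ⁻¹' E) (hsw.measurable hE)
    (fun k₀ => hsw.quasiMeasurePreserving.preimage_ae_eq (hEi k₀))
  exact ⟨F, hF, hsw'.quasiMeasurePreserving.preimage_ae_eq h⟩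

end Ergodicity

/-! ### The invariant factor and the existence of a Mackey range -/

section Skew

variable {Γ A B K : Type*} [Group Γ] [ProbAlg A] [ProbAlg B] [Group K] [TopologicalSpace K]
  [IsTopologicalGroup K] [CompactSpace K] [T2Space K] [MeasurableSpace K] [BaireMeasurableSpace K]
  {S : Action Γ A} {T : Action Γ B}

/-- The map `(y, k) ↦ (T^γ y, ρ_γ(y) k)`. -/
noncomputable def Cocycle.skewFun (ρ : Cocycle T K) (γ : Γ) : Stone B × K → Stone B × K :=
  skewMap (Stone.map (T.pull γ)) (ρ.toFun γ).rep

theorem Cocycle.measurePreserving_skewFun (ρ : Cocycle T K) (γ : Γ) :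
    MeasurePreserving (ρ.skewFun γ) (prodHaar B K) (prodHaar B K) :=
  measurePreserving_skewMap _ _

theorem Cocycle.skewFun_inv_skewFun (ρ : Cocycle T K) (γ : Γ) (x : Stone B × K) :
    ρ.skewFun γ⁻¹ (ρ.skewFun γ x) = x := by
  refine Prod.ext (T.map_inv_map γ x.1) ?_
  change (ρ.toFun γ⁻¹).rep (Stone.map (T.pull γ) x.1) * ((ρ.toFun γ).rep x.1 * x.2) = x.2
  have h : (ρ.toFun (γ⁻¹ * γ)).rep x.1 =
      (ρ.toFun γ⁻¹).rep (Stone.map (T.pull γ) x.1) * (ρ.toFun γ).rep x.1 := by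
    rw [ρ.map_mul, Cond.rep_mul, Cond.rep_pull]; rfl
  rw [← mul_assoc, ← h, inv_mul_cancel, ρ.map_one, Cond.rep_one]
  exact one_mul _

theorem Cocycle.mk_mem_inv_iff (ρ : Cocycle T K) {D : Set (Stone B × K)} (hD : MeasurableSet D) :
    MeasAlg.mk _ ⟨D, hD⟩ ∈ ρ.skewProduct.inv ↔
      ∀ γ, ρ.skewFun γ ⁻¹' D =ᵐ[prodHaar B K] D :=
  forall_congr' fun _ => MeasAlg.mk_eq_mk

namespace GroupExtension

variable (X : GroupExtension S T K)

/-- The map `Π(x, k) = (π(x), θ(x) k)`. -/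
noncomputable def prodFun : Stone A × K → Stone B × K := skewMap (Stone.map X.π) X.θ.rep

theorem measurePreserving_prodFun :
    MeasurePreserving X.prodFun (prodHaar A K) (prodHaar B K) :=
  measurePreserving_skewMap _ _

theorem map_π_map (γ : Γ) (x : Stone A) :
    Stone.map X.π (Stone.map (S.pull γ) x) = Stone.map (T.pull γ) (Stone.map X.π x) :=
  Subtype.ext (funext fun b => congrArg x.1 (X.pull_π γ b))

theorem θ_rep_map (γ : Γ) (x : Stone A) : X.θ.rep (Stone.map (S.pull γ) x) =
    (X.ρ.toFun γ).rep (Stone.map X.π x) * X.θ.rep x := by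
  have h := congrArg Cond.rep (X.θ_pull γ)
  rw [Cond.rep_mul, Cond.rep_pull, Cond.rep_pull] at h
  exact congrArg (fun F : C(Stone A, K) => F x) h

theorem prodFun_map (γ : Γ) (x : Stone A × K) :
    X.prodFun (Prod.map (Stone.map (S.pull γ)) id x) = X.ρ.skewFun γ (X.prodFun x) := by
  refine Prod.ext (X.map_π_map γ x.1) ?_
  change X.θ.rep (Stone.map (S.pull γ) x.1) * x.2 =
    (X.ρ.toFun γ).rep (Stone.map X.π x.1) * (X.θ.rep x.1 * x.2)
  rw [θ_rep_map, mul_assoc]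

/-- `Π` loses no information on sets of `Y ⋊_ρ K`, since its pullback map is injective. -/
theorem preimage_prodFun_ae_eq_iff {D D' : Set (Stone B × K)} (hD : MeasurableSet D)
    (hD' : MeasurableSet D') : X.prodFun ⁻¹' D =ᵐ[prodHaar A K] X.prodFun ⁻¹' D' ↔
      D =ᵐ[prodHaar B K] D' := by
  have h := X.prodPull.injective.eq_iff (a := MeasAlg.mk _ ⟨D, hD⟩) (b := MeasAlg.mk _ ⟨D', hD'⟩)
  rw [MeasAlg.mk_eq_mk] at h
  rw [← h]
  exact (MeasAlg.mk_eq_mk (ν := prodHaar A K)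
    (s := ⟨X.prodFun ⁻¹' D, X.measurePreserving_prodFun.measurable hD⟩)
    (t := ⟨X.prodFun ⁻¹' D', X.measurePreserving_prodFun.measurable hD'⟩)).symm

variable {X}

/-- Since `X` is ergodic, an invariant element of `Y ⋊_ρ K` becomes a function of the vertical
coordinate on `X ⋊_1 K`. -/
theorem exists_preimage_prodFun_ae_eq (hS : S.IsErgodic) {D : Set (Stone B × K)}
    (hD : MeasurableSet D) (hDi : ∀ γ, X.ρ.skewFun γ ⁻¹' D =ᵐ[prodHaar B K] D) :
    ∃ s : Set K, MeasurableSet s ∧ X.prodFun ⁻¹' D =ᵐ[prodHaar A K] Prod.snd ⁻¹' s := by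
  refine exists_ae_eq_preimage_snd (τ := fun γ => Stone.map (S.pull γ))
    (fun γ => Stone.measurePreserving_map _) S.map_inv_map
    (fun D hD hDi => hS.measure_eq_zero_or hD hDi) (X.measurePreserving_prodFun.measurable hD)
    fun γ => ?_
  have h := X.measurePreserving_prodFun.quasiMeasurePreserving.preimage_ae_eq (hDi γ)
  have h2 : Prod.map (Stone.map (S.pull γ)) id ⁻¹' (X.prodFun ⁻¹' D) =
      X.prodFun ⁻¹' (X.ρ.skewFun γ ⁻¹' D) := by
    ext x
    simp only [mem_preimage, X.prodFun_map]
  rw [h2]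
  exact h

/-- An element of `Y ⋊_ρ K` that becomes a function of the vertical coordinate on `X ⋊_1 K` is
invariant. -/
theorem invariant_of_preimage_prodFun_ae_eq {D : Set (Stone B × K)} (hD : MeasurableSet D)
    {s : Set K} (hs : X.prodFun ⁻¹' D =ᵐ[prodHaar A K] Prod.snd ⁻¹' s) (γ : Γ) :
    X.ρ.skewFun γ ⁻¹' D =ᵐ[prodHaar B K] D := by
  rw [← X.preimage_prodFun_ae_eq_iff ((X.ρ.measurePreserving_skewFun γ).measurable hD) hD]
  have h := (measurePreserving_map_id S γ).quasiMeasurePreserving.preimage_ae_eq hs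
  have h2 : Prod.map (Stone.map (S.pull γ)) id ⁻¹' (X.prodFun ⁻¹' D) =
      X.prodFun ⁻¹' (X.ρ.skewFun γ ⁻¹' D) := by
    ext x
    simp only [mem_preimage, X.prodFun_map]
  rw [h2] at h
  exact h.trans hs.symm

variable (X) in
/-- The σ-algebra of the sets in `K` whose pullback to `X ⋊_1 K` under the vertical coordinate
comes from `Y ⋊_ρ K`. -/
@[reducible] def mackeySigma : MeasurableSpace K where
  MeasurableSet' s := MeasurableSet s ∧ ∃ D : Set (Stone B × K), MeasurableSet D ∧
    X.prodFun ⁻¹' D =ᵐ[prodHaar A K] Prod.snd ⁻¹' s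
  measurableSet_empty := ⟨MeasurableSet.empty, ∅, MeasurableSet.empty, EventuallyEq.rfl⟩
  measurableSet_compl := by
    rintro s ⟨hs, D, hD, h⟩
    exact ⟨hs.compl, Dᶜ, hD.compl, h.compl⟩
  measurableSet_iUnion := by
    intro s hs
    choose hs D hD h using hs
    refine ⟨MeasurableSet.iUnion hs, ⋃ n, D n, MeasurableSet.iUnion hD, ?_⟩
    rw [preimage_iUnion, preimage_iUnion]
    exact Filter.EventuallyEq.countable_iUnion h

theorem exists_isMackeyRange (hS : S.IsErgodic) (X : GroupExtension S T K) :
    ∃ H : Subgroup K, CompactSpace H ∧ X.IsMackeyRange H := by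
  have hsnd : MeasurePreserving Prod.snd (prodHaar A K) (haar K) := measurePreserving_snd
  obtain ⟨H, hH, h1, h2⟩ := exists_subgroup_of_rightInvariant (m0 := X.mackeySigma)
    (fun s hs => hs.1)
    (by
      rintro s t ⟨hs, D, hD, h⟩ ht hts
      exact ⟨ht, D, hD, h.trans (hsnd.quasiMeasurePreserving.preimage_ae_eq hts).symm⟩)
    (by
      rintro s k₀ ⟨hs, D, hD, h⟩
      exact ⟨(measurePreserving_mul_const k₀).measurable hs, rightMap k₀ ⁻¹' D,
        (measurePreserving_rightMap k₀).measurable hD, by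
          have h3 := (measurePreserving_rightMap (A := A) k₀).quasiMeasurePreserving.preimage_ae_eq h
          have h4 : rightMap k₀ ⁻¹' (X.prodFun ⁻¹' D) = X.prodFun ⁻¹' (rightMap k₀ ⁻¹' D) := by
            ext x
            simp [rightMap, prodFun, skewMap, mul_assoc]
          rw [h4] at h3
          exact h3⟩)
  refine ⟨H, hH, ?_⟩
  let χ : ProbAlgHom (MeasAlg (RightCosets.haar H)) (MeasAlg (prodHaar A K)) :=
    MeasAlg.comap _ ((RightCosets.measurePreserving_mk H).comp hsnd)
  obtain ⟨ψ, hψ⟩ := X.prodPull.exists_factor χ (by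
    intro F
    obtain ⟨⟨E, hE⟩, rfl⟩ := MeasAlg.exists_mk F
    obtain ⟨-, D, hD, h⟩ := h1 E hE
    exact ⟨MeasAlg.mk _ ⟨D, hD⟩, MeasAlg.mk_eq_mk.2 h⟩)
  have hχ : ∀ F, χ F = vertPull A K (MeasAlg.comap _ (RightCosets.measurePreserving_mk H) F) := by
    intro F
    obtain ⟨E, rfl⟩ := MeasAlg.exists_mk F
    rfl
  refine ⟨ψ, ?_, ?_, fun F => (hψ F).trans (hχ F)⟩
  · ext a
    obtain ⟨⟨D, hD⟩, rfl⟩ := MeasAlg.exists_mk a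
    rw [X.ρ.mk_mem_inv_iff]
    constructor
    · rintro ⟨F, hF⟩
      have h3 := hψ F
      obtain ⟨⟨E, hE⟩, rfl⟩ := MeasAlg.exists_mk F
      rw [hF] at h3
      exact invariant_of_preimage_prodFun_ae_eq hD (s := RightCosets.mk H ⁻¹' E) (MeasAlg.mk_eq_mk.1 h3)
    · intro hDi
      obtain ⟨s, hs, h3⟩ := exists_preimage_prodFun_ae_eq hS hD hDi
      obtain ⟨E, hE, hsE⟩ := h2 s ⟨hs, D, hD, h3⟩
      refine ⟨MeasAlg.mk _ ⟨E, hE⟩, X.prodPull.injective ?_⟩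
      rw [hψ]
      exact MeasAlg.mk_eq_mk.2 (h3.trans (hsnd.quasiMeasurePreserving.preimage_ae_eq hsE)).symm
  · intro k₀ F
    apply X.prodPull.injective
    have h3 : ∀ a, X.prodPull (rightPull B K k₀ a) = rightPull A K k₀ (X.prodPull a) := by
      intro a
      obtain ⟨⟨D, hD⟩, rfl⟩ := MeasAlg.exists_mk a
      refine congrArg (MeasAlg.mk _) (Subtype.ext ?_)
      ext x
      change rightMap k₀ (X.prodFun x) ∈ D ↔ X.prodFun (rightMap k₀ x) ∈ D
      simp [rightMap, prodFun, skewMap, mul_assoc]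
    rw [h3, hψ, hψ]
    obtain ⟨E, rfl⟩ := MeasAlg.exists_mk F
    rfl

end GroupExtension

end Skew

/-! ### Equivariant maps from a skew product to `H \ K` -/

section Base

variable (B K : Type*) [ProbAlg B] [Group K] [TopologicalSpace K]
  [IsTopologicalGroup K] [CompactSpace K] [MeasurableSpace K] [BaireMeasurableSpace K]

/-- The pullback map of the projection `(y, k) ↦ y` of a skew product onto its base. -/
noncomputable def basePull : ProbAlgHom B (MeasAlg (prodHaar B K)) where
  toFun b := MeasAlg.mk _ ⟨Prod.fst ⁻¹' Stone.clopen b, measurable_fst (Stone.measurableSet_clopen b)⟩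
  map_sup' a b := by rw [← MeasAlg.mk_sup]; exact congrArg _ (Subtype.ext (by simp))
  map_inf' a b := by rw [← MeasAlg.mk_inf]; exact congrArg _ (Subtype.ext (by simp))
  map_top' := by rw [← MeasAlg.mk_top]; exact congrArg _ (Subtype.ext (by simp))
  map_bot' := by rw [← MeasAlg.mk_bot]; exact congrArg _ (Subtype.ext (by simp))
  mu_map b := by
    change (prodHaar B K).real (Prod.fst ⁻¹' Stone.clopen b) = mu b
    rw [Measure.real, (measurePreserving_fst (μ := Stone.measure B) (ν := haar K)).measure_preimage
      (Stone.measurableSet_clopen b).nullMeasurableSet, Stone.measure_clopen,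
      ENNReal.toReal_ofReal (mu_nonneg b)]

variable {B K}

theorem basePull_eq_of_ae_eq {b : B} {F : Set (Stone B)} (hF : MeasurableSet F)
    (h : F =ᵐ[Stone.measure B] Stone.clopen b) :
    basePull B K b = MeasAlg.mk _ ⟨Prod.fst ⁻¹' F, measurable_fst hF⟩ :=
  MeasAlg.mk_eq_mk.2
    ((measurePreserving_fst (ν := haar K)).quasiMeasurePreserving.preimage_ae_eq h.symm)

/-- The projection to the base is represented by the canonical model of its pullback map. -/
theorem measRep_fst : measRep (prodHaar B K) Prod.fst measurable_fst = Stone.map (basePull B K) := by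
  have h : (Cond.ofRep (ContinuousMap.id (Stone B))).pull (basePull B K) =
      Cond.ofMeasurable (prodHaar B K) Prod.fst measurable_fst :=
    DFunLike.ext _ _ fun E => by
      have h1 := Cond.preimage_ae_eq_ofRep (ContinuousMap.id (Stone B)) E
      exact basePull_eq_of_ae_eq (K := K) (F := E.1) E.2 h1
  rw [measRep, ← h, Cond.rep_pull, Cond.rep_ofRep]
  rfl

end Base

namespace GroupExtension

variable {Γ A B K : Type*} [Group Γ] [ProbAlg A] [ProbAlg B] [Group K] [TopologicalSpace K]
  [IsTopologicalGroup K] [CompactSpace K] [T2Space K] [MeasurableSpace K] [BaireMeasurableSpace K]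
  {S : Action Γ A} {T : Action Γ B} {H : Subgroup K} [CompactSpace H]

/-- A `K^op`-equivariant factor map `Y ⋊_ρ K → H \ K` is of the form `(y, k) ↦ H Φ(y) k`. -/
theorem exists_rep_eq_mk_mul
    (ψ : ProbAlgHom (MeasAlg (RightCosets.haar H)) (MeasAlg (prodHaar B K)))
    (hψ : ∀ k₀ F, ψ (MeasAlg.comap _ (RightCosets.measurePreserving_translate k₀) F) =
      rightPull B K k₀ (ψ F)) :
    ∃ Φ : C(Stone B, K), ∀ w,
      ((Cond.ofMeasurable (RightCosets.haar H) id measurable_id).pull ψ).rep w =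
        RightCosets.mk H (Φ (measRep (prodHaar B K) Prod.fst measurable_fst w) *
          measRep (prodHaar B K) Prod.snd measurable_snd w) := by
  let κ := measRep (prodHaar B K) Prod.snd measurable_snd
  let Ψ : Cond (MeasAlg (prodHaar B K)) (RightCosets H) :=
    (Cond.ofMeasurable (RightCosets.haar H) id measurable_id).pull ψ
  -- dividing by the vertical coordinate makes the factor map invariant under `K^op`
  let q' : C(Stone (MeasAlg (prodHaar B K)), RightCosets H) :=
    ⟨fun w => RightCosets.translate (κ w)⁻¹ (Ψ.rep w),
      (RightCosets.continuous_translate H).comp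
        (Ψ.rep.continuous.prodMk κ.continuous.inv)⟩
  have hΨ : ∀ k₀ w, Ψ.rep (Stone.map (rightPull B K k₀) w) = RightCosets.translate k₀ (Ψ.rep w) := by
    intro k₀ w
    have hc : Continuous (RightCosets.translate (H := H) k₀) :=
      (RightCosets.continuous_translate H).comp (continuous_id.prodMk continuous_const)
    have h1 : Ψ.pull (rightPull B K k₀) =
        Ψ.map (⟨_, hc⟩ : C(_, _)) (measurable_of_continuous hc) :=
      DFunLike.ext _ _ fun E => (hψ k₀ (MeasAlg.mk _ E)).symm
    have h2 := congrArg Cond.rep h1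
    rw [Cond.rep_pull, Cond.rep_map] at h2
    exact congrArg (fun F : C(_, RightCosets H) => F w) h2
  have hκ : ∀ k₀ w, κ (Stone.map (rightPull B K k₀) w) = κ w * k₀ := by
    intro k₀ w
    have h1 := measRep_comap (Prod.snd : Stone B × K → K) measurable_snd _
      (measurePreserving_rightMap (A := B) k₀)
    have h2 := measRep_comp (ν := prodHaar B K) (Prod.snd : Stone B × K → K) measurable_snd
      ⟨fun k => k * k₀, continuous_mul_const k₀⟩
    exact congrArg (fun F : C(_, K) => F w) (h1.trans h2)
  let Q := Cond.ofRep q'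
  have hQ : ∀ k₀, Q.pull (rightPull B K k₀) = Q := by
    intro k₀
    apply Cond.rep_injective
    rw [Cond.rep_pull, Cond.rep_ofRep]
    ext w
    change RightCosets.translate (κ (Stone.map (rightPull B K k₀) w))⁻¹
      (Ψ.rep (Stone.map (rightPull B K k₀) w)) = RightCosets.translate (κ w)⁻¹ (Ψ.rep w)
    rw [hΨ, hκ, RightCosets.translate_translate, mul_inv_rev, mul_inv_cancel_left]
  obtain ⟨q, hq⟩ := Cond.exists_pull_eq (basePull B K) Q (by
    intro E
    obtain ⟨⟨D, hD⟩, hDE⟩ := MeasAlg.exists_mk (Q E)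
    have hDi : ∀ k₀, rightMap k₀ ⁻¹' D =ᵐ[prodHaar B K] D := by
      intro k₀
      have h1 : rightPull B K k₀ (Q E) = Q E := congrArg (fun R => R E) (hQ k₀)
      rw [← hDE] at h1
      exact MeasAlg.mk_eq_mk.1 h1
    obtain ⟨F, hF, h⟩ := exists_ae_eq_preimage_fst_of_rightInvariant hD hDi
    obtain ⟨b, hb⟩ := Stone.exists_clopen_ae_eq hF
    refine ⟨b, ?_⟩
    rw [basePull_eq_of_ae_eq hF hb, ← hDE]
    exact MeasAlg.mk_eq_mk.2 h.symm)
  obtain ⟨Φ, hΦ⟩ := Stone.exists_lift (RightCosets.mk H) (RightCosets.mk_surjective H) q.rep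
  refine ⟨Φ, fun w => ?_⟩
  have h1 : q.rep (Stone.map (basePull B K) w) = q' w := by
    have h2 := congrArg Cond.rep hq
    rw [Cond.rep_pull, Cond.rep_ofRep] at h2
    exact congrArg (fun F : C(_, RightCosets H) => F w) h2
  rw [measRep_fst, ← RightCosets.translate_mk, hΦ, h1]
  obtain ⟨k, hk⟩ := RightCosets.mk_surjective H (Ψ.rep w)
  change Ψ.rep w = RightCosets.translate (κ w) (RightCosets.translate (κ w)⁻¹ (Ψ.rep w))
  rw [← hk, RightCosets.translate_mk, RightCosets.translate_mk, inv_mul_cancel_right]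

/-- If `H` is a Mackey range, the vertical coordinate can be moved into `H` by a continuous function
on the canonical model of the base. -/
theorem IsMackeyRange.exists_mul_mem {X : GroupExtension S T K} (hH : X.IsMackeyRange H) :
    ∃ Φ : C(Stone B, K), ∀ x, Φ (Stone.map X.π x) * X.θ.rep x ∈ H := by
  obtain ⟨ψ, -, hψ, hvert⟩ := hH
  obtain ⟨Φ, hΦ⟩ := exists_rep_eq_mk_mul ψ hψ
  refine ⟨Φ, fun x => ?_⟩
  obtain ⟨w, hw⟩ := Stone.map_surjective (basePull A K) x
  have hfst : ∀ w, measRep (prodHaar A K) Prod.fst measurable_fst w = Stone.map (basePull A K) w :=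
    fun w => by rw [measRep_fst]
  let κ := measRep (prodHaar A K) Prod.snd measurable_snd
  -- the coordinates of `Π`
  have h1 : measRep (prodHaar B K) Prod.fst measurable_fst (Stone.map X.prodPull w) =
      Stone.map X.π x := by
    have h2 := measRep_comap (Prod.fst : Stone B × K → Stone B) measurable_fst _
      X.measurePreserving_prodFun
    have h3 := measRep_comp (ν := prodHaar A K) Prod.fst measurable_fst (Stone.map X.π)
    rw [← hw, ← hfst]
    exact congrArg (fun F : C(_, Stone B) => F w) (h2.trans h3)
  have h2 : measRep (prodHaar B K) Prod.snd measurable_snd (Stone.map X.prodPull w) =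
      X.θ.rep x * κ w := by
    have h2 := measRep_comap (Prod.snd : Stone B × K → K) measurable_snd _
      X.measurePreserving_prodFun
    have h3 := measRep_comp (ν := prodHaar A K) (fun z : Stone A × K => (z.1, z.2))
      (measurable_fst.prodMk measurable_snd)
      ⟨fun z : Stone A × K => X.θ.rep z.1 * z.2, by fun_prop⟩
    rw [measRep_prodMk] at h3
    rw [← hw, ← hfst]
    exact congrArg (fun F : C(_, K) => F w) (h2.trans h3)
  have h3 : ((Cond.ofMeasurable (RightCosets.haar H) id measurable_id).pull ψ).rep
      (Stone.map X.prodPull w) = RightCosets.mk H (κ w) := by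
    have h4 : ((Cond.ofMeasurable (RightCosets.haar H) id measurable_id).pull ψ).pull X.prodPull =
        Cond.ofMeasurable (prodHaar A K) (RightCosets.mk H ∘ Prod.snd)
          ((RightCosets.measurable_mk H).comp measurable_snd) :=
      DFunLike.ext _ _ fun E => hvert (MeasAlg.mk _ E)
    have h5 := congrArg Cond.rep h4
    rw [Cond.rep_pull] at h5
    exact congrArg (fun F : C(_, RightCosets H) => F w) (h5.trans (measRep_comp _ _ (RightCosets.mk H)))
  rw [hΦ, h1, h2] at h3
  have h4 := RightCosets.mk_eq_mk.1 h3.symm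
  rwa [← mul_assoc, mul_inv_cancel_right] at h4

theorem IsMackeyRange.exists_cond {X : GroupExtension S T K} (hH : X.IsMackeyRange H) :
    ∃ (Φ : Cond B K) (θs : Cond A H),
        θs.map Subtype.val measurable_subtype_coe = Φ.pull X.π * X.θ := by
  obtain ⟨Φ, hΦ⟩ := hH.exists_mul_mem
  let θs : C(Stone A, H) := ⟨fun x => ⟨_, hΦ x⟩, by
    exact Continuous.subtype_mk (by fun_prop) _⟩
  refine ⟨Cond.ofRep Φ, Cond.ofRep θs, Cond.rep_injective ?_⟩
  have h1 := Cond.rep_map (Cond.ofRep θs) (⟨Subtype.val, continuous_subtype_val⟩ : C(H, K))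
  rw [Cond.rep_ofRep] at h1
  rw [Cond.rep_mul, Cond.rep_pull, Cond.rep_ofRep]
  exact h1

end GroupExtension

/-! ### Recognizing product measures -/

section ProductMeasure

/-- The cozero sets of a space, written as the sets `{f > 0}` with `f` continuous. -/
def cozeroSets (Z : Type*) [TopologicalSpace Z] : Set (Set Z) :=
  range fun f : C(Z, ℝ) => {z | 0 < f z}

theorem isPiSystem_cozeroSets (Z : Type*) [TopologicalSpace Z] : IsPiSystem (cozeroSets Z) := by
  rintro _ ⟨f, rfl⟩ _ ⟨g, rfl⟩ -
  exact ⟨f ⊓ g, by ext z; simp⟩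

theorem univ_mem_cozeroSets (Z : Type*) [TopologicalSpace Z] : univ ∈ cozeroSets Z :=
  ⟨1, by ext z; simp⟩

theorem generateFrom_cozeroSets (Z : Type*) [TopologicalSpace Z] [m : MeasurableSpace Z]
    [hZ : BaireMeasurableSpace Z] : MeasurableSpace.generateFrom (cozeroSets Z) = m := by
  apply le_antisymm
  · refine MeasurableSpace.generateFrom_le ?_
    rintro _ ⟨f, rfl⟩
    exact measurable_real_of_continuous f.continuous measurableSet_Ioi
  · rw [hZ.eq_baire]
    refine iSup_le fun f => ?_
    rw [← BorelSpace.measurable_eq (α := ℝ), ← measurable_iff_comap_le]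
    refine measurable_of_Ioi (mδ := MeasurableSpace.generateFrom (cozeroSets Z)) fun c => ?_
    refine MeasurableSpace.measurableSet_generateFrom ⟨f - ContinuousMap.const Z c, ?_⟩
    ext z; simp

/-- The continuous functions `min 1 (n * max a 0)` increase to the indicator of `{a > 0}`. -/
theorem tendsto_min_mul_max (a : ℝ) :
    Tendsto (fun n : ℕ => min 1 ((n : ℝ) * max a 0)) atTop (𝓝 ((Ioi (0 : ℝ)).indicator 1 a)) := by
  by_cases ha : 0 < a
  · rw [indicator_of_mem (show a ∈ Ioi (0 : ℝ) from ha)]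
    refine tendsto_const_nhds.congr' ?_
    obtain ⟨N, hN⟩ := exists_nat_ge (1 / a)
    filter_upwards [eventually_ge_atTop N] with n hn
    have h1 : 1 / a ≤ n := hN.trans (Nat.cast_le.2 hn)
    rw [div_le_iff₀ ha] at h1
    rw [max_eq_left ha.le, min_eq_left h1]
    rfl
  · rw [indicator_of_notMem (show a ∉ Ioi (0 : ℝ) from ha), max_eq_right (not_lt.1 ha)]
    simp

theorem min_mul_max_mem (a : ℝ) (n : ℕ) : ‖min 1 ((n : ℝ) * max a 0)‖ ≤ 1 := by
  rw [Real.norm_eq_abs, abs_of_nonneg (by positivity)]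
  exact min_le_left _ _

theorem tendsto_integral_min_mul_max {Z : Type*} [TopologicalSpace Z] [MeasurableSpace Z]
    [BaireMeasurableSpace Z] {μ : Measure Z} [IsFiniteMeasure μ] (f : C(Z, ℝ)) :
    Tendsto (fun n : ℕ => ∫ z, min 1 ((n : ℝ) * max (f z) 0) ∂μ) atTop
      (𝓝 (μ.real {z | 0 < f z})) := by
  have hm : Measurable f := measurable_real_of_continuous f.continuous
  have hs : MeasurableSet {z | 0 < f z} := hm measurableSet_Ioi
  rw [← integral_indicator_one hs]
  refine tendsto_integral_of_dominated_convergence (fun _ => 1)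
    (fun n => (measurable_const.min ((hm.max measurable_const).const_mul _)).aestronglyMeasurable)
    (integrable_const 1) (fun n => ae_of_all _ fun z => min_mul_max_mem _ _)
    (ae_of_all _ fun z => tendsto_min_mul_max (f z))

/-- On Baire spaces, a measure is a product measure if it integrates products of continuous
functions as the product measure does. -/
theorem eq_prod_of_integral_mul {Z W : Type*} [TopologicalSpace Z] [MeasurableSpace Z]
    [BaireMeasurableSpace Z] [TopologicalSpace W] [MeasurableSpace W] [BaireMeasurableSpace W]
    {μ : Measure Z} {ν : Measure W} {lam : Measure (Z × W)} [IsFiniteMeasure μ]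
    [IsFiniteMeasure ν] [IsFiniteMeasure lam]
    (h : ∀ (f : C(Z, ℝ)) (g : C(W, ℝ)),
      ∫ x, f x.1 * g x.2 ∂lam = (∫ z, f z ∂μ) * ∫ w, g w ∂ν) : lam = μ.prod ν := by
  symm
  refine Measure.prod_eq_generateFrom (generateFrom_cozeroSets Z) (generateFrom_cozeroSets W)
    (isPiSystem_cozeroSets Z) (isPiSystem_cozeroSets W)
    ⟨fun _ => univ, fun _ => univ_mem_cozeroSets Z, fun _ => measure_lt_top _ _, iUnion_const _⟩
    ⟨fun _ => univ, fun _ => univ_mem_cozeroSets W, fun _ => measure_lt_top _ _, iUnion_const _⟩ ?_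
  rintro _ ⟨f, rfl⟩ _ ⟨g, rfl⟩
  have hf : Measurable f := measurable_real_of_continuous f.continuous
  have hg : Measurable g := measurable_real_of_continuous g.continuous
  have h1 : Tendsto (fun n : ℕ => ∫ x, min 1 ((n : ℝ) * max (f x.1) 0) *
      min 1 ((n : ℝ) * max (g x.2) 0) ∂lam) atTop
      (𝓝 (lam.real ({z | 0 < f z} ×ˢ {w | 0 < g w}))) := by
    have hs : MeasurableSet ({z | 0 < f z} ×ˢ {w | 0 < g w}) :=
      (hf measurableSet_Ioi : MeasurableSet {z | 0 < f z}).prod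
        (hg measurableSet_Ioi : MeasurableSet {w | 0 < g w})
    rw [← integral_indicator_one hs]
    refine tendsto_integral_of_dominated_convergence (fun _ => 1)
      (fun n => Measurable.aestronglyMeasurable ?_) (integrable_const 1)
      (fun n => ae_of_all _ fun x => ?_) (ae_of_all _ fun x => ?_)
    · exact (measurable_const.min (((hf.comp measurable_fst).max measurable_const).const_mul _)).mul
        (measurable_const.min (((hg.comp measurable_snd).max measurable_const).const_mul _))
    · rw [norm_mul]
      exact mul_le_one₀ (min_mul_max_mem _ _) (norm_nonneg _) (min_mul_max_mem _ _)
    · have h2 := (tendsto_min_mul_max (f x.1)).mul (tendsto_min_mul_max (g x.2))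
      convert h2 using 2
      by_cases h3 : 0 < f x.1 <;> by_cases h4 : 0 < g x.2 <;> simp [indicator, h3, h4]
  have h2 := (tendsto_integral_min_mul_max (μ := μ) f).mul (tendsto_integral_min_mul_max (μ := ν) g)
  have h3 := tendsto_nhds_unique (h1.congr fun n : ℕ =>
    h ⟨fun z => min 1 ((n : ℝ) * max (f z) 0), by fun_prop⟩
      ⟨fun w => min 1 ((n : ℝ) * max (g w) 0), by fun_prop⟩) h2
  have h4 := congrArg ENNReal.ofReal h3
  rwa [ENNReal.ofReal_mul measureReal_nonneg, ofReal_measureReal, ofReal_measureReal,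
    ofReal_measureReal] at h4

theorem measurable_complex_of_continuous {Z : Type*} [TopologicalSpace Z] [MeasurableSpace Z]
    [BaireMeasurableSpace Z] (f : C(Z, ℂ)) : Measurable f := by
  have h : (f : Z → ℂ) = fun z => ((f z).re : ℂ) + (f z).im * Complex.I := by
    funext z; exact (Complex.re_add_im _).symm
  rw [h]
  exact (Complex.measurable_ofReal.comp (measurable_real_of_continuous
    (Complex.continuous_re.comp f.continuous))).add ((Complex.measurable_ofReal.comp
    (measurable_real_of_continuous (Complex.continuous_im.comp f.continuous))).mul_const _)

end ProductMeasure

/-! ### Slices and the joint distribution of `π` and `θs` -/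

theorem prod_restrict_haar_absolutelyContinuous {A K : Type*} [ProbAlg A] [Group K]
    [TopologicalSpace K] [IsTopologicalGroup K] [CompactSpace K] [MeasurableSpace K]
    [BaireMeasurableSpace K] (C : Set K) :
    (Stone.measure A).prod ((haar K).restrict C) ≪ prodHaar A K :=
  Measure.AbsolutelyContinuous.rfl.prod Measure.restrict_le_self.absolutelyContinuous

namespace GroupExtension

variable {Γ A B K : Type*} [Group Γ] [ProbAlg A] [ProbAlg B] [Group K] [TopologicalSpace K]
  [IsTopologicalGroup K] [CompactSpace K] [T2Space K] [MeasurableSpace K] [BaireMeasurableSpace K]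
  {S : Action Γ A} {T : Action Γ B} {H : Subgroup K} {X : GroupExtension S T K}

/-- If `H` is a Mackey range, the invariant sets of `Y ⋊_ρ K` are functions of the coset `Hk` on
`X ⋊_1 K`. -/
theorem IsMackeyRange.exists_preimage_ae_eq (hH : X.IsMackeyRange H) {D : Set (Stone B × K)}
    (hD : MeasurableSet D) (hDi : ∀ γ, X.ρ.skewFun γ ⁻¹' D =ᵐ[prodHaar B K] D) :
    ∃ E : Set (RightCosets H), MeasurableSet E ∧
      X.prodFun ⁻¹' D =ᵐ[prodHaar A K] Prod.snd ⁻¹' (RightCosets.mk H ⁻¹' E) := by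
  obtain ⟨ψ, hr, -, hv⟩ := hH
  have h1 : MeasAlg.mk _ ⟨D, hD⟩ ∈ range ψ := by
    rw [hr, X.ρ.mk_mem_inv_iff]
    exact hDi
  obtain ⟨F, hF⟩ := h1
  have h2 := hv F
  obtain ⟨⟨E, hE⟩, rfl⟩ := MeasAlg.exists_mk F
  rw [hF] at h2
  exact ⟨E, hE, MeasAlg.mk_eq_mk.1 h2⟩

variable (X) in
/-- The image under `Π` of the measure of `X ⋊_1 K`, restricted to the set of points whose
vertical coordinate lies in `C`. -/
noncomputable def sliceMeasure (C : Set K) : Measure (Stone B × K) :=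
  ((Stone.measure A).prod ((haar K).restrict C)).map X.prodFun

instance (C : Set K) : IsFiniteMeasure (X.sliceMeasure C) := by
  rw [sliceMeasure]; infer_instance

theorem measurePreserving_skewFun_sliceMeasure (C : Set K) (γ : Γ) :
    MeasurePreserving (X.ρ.skewFun γ) (X.sliceMeasure C) (X.sliceMeasure C) := by
  have hm := X.measurePreserving_prodFun.measurable
  have hγ := (X.ρ.measurePreserving_skewFun γ).measurable
  refine ⟨hγ, ?_⟩
  have h1 : MeasurePreserving (Prod.map (Stone.map (S.pull γ)) id)
      ((Stone.measure A).prod ((haar K).restrict C)) ((Stone.measure A).prod ((haar K).restrict C)) :=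
    (Stone.measurePreserving_map (S.pull γ)).prod (MeasurePreserving.id _)
  rw [sliceMeasure, Measure.map_map hγ hm]
  conv_rhs => rw [← h1.map_eq, Measure.map_map hm h1.measurable]
  congr 1
  funext x
  exact (X.prodFun_map γ x).symm

theorem sliceMeasure_absolutelyContinuous (C : Set K) : X.sliceMeasure C ≪ prodHaar B K := by
  have h := (prod_restrict_haar_absolutelyContinuous (A := A) C).map
    X.measurePreserving_prodFun.measurable
  rwa [X.measurePreserving_prodFun.map_eq] at h

/-- If `H` is a Mackey range, the slices of `X ⋊_1 K` over `C` and `h⁻¹ C` have the same image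
in `Y ⋊_ρ K`: the images are invariant, and on invariant sets they are computed in `H \ K`. -/
theorem IsMackeyRange.sliceMeasure_preimage (hH : X.IsMackeyRange H) {h : K} (hh : h ∈ H) {C : Set K}
    (hC : MeasurableSet C) : X.sliceMeasure ((h * ·) ⁻¹' C) = X.sliceMeasure C := by
  have hmp : MeasurePreserving (h * ·) (haar K) (haar K) := by
    simpa using measurePreserving_mul h 1
  refine measure_eq_of_eq_on_invariant (τ := X.ρ.skewFun) X.ρ.measurePreserving_skewFun
    X.ρ.skewFun_inv_skewFun (sliceMeasure_absolutelyContinuous _)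
    (sliceMeasure_absolutelyContinuous _) (measurePreserving_skewFun_sliceMeasure _)
    (measurePreserving_skewFun_sliceMeasure _) fun D hD hDi => ?_
  obtain ⟨E, hE, hDE⟩ := hH.exists_preimage_ae_eq hD hDi
  have hE' := RightCosets.measurable_mk H hE
  have key : ∀ C, MeasurableSet C → X.sliceMeasure C D = haar K (RightCosets.mk H ⁻¹' E ∩ C) := by
    intro C hC
    rw [sliceMeasure, Measure.map_apply X.measurePreserving_prodFun.measurable hD,
      measure_congr ((prod_restrict_haar_absolutelyContinuous C).ae_le hDE),
      ← univ_prod, Measure.prod_prod, measure_univ, one_mul, Measure.restrict_apply hE']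
  rw [key C hC, key _ (hmp.measurable hC), ← hmp.measure_preimage (hE'.inter hC).nullMeasurableSet]
  congr 1
  ext k
  have : RightCosets.mk H (h * k) = RightCosets.mk H k :=
    RightCosets.mk_eq_mk.2 (by simpa using H.inv_mem hh)
  simp [this]

/-- If `(Φ ∘ π) θ` takes values in a Mackey range `H`, right translating these values by elements
of `H` does not change their joint distribution with `π`. -/
theorem IsMackeyRange.integral_mul_eq (hH : X.IsMackeyRange H) {Φ : C(Stone B, K)}
    {t : C(Stone A, H)} (ht : ∀ x, (t x : K) = Φ (Stone.map X.π x) * X.θ.rep x)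
    (f : C(Stone B, ℝ)) (g : C(K, ℝ)) {h : K} (hh : h ∈ H) :
    ∫ x, f (Stone.map X.π x) * g (t x * h) ∂(Stone.measure A) =
      ∫ x, f (Stone.map X.π x) * g (t x) ∂(Stone.measure A) := by
  let F : K → Stone A → ℝ := fun k x => f (Stone.map X.π x) * g (t x * k)
  have hFc : Continuous fun z : K × Stone A => F z.1 z.2 := by fun_prop
  let I : C(K, ℝ) := ⟨fun k => ∫ x, F k x ∂(Stone.measure A), by
    simpa using continuous_integral_mul (μ := Stone.measure A) (f := fun _ => 1) measurable_const
      (by simp) hFc⟩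
  have hIm : Measurable I := measurable_real_of_continuous I.continuous
  have hIi : Integrable I (haar K) :=
    Integrable.of_bound hIm.aestronglyMeasurable _ (ae_of_all _ I.norm_coe_le_norm)
  have hmp : ∀ a : K, MeasurePreserving (a * ·) (haar K) (haar K) := fun a => by
    simpa using measurePreserving_mul a 1
  -- the integral of `I` over `C` is an integral against the image of the slice over `C`
  let G : C(Stone B × K, ℝ) := ⟨fun z => f z.1 * g (Φ z.1 * z.2), by fun_prop⟩
  have hslice : ∀ C, ∫ k in C, I k ∂(haar K) = ∫ z, G z ∂(X.sliceMeasure C) := by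
    intro C
    have hGm : Measurable G := measurable_real_of_continuous G.continuous
    have hGcomp : ∀ x : Stone A × K, G (X.prodFun x) = F x.2 x.1 := by
      intro x
      change f (Stone.map X.π x.1) * g (Φ (Stone.map X.π x.1) * (X.θ.rep x.1 * x.2)) = _
      rw [← mul_assoc, ← ht]
    rw [sliceMeasure, integral_map X.measurePreserving_prodFun.measurable.aemeasurable
      hGm.aestronglyMeasurable, integral_prod_symm]
    · simp only [hGcomp]; rfl
    · exact Integrable.of_bound (hGm.comp X.measurePreserving_prodFun.measurable).aestronglyMeasurable
        ‖G‖ (ae_of_all _ fun x => G.norm_coe_le_norm _)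
  -- so `I` and its left translate have the same integrals over measurable sets
  let I' : C(K, ℝ) := I.comp ⟨(h⁻¹ * ·), continuous_const_mul _⟩
  have hI'm : Measurable I' := measurable_real_of_continuous I'.continuous
  have hI'i : Integrable I' (haar K) :=
    Integrable.of_bound hI'm.aestronglyMeasurable _ (ae_of_all _ I'.norm_coe_le_norm)
  have hII' : I = I' := by
    refine eq_of_ae_eq_haar (hIi.ae_eq_of_forall_setIntegral_eq _ _ hI'i fun C hC _ => ?_)
    have h1 : ∫ k in C, I k ∂(haar K) = ∫ k in (h * ·) ⁻¹' C, I k ∂(haar K) := by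
      rw [hslice, hslice, hH.sliceMeasure_preimage hh hC]
    rw [h1]
    have h2 := (hmp h).restrict_preimage hC
    have h3 : AEStronglyMeasurable I' ((haar K).restrict C) := hI'm.aestronglyMeasurable
    rw [← h2.map_eq] at h3
    have h4 := integral_map (hmp h).measurable.aemeasurable h3
    rw [h2.map_eq] at h4
    rw [h4]
    simp [I']
  have h1 := congrArg (fun J : C(K, ℝ) => J h) hII'
  simpa [I, I', F] using h1

variable [CompactSpace H]

/-- If `(Φ ∘ π) θ` takes values in a Mackey range `H`, it is Haar distributed in `H` and
independent of `π`. -/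
theorem IsMackeyRange.map_eq_prod (hH : X.IsMackeyRange H) {Φ : C(Stone B, K)}
    {t : C(Stone A, H)} (ht : ∀ x, (t x : K) = Φ (Stone.map X.π x) * X.θ.rep x) :
    Measure.map (fun x => (Stone.map X.π x, t x)) (Stone.measure A) =
      (Stone.measure B).prod (haar H) := by
  have hπ := Stone.measurePreserving_map X.π
  have htm : Measurable t := measurable_of_continuous t.continuous
  have hm : Measurable fun x => (Stone.map X.π x, t x) := hπ.measurable.prodMk htm
  refine eq_prod_of_integral_mul fun f g => ?_
  have hf : Measurable f := measurable_real_of_continuous f.continuous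
  have hg : Measurable g := measurable_real_of_continuous g.continuous
  have hHc : IsClosed (H : Set K) := (isCompact_iff_compactSpace.2 ‹_›).isClosed
  obtain ⟨g', hg'⟩ := ContinuousMap.exists_extension hHc.isClosedEmbedding_subtypeVal g
  have hgg : ∀ a : H, g' a = g a := fun a => congrArg (fun F : C(H, ℝ) => F a) hg'
  have hfg : Measurable fun x : Stone B × H => f x.1 * g x.2 :=
    (hf.comp measurable_fst).mul (hg.comp measurable_snd)
  rw [integral_map hm.aemeasurable hfg.aestronglyMeasurable]
  have h1 : ∀ a : H, ∫ x, f (Stone.map X.π x) * g (t x * a) ∂(Stone.measure A) =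
      ∫ x, f (Stone.map X.π x) * g (t x) ∂(Stone.measure A) := by
    intro a
    simpa [← hgg] using hH.integral_mul_eq ht f g' a.2
  -- averaging over `H`
  have h2 : ∫ a : H, ∫ x, f (Stone.map X.π x) * g (t x * a) ∂(Stone.measure A) ∂(haar H) =
      ∫ x, f (Stone.map X.π x) * g (t x) ∂(Stone.measure A) := by
    simp only [h1, integral_const, probReal_univ, one_smul]
  let G : C(H × Stone A, ℝ) := ⟨fun z => f (Stone.map X.π z.2) * g (t z.2 * z.1), by fun_prop⟩
  have hGi : Integrable G ((haar H).prod (Stone.measure A)) :=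
    Integrable.of_bound (measurable_real_of_continuous G.continuous).aestronglyMeasurable ‖G‖
      (ae_of_all _ G.norm_coe_le_norm)
  rw [← h2, integral_integral_swap hGi]
  have h3 : ∀ x, ∫ a : H, f (Stone.map X.π x) * g (t x * a) ∂(haar H) =
      f (Stone.map X.π x) * ∫ a, g a ∂(haar H) := by
    intro x
    have hmp : MeasurePreserving (t x * ·) (haar H) (haar H) := by
      simpa using measurePreserving_mul (t x) 1
    have h4 := hg.aestronglyMeasurable (μ := haar H)
    rw [← hmp.map_eq] at h4
    have h5 := integral_map hmp.measurable.aemeasurable h4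
    rw [hmp.map_eq] at h5
    rw [integral_const_mul, h5]
  simp only [h3]
  rw [integral_mul_const]
  congr 1
  have h4 := hf.aestronglyMeasurable (μ := Stone.measure B)
  rw [← hπ.map_eq] at h4
  have h5 := integral_map hπ.measurable.aemeasurable h4
  rw [hπ.map_eq] at h5
  exact h5.symm

end GroupExtension

end MackeyZimmer

open MackeyZimmer
theorem proposition6p1 {Γ A B K : Type*} [Group Γ] [ProbAlg A] [ProbAlg B] [Group K]
    [TopologicalSpace K] [IsTopologicalGroup K] [CompactSpace K] [T2Space K] [MeasurableSpace K]
    [BaireMeasurableSpace K] (S : Action Γ A) (T : Action Γ B) (hS : S.IsErgodic)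
    (hT : T.IsErgodic) (X : GroupExtension S T K) :
    (∃ H : Subgroup K, CompactSpace H ∧ X.IsMackeyRange H) ∧
    ∀ (H : Subgroup K) [CompactSpace H], X.IsMackeyRange H →
      (∃ (Φ : Cond B K) (θs : Cond A H),
        θs.map Subtype.val measurable_subtype_coe = Φ.pull X.π * X.θ) ∧
      ∀ (Φ : Cond B K) (θs : Cond A H),
        θs.map Subtype.val measurable_subtype_coe = Φ.pull X.π * X.θ →
        (∀ (f : C(Stone B, ℂ)) (g : C(H, ℂ)),
          ∫ x, f (Stone.map X.π x) * g (θs.rep x) ∂(Stone.measure A) =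
            (∫ y, f y ∂(Stone.measure B)) * ∫ h, g h ∂(haar H)) ∧
        Measure.map (fun x => (Stone.map X.π x, θs.rep x)) (Stone.measure A) =
          (Stone.measure B).prod (haar H) := by
  refine ⟨GroupExtension.exists_isMackeyRange hS X, fun H _ hH => ⟨hH.exists_cond, ?_⟩⟩
  intro Φ θs hθs
  have ht : ∀ x, (θs.rep x : K) = Φ.rep (Stone.map X.π x) * X.θ.rep x := by
    intro x
    have h1 := Cond.rep_map θs (⟨Subtype.val, continuous_subtype_val⟩ : C(H, K))
    have h2 := congrArg Cond.rep hθs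
    rw [Cond.rep_mul, Cond.rep_pull] at h2
    exact congrArg (fun F : C(Stone A, K) => F x) (h1.symm.trans h2)
  have hmap := hH.map_eq_prod ht
  refine ⟨fun f g => ?_, hmap⟩
  have hm : Measurable fun x => (Stone.map X.π x, θs.rep x) :=
    (Stone.measurePreserving_map X.π).measurable.prodMk
      (measurable_of_continuous θs.rep.continuous)
  rw [← integral_prod_mul, ← hmap, integral_map hm.aemeasurable]
  exact (((measurable_complex_of_continuous f).comp measurable_fst).mul
    ((measurable_complex_of_continuous g).comp measurable_snd)).aestronglyMeasurable
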